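/- **Setting.** Let $\gamma_1,\dots,\gamma_K$ be smooth oriented embedded open arcs in $\mathbb C$ (bounded or not), each end of which runs to a point of a finite set $N\ni 0$ of nodes or to $\infty$, and which meet each other only at nodes; put $\Sigma=\bigcup_j\gamma_j$. Let $w_j$ be weights on the arcs, analytic near every point of $\gamma_j\setminus N$ (for instance semiclassical weights $w_j=\varkappa_j e^{-V}$ with $V'$ rational), let $n\ge 0$ and $\ell$ be integers, and assume that $\mu_k=\sum_j\int_{\gamma_j}x^k w_j(x)\,dx$ converges absolutely for $\ell-n+1\le k\le \ell+n$. Put $\Delta_n^\ell=\det[\mu_{\ell-i+j}]_{i,j=0}^{n-1}$, $\Delta_0^\ell=1$. Fix which side of the oriented arcs is called the $+$ side, and let $\varepsilon=1$ if it is the right side and $\varepsilon=-1$ if it is the left side. Let $\Gamma=\Gamma^{(n,\ell)}$ be a $2\times2$ matrix function, holomorphic off $\Sigma\cup N$, with one-sided boundary values at the points of $\Sigma\setminus N$ satisfying $\Gamma_+=\Gamma_-M$, $M=\begin{pmatrix}1&w_j\\0&1\end{pmatrix}$ on $\gamma_j$, such that $\Gamma(z)=(\mathbf 1+O(z^{-1}))\,\mathrm{diag}(z^{n},z^{-\ell-1})$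 as $z\to\infty$ and $\Gamma(z)\,\mathrm{diag}(1,z^{-(n-\ell-1)})=o(1/|z-a|)$ as $z\to a$ for each $a\in N$ (in particular $O(1)$ at $0$, or logarithmic growth at hard edges, is allowed). For a deformation of the jump matrices let $\Xi_\partial=\partial M\,M^{-1}$ and $$\omega_M(\partial;[\Gamma])=-\int_{\Sigma}\mathrm{Tr}\big(\Gamma_-^{-1}\Gamma_-'\,\Xi_\partial\big)\frac{dx}{2\pi i}.$$ **Theorem.** In each of the following situations $\Delta_n^\ell\ne0$ at the point where $\Gamma$ solves the problem, $\Delta_n^\ell$ is differentiable there, and the integrals converge absolutely. 1. *Deformation of the weights.* If $w_j=w_j(x;s)$ depends holomorphically on $s$ in an open set and the integrals of $|x^kw_j|$, $\ell-n+1\le k\le\ell+n$, are dominated uniformly in $s$, and if $\Gamma$ solves the problem at $s_0$, then at $s_0$ $$\partial_s\ln\Delta_n^\ell=\varepsilon\,\omega_M(\partial_s;[\Gamma^{(n,\ell)}]).$$ 2. *Displacement of a hard edge.* Let $b$ be a node (with $b\neq0$ or $n\le\ell+1$), $0<r<R$, with no other node in $|z-b|\le R$, suppose that the weights of the arcs ending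 at $b$ are analytic on $|z-b|\le r$, that each arc meets $|z-b|=R$ in finitely many points, and that the $w_j$ are also absolutely integrable. Move $b$ to $s$, $|s-b|<r$, by modifying the arcs that end at $b$ only inside $|z-b|<r$, keeping them $C^1$ and of finite length inside that disk. Let $C(z)=\sum_j\int_{\gamma_j}\frac{w_j(x)}{x-z}\frac{dx}{2\pi i}$, and let $\widetilde\Gamma=\Gamma\begin{pmatrix}1&\varepsilon C\\0&1\end{pmatrix}$ for $|z-b|<R$ and $\widetilde\Gamma=\Gamma$ elsewhere. This has no jump on the arcs inside the circle and has the jump matrix $\begin{pmatrix}1&-C\\0&1\end{pmatrix}$ on the counterclockwise circle $|z-b|=R$. Then, with $\omega_M$ taken for these jump matrices on $\Sigma\cup\{|z-b|=R\}$, at $s=b$ $$\partial_b\ln\Delta_n^\ell=\varepsilon\,\omega_M(\partial_b;[\widetilde\Gamma^{(n,\ell)}]).$$ 3. *Derivatives in the coefficients.* If $w_j=\varkappa_j\rho_j$ with $\varkappa_j\in\mathbb C$ (for instance $\rho_j=e^{-V}$), the $\rho_j$ being analytic near $\gamma_j\setminus N$ with $x^k\rho_j$ absolutely integrable on $\gamma_j$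 for $\ell-n+1\le k\le\ell+n$, then $$\partial_{\varkappa_j}\ln\Delta_n^\ell=\varepsilon\int_{\gamma_j}K^{(n,\ell)}(x,x)\,\rho_j(x)\frac{dx}{2\pi i},\qquad K^{(n,\ell)}(x,y)=\frac{[\Gamma^{(n,\ell)}(x)^{-1}\Gamma^{(n,\ell)}(y)]_{21}}{x-y},$$ where $K^{(n,\ell)}(x,x)$ is the limit of $K^{(n,\ell)}$ on the diagonal, which exists at the points of $\gamma_j\setminus N$. 4. *Christoffel–Darboux kernel.* If $n\ge1$, $\ell=n-1$ and $p_0,\dots,p_n$ are monic polynomials, $\deg p_i=i$, with $\sum_j\int_{\gamma_j}p_ip_kw_j\,dx=h_i\delta_{ik}$ for $i\le n$, $k<n$, then for $x\ne y$ off $\Sigma\cup N$ $$K^{(n,n-1)}(x,y)=\frac{2\pi i\,\varepsilon}{h_{n-1}}\,\frac{p_n(x)p_{n-1}(y)-p_{n-1}(x)p_n(y)}{x-y}=2\pi i\,\varepsilon\sum_{i=0}^{n-1}\frac{p_i(x)p_i(y)}{h_i}.$$ -/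

import Mathlib

open Set Filter Topology MeasureTheory Asymptotics Bornology

/-- `∫_γ f(x) dx` along the arc `γ`, parametrized by the open interval `(0,1)`. -/
noncomputable def arcIntegral (γ : ℝ → ℂ) (f : ℂ → ℂ) : ℂ :=
  ∫ t in Ioo (0 : ℝ) 1, f (γ t) * deriv γ t

/-- Absolute convergence of `∫_γ f(x) dx`. -/
def ArcIntegrable (γ : ℝ → ℂ) (f : ℂ → ℂ) : Prop :=
  IntegrableOn (fun t => f (γ t) * deriv γ t) (Ioo (0 : ℝ) 1)

/-- A finite collection of smooth oriented embedded open arcs `γ_j` in the plane, bounded or not.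
Different arcs meet only at a finite set of nodes; each end of an arc runs into a node or to
infinity. The origin, where a growth condition is imposed, counts as a node. -/
structure ContourSystem (ι : Type*) where
  path : ι → ℝ → ℂ
  nodes : Finset ℂ
  zero_mem : (0 : ℂ) ∈ nodes
  smooth : ∀ j, ContDiffOn ℝ 2 (path j) (Ioo 0 1)
  regular : ∀ j, ∀ t ∈ Ioo (0 : ℝ) 1, deriv (path j) t ≠ 0
  injOn : ∀ j, InjOn (path j) (Ioo 0 1)
  source : ∀ j, (∃ a ∈ nodes, Tendsto (path j) (𝓝[>] 0) (𝓝 a)) ∨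
    Tendsto (path j) (𝓝[>] 0) (cobounded ℂ)
  target : ∀ j, (∃ a ∈ nodes, Tendsto (path j) (𝓝[<] 1) (𝓝 a)) ∨
    Tendsto (path j) (𝓝[<] 1) (cobounded ℂ)
  meet : ∀ i j, i ≠ j → ∀ s ∈ Ioo (0 : ℝ) 1, ∀ t ∈ Ioo (0 : ℝ) 1,
    path i s = path j t → path i s ∈ nodes

/-- The complement of the contours and of the nodes. -/
def ContourSystem.domain {ι : Type*} (C : ContourSystem ι) : Set ℂ :=
  ((⋃ j, C.path j '' Ioo (0 : ℝ) 1) ∪ (C.nodes : Set ℂ))ᶜ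

/-- Which side of an oriented arc is its `+` side. -/
inductive PlusSide
  | left
  | right

/-- The sign attached to the convention: `1` if `+` is the right side, `-1` if it is the left. -/
noncomputable def PlusSide.sign : PlusSide → ℂ
  | .left => -1
  | .right => 1

noncomputable def PlusSide.plusFilter : PlusSide → Filter ℝ
  | .left => 𝓝[>] 0
  | .right => 𝓝[<] 0

noncomputable def PlusSide.minusFilter : PlusSide → Filter ℝ
  | .left => 𝓝[<] 0
  | .right => 𝓝[>] 0

/-- Points near the arc: `(t, h) ↦ γ(t) + i h γ'(t)`, to the left of the oriented arc for small
`h > 0` and to its right for small `h < 0`. -/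
noncomputable def collar (γ : ℝ → ℂ) (p : ℝ × ℝ) : ℂ :=
  γ p.1 + Complex.I * p.2 * deriv γ p.1

/-- Entrywise `z`-derivative of a matrix function. -/
noncomputable def matDeriv (Γ : ℂ → Matrix (Fin 2) (Fin 2) ℂ) (z : ℂ) :
    Matrix (Fin 2) (Fin 2) ℂ :=
  Matrix.of fun a b => deriv (fun y => Γ y a b) z

/-- Entrywise boundary value at `γ t` from the `-` side. -/
noncomputable def minusValue (σ : PlusSide) (γ : ℝ → ℂ) (Γ : ℂ → Matrix (Fin 2) (Fin 2) ℂ)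
    (t : ℝ) : Matrix (Fin 2) (Fin 2) ℂ :=
  Matrix.of fun a b =>
    limUnder (𝓝 t ×ˢ σ.minusFilter) (fun p : ℝ × ℝ => Γ (collar γ p) a b)

/-- The jump matrix with weight `w`. -/
noncomputable def jumpMatrix (w : ℂ) : Matrix (Fin 2) (Fin 2) ℂ := !![1, w; 0, 1]

/-- `Γ` solves the Riemann-Hilbert problem with indices `n, ℓ` and jump weight `w j` on the `j`-th
arc. Near a node `Γ(z) diag(1, z^(-(n-ℓ-1)))` is required to be `o(1/|z - a|)`. This is implied by
boundedness, by logarithmic growth at hard edges, and by integrable algebraic singularities; the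
diagonal factor only matters at the node `0`. -/
structure IsSolution {ι : Type*} (σ : PlusSide) (C : ContourSystem ι) (n : ℕ) (ℓ : ℤ)
    (w : ι → ℂ → ℂ) (Γ : ℂ → Matrix (Fin 2) (Fin 2) ℂ) : Prop where
  holo : ∀ a b, DifferentiableOn ℂ (fun z => Γ z a b) C.domain
  jump : ∀ j, ∀ t ∈ Ioo (0 : ℝ) 1, C.path j t ∉ C.nodes →
    ∃ P N : Matrix (Fin 2) (Fin 2) ℂ,
      Tendsto (fun p => Γ (collar (C.path j) p)) (𝓝 t ×ˢ σ.plusFilter) (𝓝 P) ∧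
      Tendsto (fun p => Γ (collar (C.path j) p)) (𝓝 t ×ˢ σ.minusFilter) (𝓝 N) ∧
      P = N * jumpMatrix (w j (C.path j t))
  node : ∀ a ∈ C.nodes, ∀ i k,
    (fun z => (Γ z * Matrix.diagonal ![1, z ^ (-((n : ℤ) - ℓ - 1))]) i k)
      =o[𝓝[C.domain] a] fun z => (z - a)⁻¹
  infinity : ∀ i k,
    (fun z => (Γ z * Matrix.diagonal ![z ^ (-(n : ℤ)), z ^ (ℓ + 1)] - 1) i k)
      =O[cobounded ℂ ⊓ 𝓟 C.domain] fun z => z⁻¹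

/-- `μ_k = ∑_j ∫_{γ_j} x^k w_j(x) dx`. -/
noncomputable def moment {ι : Type*} [Fintype ι] (γ : ι → ℝ → ℂ) (w : ι → ℂ → ℂ) (k : ℤ) : ℂ :=
  ∑ j, arcIntegral (γ j) fun x => x ^ k * w j x

/-- The shifted Toeplitz determinant `Δ_n^ℓ = det [μ_{ℓ - i + j}]`, `0 ≤ i, j < n`. -/
noncomputable def toeplitzDet {ι : Type*} [Fintype ι] (γ : ι → ℝ → ℂ) (w : ι → ℂ → ℂ)
    (n : ℕ) (ℓ : ℤ) : ℂ :=
  Matrix.det (Matrix.of fun i j : Fin n => moment γ w (ℓ - (i : ℤ) + (j : ℤ)))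

/-- The exponents of the moments that are required to converge. -/
def momentRange (n : ℕ) (ℓ : ℤ) : Set ℤ := Icc (ℓ - n + 1) (ℓ + n)

/-- Weights on the arcs, analytic near each point of the arcs that is not a node, with absolutely
convergent moments for the exponents in `S`. -/
structure AdmissibleWeight {ι : Type*} (C : ContourSystem ι) (S : Set ℤ)
    (w : ι → ℂ → ℂ) : Prop where
  analytic : ∀ j, ∀ t ∈ Ioo (0 : ℝ) 1, C.path j t ∉ C.nodes → AnalyticAt ℂ (w j) (C.path j t)
  moments : ∀ j, ∀ k ∈ S, ArcIntegrable (C.path j) fun x => x ^ k * w j x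

/-- A holomorphic one-parameter deformation `w s j` of the weights, for `s` in the open set `U`,
whose moment integrals converge absolutely and uniformly (dominated) in `s`. -/
structure WeightDeformation {ι : Type*} (C : ContourSystem ι) (S : Set ℤ) (U : Set ℂ)
    (w : ℂ → ι → ℂ → ℂ) : Prop where
  isOpen : IsOpen U
  admissible : ∀ s ∈ U, AdmissibleWeight C S (w s)
  holo : ∀ j, ∀ t ∈ Ioo (0 : ℝ) 1, C.path j t ∉ C.nodes →
    DifferentiableOn ℂ (fun s => w s j (C.path j t)) U
  dominated : ∀ j, ∀ k ∈ S, ∃ g : ℝ → ℝ, IntegrableOn g (Ioo 0 1) ∧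
    ∀ s ∈ U, ∀ t ∈ Ioo (0 : ℝ) 1, C.path j t ∉ C.nodes →
      ‖C.path j t ^ k * w s j (C.path j t) * deriv (C.path j) t‖ ≤ g t

/-- `Ξ_∂ = ∂M M⁻¹` on the `j`-th arc, at the point `z` and the parameter value `s₀`. -/
noncomputable def jumpVariation {κ : Type*} (M : ℂ → κ → ℂ → Matrix (Fin 2) (Fin 2) ℂ) (s₀ : ℂ)
    (j : κ) (z : ℂ) : Matrix (Fin 2) (Fin 2) ℂ :=
  (Matrix.of fun a b => deriv (fun s => M s j z a b) s₀) * (M s₀ j z)⁻¹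

/-- The integrand of Malgrange's form on the `j`-th arc, as a function of the arc parameter. -/
noncomputable def malgrangeIntegrand {κ : Type*} (σ : PlusSide) (γ : κ → ℝ → ℂ)
    (Γ : ℂ → Matrix (Fin 2) (Fin 2) ℂ) (M : ℂ → κ → ℂ → Matrix (Fin 2) (Fin 2) ℂ) (s₀ : ℂ)
    (j : κ) (t : ℝ) : ℂ :=
  Matrix.trace ((minusValue σ (γ j) Γ t)⁻¹ * minusValue σ (γ j) (matDeriv Γ) t *
    jumpVariation M s₀ j (γ j t)) * deriv (γ j) t / (2 * Real.pi * Complex.I)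

/-- Malgrange's form `ω_M(∂; [Γ]) = - ∫_Σ Tr(Γ₋⁻¹ Γ₋' Ξ_∂) dx/(2πi)` for the family of jump
matrices `M s`, at `s = s₀`. -/
noncomputable def malgrangeForm {κ : Type*} [Fintype κ] (σ : PlusSide) (γ : κ → ℝ → ℂ)
    (Γ : ℂ → Matrix (Fin 2) (Fin 2) ℂ) (M : ℂ → κ → ℂ → Matrix (Fin 2) (Fin 2) ℂ)
    (s₀ : ℂ) : ℂ :=
  -∑ j, ∫ t in Ioo (0 : ℝ) 1, malgrangeIntegrand σ γ Γ M s₀ j t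

/-- `K(x,y) = [Γ(x)⁻¹ Γ(y)]₂₁ / (x - y)`. -/
noncomputable def cdKernel (Γ : ℂ → Matrix (Fin 2) (Fin 2) ℂ) (x y : ℂ) : ℂ :=
  ((Γ x)⁻¹ * Γ y) 1 0 / (x - y)

/-- Pairs of distinct points off the contours, approaching the diagonal point `(x, x)`. -/
noncomputable def diagFilter {ι : Type*} (C : ContourSystem ι) (x : ℂ) : Filter (ℂ × ℂ) :=
  𝓝 (x, x) ⊓ 𝓟 {p | p.1 ∈ C.domain ∧ p.2 ∈ C.domain ∧ p.1 ≠ p.2}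

/-- The value `K(x,x)` on the diagonal, also for `x` on the contours. -/
noncomputable def cdDiag {ι : Type*} (C : ContourSystem ι) (Γ : ℂ → Matrix (Fin 2) (Fin 2) ℂ)
    (x : ℂ) : ℂ :=
  limUnder (diagFilter C x) fun p => cdKernel Γ p.1 p.2

/-- The `j`-th arc starts at, respectively ends at, `b`. -/
def ContourSystem.StartsAt {ι : Type*} (C : ContourSystem ι) (j : ι) (b : ℂ) : Prop :=
  Tendsto (C.path j) (𝓝[>] 0) (𝓝 b)

def ContourSystem.EndsAt {ι : Type*} (C : ContourSystem ι) (j : ι) (b : ℂ) : Prop :=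
  Tendsto (C.path j) (𝓝[<] 1) (𝓝 b)

/-- A displacement of the hard edge `b`: for `s` in the disk of radius `r` around `b`, the arcs that
end at `b` are modified inside that disk so that they end at `s` instead. -/
structure EdgeMotion {ι : Type*} (C : ContourSystem ι) (b : ℂ) (r : ℝ)
    (γ : ℂ → ι → ℝ → ℂ) : Prop where
  base : ∀ j, ∀ t ∈ Ioo (0 : ℝ) 1, γ b j t = C.path j t
  smooth : ∀ s ∈ Metric.ball b r, ∀ j, ContDiffOn ℝ 1 (γ s j) (Ioo 0 1)
  rectifiable : ∀ s ∈ Metric.ball b r, ∀ j,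
    IntegrableOn (deriv (γ s j)) (Ioo (0 : ℝ) 1 ∩ γ s j ⁻¹' Metric.ball b r)
  outside : ∀ s ∈ Metric.ball b r, ∀ j, ∀ t ∈ Ioo (0 : ℝ) 1,
    γ s j t = C.path j t ∨ (γ s j t ∈ Metric.ball b r ∧ C.path j t ∈ Metric.ball b r)
  fixed : ∀ s ∈ Metric.ball b r, ∀ j, ¬ C.StartsAt j b → ¬ C.EndsAt j b →
    ∀ t ∈ Ioo (0 : ℝ) 1, γ s j t = C.path j t
  source : ∀ s ∈ Metric.ball b r, ∀ j, C.StartsAt j b → Tendsto (γ s j) (𝓝[>] 0) (𝓝 s)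
  source_fixed : ∀ s ∈ Metric.ball b r, ∀ j, ¬ C.StartsAt j b →
    γ s j =ᶠ[𝓝[>] 0] C.path j
  target : ∀ s ∈ Metric.ball b r, ∀ j, C.EndsAt j b → Tendsto (γ s j) (𝓝[<] 1) (𝓝 s)
  target_fixed : ∀ s ∈ Metric.ball b r, ∀ j, ¬ C.EndsAt j b →
    γ s j =ᶠ[𝓝[<] 1] C.path j

/-- `∑_j ∫_{γ_j} w_j(x)/(x - z) dx/(2πi)`. -/
noncomputable def cauchyTransform {ι : Type*} [Fintype ι] (γ : ι → ℝ → ℂ) (w : ι → ℂ → ℂ)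
    (z : ℂ) : ℂ :=
  (∑ j, arcIntegral (γ j) fun x => w j x / (x - z)) / (2 * Real.pi * Complex.I)

/-- The arcs together with the counterclockwise circle of radius `R` around `b`. -/
noncomputable def cloakedPath {ι : Type*} (γ : ι → ℝ → ℂ) (b : ℂ) (R : ℝ) : Option ι → ℝ → ℂ
  | none => fun t => b + R * Complex.exp (2 * Real.pi * Complex.I * t)
  | some j => γ j

open Classical in
/-- Removal of the hard edge `b`: inside the circle the jump of `Γ` is undone by a unipotent factor
built from the Cauchy transform of the weights. -/
noncomputable def cloakedSolution {ι : Type*} [Fintype ι] (σ : PlusSide) (γ : ι → ℝ → ℂ)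
    (w : ι → ℂ → ℂ) (b : ℂ) (R : ℝ) (Γ : ℂ → Matrix (Fin 2) (Fin 2) ℂ) (z : ℂ) :
    Matrix (Fin 2) (Fin 2) ℂ :=
  if z ∈ Metric.ball b R then Γ z * jumpMatrix (σ.sign * cauchyTransform γ w z) else Γ z

open Classical in
/-- The jump matrices of the cloaked problem: on the circle the Cauchy transform appears, on the
arcs the old jump outside the disk and no jump inside. -/
noncomputable def cloakedJump {ι : Type*} [Fintype ι] (γ : ι → ℝ → ℂ) (w : ι → ℂ → ℂ) (b : ℂ)
    (R : ℝ) : Option ι → ℂ → Matrix (Fin 2) (Fin 2) ℂ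
  | none => fun z => jumpMatrix (-cauchyTransform γ w z)
  | some j => fun z => if z ∈ Metric.ball b R then 1 else jumpMatrix (w j z)

/-! The Riemann-Hilbert problem encodes orthogonality. The logarithmic derivative of a Hankel
determinant is the diagonal Christoffel-Darboux kernel paired with the variation of the moments, and
the integrand of Malgrange's form turns out to be built from the same kernel.

The jump matrices are upper unipotent, so the first column of `Γ` has no jump. Singularities of size
`o(1/|z - a|)` are removable, and Liouville's theorem makes the entries polynomials: `P` monic of
degree `n`, and `Q` of degree below `n`. In the same way `det Γ = z^(n-ℓ-1)` (`IsSolution.det_eq`).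
The second column jumps by the first column times the weight. Multiplied by `z^(k+ℓ+1-n)` it is `d/z
+ O(z⁻²)` at infinity, and `d` determines the total jump over the contours
(`ContourSystem.Sides.total_jump`). Hence, for the functional `L` with moments `m_k = μ_(ℓ-n+1+k)`,
`P` is orthogonal to `1, …, x^(n-1)`, and `Q` to all of these but the last, on which `L` takes the
value `c = 2πiε` (`IsSolution.exists_orthogonalPair`).

The rest of the first half is algebra. The kernel `k(x,y) = (Q(x)P(y) - P(x)Q(y))/(y - x)` satisfies
`L_y(k y^i) = c x^i` for `i < n`, that is, the Hankel matrix `H` maps its coefficient vector to `c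
(x^i)`. So `H` is invertible, and on the diagonal `QP' - PQ'` equals `c ∑ (H⁻¹)_ji x^(i+j)`.
Jacobi's formula then gives `(ln det H)' = L'(QP' - PQ')/c`, where `L'` has the derivatives of the
moments as its moments (`OrthogonalPair.hasDerivAt_det`). Reversing the rows turns the Toeplitz
determinant into `det H` up to a constant sign.

On the other side, a variation of a unipotent jump is strictly upper triangular, so the trace in
Malgrange's form involves only the first column and the determinant: it is `-x^(ℓ-n+1) (QP' - PQ')
∂w`. For weights and coefficients the two sides agree at once. For a moving edge, `L'` is a multiple
of evaluation at `b`, the variation of the Cauchy transform on the circle is a simple pole at `b`,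
and Cauchy's integral formula identifies them.

The analytic input is the distributional formula `∂f/∂z̄ = (f_L - f_R) dx/2i` off the nodes
(`ContourSystem.Sides.jump_formula`), obtained from Green's formula on both sides of an arc. With
Weyl's lemma it shows that a function without jump is holomorphic across the arcs
(`ContourSystem.exists_entire`). Tested on cutoffs that vanish near the nodes and near infinity, it
gives the total jump. -/

/-! ### Wirtinger calculus. -/

/-- The Wirtinger derivative `∂ψ/∂z̄`. -/
noncomputable def dbar (ψ : ℂ → ℂ) (z : ℂ) : ℂ :=
  (fderiv ℝ ψ z 1 + Complex.I * fderiv ℝ ψ z Complex.I) / 2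

lemma fderiv_real_apply (ψ : ℂ → ℂ) (z a : ℂ) :
    fderiv ℝ ψ z a = a.re * fderiv ℝ ψ z 1 + a.im * fderiv ℝ ψ z Complex.I := by
  conv_lhs => rw [show a = a.re • (1 : ℂ) + a.im • Complex.I by simp [Complex.re_add_im]]
  rw [map_add, map_smul, map_smul]
  simp

lemma dbar_eq_zero {f : ℂ → ℂ} {z : ℂ} (hf : DifferentiableAt ℂ f z) : dbar f z = 0 := by
  have h := hf.hasFDerivAt.restrictScalars ℝ
  rw [dbar, h.fderiv]
  simp only [ContinuousLinearMap.coe_restrictScalars']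
  have : fderiv ℂ f z Complex.I = Complex.I * fderiv ℂ f z 1 := by
    rw [← smul_eq_mul, ← map_smul]; simp
  rw [this, ← mul_assoc, Complex.I_mul_I]; ring

lemma dbar_mul {f ψ : ℂ → ℂ} {z : ℂ} (hf : DifferentiableAt ℝ f z)
    (hψ : DifferentiableAt ℝ ψ z) :
    dbar (fun z => f z * ψ z) z = f z * dbar ψ z + dbar f z * ψ z := by
  simp only [dbar]
  rw [fderiv_fun_mul hf hψ]
  simp only [add_apply, smul_apply, smul_eq_mul]
  ring

lemma dbar_holo_mul {f ψ : ℂ → ℂ} {z : ℂ} (hf : DifferentiableAt ℂ f z)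
    (hψ : DifferentiableAt ℝ ψ z) : dbar (fun z => f z * ψ z) z = f z * dbar ψ z := by
  rw [dbar_mul (hf.restrictScalars ℝ) hψ, dbar_eq_zero hf]; ring

lemma continuous_dbar {ψ : ℂ → ℂ} (hψ : ContDiff ℝ 1 ψ) : Continuous (dbar ψ) := by
  have h := hψ.continuous_fderiv one_ne_zero
  unfold dbar
  exact ((h.clm_apply continuous_const).add
    (continuous_const.mul (h.clm_apply continuous_const))).div_const _

lemma dbar_eq_zero_of_notMem_tsupport {ψ : ℂ → ℂ} {z : ℂ} (hz : z ∉ tsupport ψ) :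
    dbar ψ z = 0 := by
  rw [dbar, fderiv_of_notMem_tsupport ℝ hz]; simp

/-- This is `dG ∧ dz` evaluated on the coordinate vectors `a = γ'(t)` and `i c` of a strip. Only the
`z̄`-derivative survives in `dG ∧ dz = 2i ∂̄G dx ∧ dy`, and `Re(a c̄)` is the Jacobian. -/
lemma strip_identity (G : ℂ → ℂ) (z a c : ℂ) :
    Complex.I * c * fderiv ℝ G z a - a * fderiv ℝ G z (Complex.I * c) =
      2 * Complex.I * ((a * (starRingEnd ℂ) c).re : ℝ) * dbar G z := by
  rw [fderiv_real_apply G z a, fderiv_real_apply G z (Complex.I * c), dbar]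
  have ha := Complex.re_add_im a
  have hc := Complex.re_add_im c
  generalize fderiv ℝ G z 1 = D
  generalize fderiv ℝ G z Complex.I = E
  simp only [Complex.mul_re, Complex.mul_im, Complex.I_re, Complex.I_im, Complex.conj_re,
    Complex.conj_im, zero_mul, one_mul, zero_sub, zero_add, mul_neg, sub_neg_eq_add]
  rw [← ha, ← hc]
  simp only [Complex.add_re, Complex.add_im, Complex.ofReal_re, Complex.ofReal_im, Complex.mul_re,
    Complex.mul_im, Complex.I_re, Complex.I_im, mul_zero, mul_one, sub_zero, add_zero, zero_add]
  push_cast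
  linear_combination (a.re * (c.im * D - c.re * E) : ℂ) * Complex.I_sq

/-! ### Green's formula on one side of a curve. -/

/-- Green's formula on a rectangle in the strip coordinates. -/
lemma strip_green {q qt qv : ℝ → ℝ → ℂ} {g : ℝ → ℂ} {a b η A : ℝ} (c : ℂ) (hab : a ≤ b)
    (hη : η ≤ A)
    (ht : ∀ t ∈ Icc a b, ∀ v ∈ Icc η A, HasDerivAt (fun t => q t v) (qt t v) t)
    (hv : ∀ t ∈ Icc a b, ∀ v ∈ Icc η A, HasDerivAt (fun v => q t v) (qv t v) v)
    (hqt : ContinuousOn (Function.uncurry qt) (Icc a b ×ˢ Icc η A))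
    (hqv : ContinuousOn (Function.uncurry qv) (Icc a b ×ˢ Icc η A))
    (hg : ContinuousOn g (Icc a b))
    (ha : ∀ v ∈ Icc η A, q a v = 0) (hb : ∀ v ∈ Icc η A, q b v = 0)
    (hA : ∀ t ∈ Icc a b, q t A = 0) :
    ∫ p in Icc a b ×ˢ Icc η A, (c * qt p.1 p.2 - g p.1 * qv p.1 p.2) =
      ∫ t in Icc a b, g t * q t η := by
  have i1 : IntegrableOn (fun p : ℝ × ℝ => qt p.1 p.2) (Icc a b ×ˢ Icc η A) :=
    hqt.integrableOn_compact (isCompact_Icc.prod isCompact_Icc)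
  have i2 : IntegrableOn (fun p : ℝ × ℝ => g p.1 * qv p.1 p.2) (Icc a b ×ˢ Icc η A) :=
    ((hg.comp continuousOn_fst fun p hp => hp.1).mul hqv).integrableOn_compact
      (isCompact_Icc.prod isCompact_Icc)
  rw [integral_sub (i1.const_mul c) i2, integral_const_mul]
  rw [Measure.volume_eq_prod] at i1 i2 ⊢
  have e1 : ∫ p in Icc a b ×ˢ Icc η A, qt p.1 p.2 ∂(volume.prod volume) = 0 := by
    rw [IntegrableOn, ← Measure.prod_restrict] at i1
    rw [← Measure.prod_restrict]
    rw [integral_prod_symm _ i1]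
    refine setIntegral_eq_zero_of_forall_eq_zero fun v hv' => ?_
    rw [integral_Icc_eq_integral_Ioc, ← intervalIntegral.integral_of_le hab,
      intervalIntegral.integral_eq_sub_of_hasDerivAt (f := fun t => q t v), ha v hv', hb v hv',
      sub_zero]
    · intro t ht'; rw [uIcc_of_le hab] at ht'; exact ht t ht' v hv'
    · apply ContinuousOn.intervalIntegrable
      rw [uIcc_of_le hab]
      exact hqt.comp (f := fun t => (t, v)) (by fun_prop) fun t ht' => ⟨ht', hv'⟩
  rw [e1, setIntegral_prod _ i2, mul_zero, zero_sub, ← integral_neg]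
  refine setIntegral_congr_fun measurableSet_Icc fun t ht' => ?_
  simp only
  rw [integral_const_mul, integral_Icc_eq_integral_Ioc, ← intervalIntegral.integral_of_le hη,
      intervalIntegral.integral_eq_sub_of_hasDerivAt (f := fun v => q t v), hA t ht']
  · ring
  · intro v hv'; rw [uIcc_of_le hη] at hv'; exact hv t ht' v hv'
  · apply ContinuousOn.intervalIntegrable
    rw [uIcc_of_le hη]
    exact hqv.comp (f := fun v => (t, v)) (by fun_prop) fun v hv' => ⟨ht', hv'⟩

/-- Strip coordinates along a curve: `(t, v) ↦ γ(t) + i c v`. -/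
noncomputable def strip (γ : ℝ → ℂ) (c : ℂ) (p : ℝ × ℝ) : ℂ := γ p.1 + Complex.I * c * p.2

lemma hasFDerivAt_strip_equivRealProd {γ : ℝ → ℂ} {γ' c : ℂ} {p : ℝ × ℝ}
    (h : HasDerivAt γ γ' p.1) :
    HasFDerivAt (fun p => Complex.equivRealProd (strip γ c p))
      (Matrix.toLin (.finTwoProd ℝ) (.finTwoProd ℝ)
        !![γ'.re, -c.im; γ'.im, c.re]).toContinuousLinearMap p := by
  rw [Matrix.toLin_finTwoProd_toContinuousLinearMap]
  have h1 : HasFDerivAt (fun p : ℝ × ℝ => (γ p.1).re) (γ'.re • ContinuousLinearMap.fst ℝ ℝ ℝ) p := by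
    have := (Complex.reCLM.hasFDerivAt.comp_hasDerivAt _ h).comp_hasFDerivAt p
      (hasFDerivAt_fst (𝕜 := ℝ) (p := p))
    simpa [Function.comp_def] using this
  have h2 : HasFDerivAt (fun p : ℝ × ℝ => (γ p.1).im) (γ'.im • ContinuousLinearMap.fst ℝ ℝ ℝ) p := by
    have := (Complex.imCLM.hasFDerivAt.comp_hasDerivAt _ h).comp_hasFDerivAt p
      (hasFDerivAt_fst (𝕜 := ℝ) (p := p))
    simpa [Function.comp_def] using this
  have h3 : HasFDerivAt (fun p : ℝ × ℝ => p.2) (ContinuousLinearMap.snd ℝ ℝ ℝ) p := hasFDerivAt_snd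
  convert! (h1.add (h3.const_mul (-c.im))).prodMk (h2.add (h3.const_mul c.re)) using 1
  ext q <;> simp [strip, Complex.equivRealProd]

/-- Because `c` is constant along the curve, the Jacobian does not depend on `v` and contains no
second derivative of `γ`. -/
lemma integral_strip {γ γ' : ℝ → ℂ} {c : ℂ} {s : Set (ℝ × ℝ)} (hs : MeasurableSet s)
    (h : ∀ p ∈ s, HasDerivAt γ (γ' p.1) p.1) (hi : InjOn (strip γ c) s) (g : ℂ → ℂ) :
    ∫ z in strip γ c '' s, g z =
      ∫ p in s, ((|(γ' p.1 * (starRingEnd ℂ) c).re| : ℝ) : ℂ) * g (strip γ c p) := by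
  have e : strip γ c '' s = Complex.measurableEquivRealProd.symm ''
      ((fun p => Complex.equivRealProd (strip γ c p)) '' s) := by
    rw [image_image]; rfl
  have hmp := Complex.volume_preserving_equiv_real_prod.symm
  rw [e, ← hmp.setIntegral_preimage_emb Complex.measurableEquivRealProd.symm.measurableEmbedding,
    Complex.measurableEquivRealProd.symm.injective.preimage_image,
    integral_image_eq_integral_abs_det_fderiv_smul volume hs
      (fun p hp => (hasFDerivAt_strip_equivRealProd (c := c) (h p hp)).hasFDerivWithinAt)
      (Complex.equivRealProd.injective.comp_injOn hi)]
  refine setIntegral_congr_fun hs fun p hp => ?_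
  simp only [LinearMap.det_toContinuousLinearMap, LinearMap.det_toLin, Matrix.det_fin_two_of,
    Complex.real_smul, Complex.mul_re, Complex.conj_re, Complex.conj_im]
  congr 3
  · congr 1; ring

lemma measurableSet_strip {γ γ' : ℝ → ℂ} {c : ℂ} {s : Set (ℝ × ℝ)} (hs : MeasurableSet s)
    (h : ∀ p ∈ s, HasDerivAt γ (γ' p.1) p.1) (hi : InjOn (strip γ c) s) :
    MeasurableSet (strip γ c '' s) := by
  have e : strip γ c '' s = Complex.measurableEquivRealProd.symm ''
      ((fun p => Complex.equivRealProd (strip γ c p)) '' s) := by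
    rw [image_image]; rfl
  rw [e, Complex.measurableEquivRealProd.symm.measurableEmbedding.measurableSet_image]
  exact measurable_image_of_fderivWithin hs
      (fun p hp => (hasFDerivAt_strip_equivRealProd (c := c) (h p hp)).hasFDerivWithinAt)
      (Complex.equivRealProd.injective.comp_injOn hi)

/-- Nothing is known about `f` outside `Ω`, but away from the support of `ψ` the product vanishes
identically, so only the points of `tsupport ψ` matter. The next two lemmas rest on the same remark.
-/
lemma continuousAt_mul_dbar {f ψ : ℂ → ℂ} {Ω : Set ℂ} (hΩ : IsOpen Ω) (hf : ContinuousOn f Ω)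
    (hψ : ContDiff ℝ 1 ψ) {z : ℂ} (h : z ∈ tsupport ψ → z ∈ Ω) :
    ContinuousAt (fun z => f z * dbar ψ z) z := by
  by_cases hz : z ∈ tsupport ψ
  · exact (hf.continuousAt (hΩ.mem_nhds (h hz))).mul (continuous_dbar hψ).continuousAt
  · have : (fun z => f z * dbar ψ z) =ᶠ[𝓝 z] fun _ => 0 := by
      filter_upwards [(isClosed_tsupport ψ).isOpen_compl.mem_nhds hz] with y hy
      rw [dbar_eq_zero_of_notMem_tsupport hy, mul_zero]
    exact (continuousAt_congr this).2 continuousAt_const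

lemma contDiffAt_mul_of_tsupport {f ψ : ℂ → ℂ} {Ω : Set ℂ} (hΩ : IsOpen Ω)
    (hf : DifferentiableOn ℂ f Ω)
    (hψ : ContDiff ℝ 1 ψ) {z : ℂ} (h : z ∈ tsupport ψ → z ∈ Ω) :
    ContDiffAt ℝ 1 (fun z => f z * ψ z) z := by
  by_cases hz : z ∈ tsupport ψ
  · have : ContDiffAt ℂ 1 f z := (hf.contDiffOn hΩ).contDiffAt (hΩ.mem_nhds (h hz))
    exact (this.restrict_scalars ℝ).mul hψ.contDiffAt
  · have : (fun z => f z * ψ z) =ᶠ[𝓝 z] fun _ => 0 := by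
      filter_upwards [(isClosed_tsupport ψ).isOpen_compl.mem_nhds hz] with y hy
      rw [image_eq_zero_of_notMem_tsupport hy, mul_zero]
    exact contDiffAt_const.congr_of_eventuallyEq this

lemma dbar_mul_of_tsupport {f ψ : ℂ → ℂ} {Ω : Set ℂ} (hΩ : IsOpen Ω)
    (hf : DifferentiableOn ℂ f Ω)
    (hψ : ContDiff ℝ 1 ψ) {z : ℂ} (h : z ∈ tsupport ψ → z ∈ Ω) :
    dbar (fun z => f z * ψ z) z = f z * dbar ψ z := by
  by_cases hz : z ∈ tsupport ψ
  · exact dbar_holo_mul (hf.differentiableAt (hΩ.mem_nhds (h hz)))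
      (hψ.differentiable one_ne_zero z)
  · have : z ∉ tsupport (fun z => f z * ψ z) := fun h' =>
      hz (closure_mono (Function.support_mul_subset_right f ψ) h')
    rw [dbar_eq_zero_of_notMem_tsupport this, dbar_eq_zero_of_notMem_tsupport hz, mul_zero]

/-- The boundary term on the curve is the limit of the boundary terms at height `η → 0`; boundedness
of `f` and the pointwise limits `fl` allow dominated convergence. The set `B` confines the support
of `ψ`, so that the lateral sides and the top of the strip contribute nothing. The sign `s` is the
orientation: it is `1` when `i c` points to the left of the curve and `-1` when it points to the
right. -/
lemma half_strip {γ γ' : ℝ → ℂ} {c : ℂ} {a b A M s : ℝ} {f ψ : ℂ → ℂ} {fl : ℝ → ℂ}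
    {Ω B : Set ℂ} (hs : s = 1 ∨ s = -1) (hab : a < b) (hA : 0 < A)
    (hγ : ∀ t ∈ Icc a b, HasDerivAt γ (γ' t) t) (hγ' : ContinuousOn γ' (Icc a b))
    (hpos : ∀ t ∈ Icc a b, 0 < s * (γ' t * (starRingEnd ℂ) c).re)
    (hΩ : IsOpen Ω) (hf : DifferentiableOn ℂ f Ω) (hψ : ContDiff ℝ 1 ψ)
    (hsupp : tsupport ψ ⊆ B) (hcpt : HasCompactSupport ψ)
    (hbox : ∀ t ∈ Icc a b, ∀ u, strip γ c (t, u) ∈ B → t ∈ Ioo a b ∧ |u| < A)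
    (hdom : ∀ t ∈ Icc a b, ∀ u > 0, strip γ c (t, u) ∈ B → strip γ c (t, u) ∈ Ω)
    (hM : ∀ z ∈ B ∩ Ω, ‖f z‖ ≤ M)
    (hlim : ∀ t ∈ Ioo a b, γ t ∈ B →
      Tendsto (fun u => f (strip γ c (t, u))) (𝓝[>] 0) (𝓝 (fl t)))
    (hinj : InjOn (strip γ c) (Ioo a b ×ˢ Ioi 0)) :
    IntegrableOn (fun t => γ' t * (fl t * ψ (γ t))) (Icc a b) ∧
    ∫ z in strip γ c '' (Ioo a b ×ˢ Ioi 0), f z * dbar ψ z =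
      s / (2 * Complex.I) * ∫ t in Icc a b, γ' t * (fl t * ψ (γ t)) := by
  have hcγ : ContinuousOn γ (Icc a b) := fun t ht => (hγ t ht).continuousAt.continuousWithinAt
  have hcs : ContinuousOn (strip γ c) (Icc a b ×ˢ univ) := by
    unfold strip
    refine (hcγ.comp continuousOn_fst fun p hp => hp.1).add ?_
    fun_prop
  set F : ℝ × ℝ → ℂ := fun p => ((|(γ' p.1 * (starRingEnd ℂ) c).re| : ℝ) : ℂ) *
    (f (strip γ c p) * dbar ψ (strip γ c p)) with hF
  have hF0 : ∀ p : ℝ × ℝ, p.1 ∈ Icc a b → ¬ (p.1 ∈ Ioo a b ∧ |p.2| < A) → F p = 0 := by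
    intro p hp hn
    have : strip γ c p ∉ tsupport ψ := fun h => hn (hbox p.1 hp p.2 (hsupp h))
    simp [hF, dbar_eq_zero_of_notMem_tsupport this]
  have hmem : ∀ p : ℝ × ℝ, p.1 ∈ Icc a b → 0 < p.2 → strip γ c p ∈ tsupport ψ →
      strip γ c p ∈ Ω := fun p hp h0 h => hdom p.1 hp p.2 h0 (hsupp h)
  have hJc : ContinuousOn (fun t => ((|(γ' t * (starRingEnd ℂ) c).re| : ℝ) : ℂ)) (Icc a b) :=
    Complex.continuous_ofReal.comp_continuousOn
      (Complex.continuous_re.comp_continuousOn (hγ'.mul continuousOn_const)).abs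
  have hFc : ContinuousOn F (Icc a b ×ˢ Ioi 0) := by
    refine (hJc.comp continuousOn_fst fun p hp => hp.1).mul ?_
    intro p hp
    exact (continuousAt_mul_dbar hΩ hf.continuousOn hψ
      (hmem p hp.1 hp.2)).comp_continuousWithinAt
      ((hcs p ⟨hp.1, trivial⟩).mono (prod_mono_right (subset_univ _)))
  have e1 : ∫ p in Ioo a b ×ˢ Ioi 0, F p = ∫ p in Icc a b ×ˢ Ioc 0 A, F p := by
    have hm : MeasurableSet (Icc a b ×ˢ Ioi (0 : ℝ)) := measurableSet_Icc.prod measurableSet_Ioi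
    rw [← setIntegral_eq_of_subset_of_forall_sdiff_eq_zero hm
      (prod_mono_left Ioo_subset_Icc_self : Ioo a b ×ˢ Ioi (0 : ℝ) ⊆ Icc a b ×ˢ Ioi 0),
      ← setIntegral_eq_of_subset_of_forall_sdiff_eq_zero hm
      (prod_mono_right Ioc_subset_Ioi_self : Icc a b ×ˢ Ioc (0 : ℝ) A ⊆ Icc a b ×ˢ Ioi 0)]
    · rintro p ⟨hp, hn⟩
      refine hF0 p hp.1 fun h => hn ⟨hp.1, hp.2, ((le_abs_self _).trans_lt h.2).le⟩
    · rintro p ⟨hp, hn⟩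
      exact hF0 p hp.1 fun h => hn ⟨h.1, hp.2⟩
  obtain ⟨D, hD⟩ := (continuous_dbar hψ).bounded_above_of_compact_support
    (HasCompactSupport.intro hcpt fun z hz => dbar_eq_zero_of_notMem_tsupport hz)
  obtain ⟨J, hJ⟩ := isCompact_Icc.exists_bound_of_continuousOn hJc
  have hFi : IntegrableOn F (Icc a b ×ˢ Ioc 0 A) := by
    refine IntegrableOn.of_bound (C := |J| * (|M| * |D|)) ?_ ?_ ?_
    · refine (measure_mono (prod_mono_right Ioc_subset_Icc_self)).trans_lt ?_
      exact (isCompact_Icc.prod isCompact_Icc).measure_lt_top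
    · exact (hFc.mono (prod_mono_right Ioc_subset_Ioi_self)).aestronglyMeasurable
        (measurableSet_Icc.prod measurableSet_Ioc)
    · refine (ae_restrict_iff' (measurableSet_Icc.prod measurableSet_Ioc)).2 (ae_of_all _ ?_)
      intro p hp
      by_cases h : strip γ c p ∈ tsupport ψ
      · rw [hF, norm_mul, norm_mul]
        have h1 := (hJ p.1 hp.1).trans (le_abs_self _)
        have h2 := (hM _ ⟨hsupp h, hmem p hp.1 hp.2.1 h⟩).trans (le_abs_self _)
        have h3 := (hD (strip γ c p)).trans (le_abs_self _)
        gcongr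
      · simp only [hF, dbar_eq_zero_of_notMem_tsupport h, mul_zero, norm_zero]
        positivity
  -- Green's formula is applied for `η n ≤ v ≤ A` only, away from the curve, where `f` need not even
  -- be continuous.
  set η : ℕ → ℝ := fun n => A / (n + 1) with hη
  have hη0 : ∀ n, 0 < η n := fun n => by positivity
  have hηA : ∀ n, η n ≤ A := fun n => div_le_self hA.le (by linarith [n.cast_nonneg (α := ℝ)])
  have hηt : Tendsto η atTop (𝓝 0) := by
    have := (tendsto_one_div_add_atTop_nhds_zero_nat (𝕜 := ℝ)).const_mul A
    simpa [hη, div_eq_mul_inv] using this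
  have hU : ⋃ n, Icc a b ×ˢ Icc (η n) A = Icc a b ×ˢ Ioc 0 A := by
    ext p
    simp only [mem_iUnion, mem_prod, mem_Icc, mem_Ioc]
    constructor
    · rintro ⟨n, h1, h2⟩; exact ⟨h1, (hη0 n).trans_le h2.1, h2.2⟩
    · rintro ⟨h1, h2⟩
      obtain ⟨n, hn⟩ := (hηt.eventually (ge_mem_nhds h2.1)).exists
      exact ⟨n, h1, hn, h2.2⟩
  have L1 : Tendsto (fun n => ∫ p in Icc a b ×ˢ Icc (η n) A, F p) atTop
      (𝓝 (∫ p in Icc a b ×ˢ Ioc 0 A, F p)) := by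
    rw [← hU] at hFi ⊢
    refine tendsto_setIntegral_of_monotone (fun n => measurableSet_Icc.prod measurableSet_Icc) ?_ hFi
    intro n m hnm
    refine prod_mono_right (Icc_subset_Icc_left ?_)
    simp only [hη]; gcongr
  -- the formula on truncated strips
  set G : ℂ → ℂ := fun z => f z * ψ z with hG
  have hGC : ∀ p : ℝ × ℝ, p.1 ∈ Icc a b → 0 < p.2 → ContDiffAt ℝ 1 G (strip γ c p) :=
    fun p hp h0 => contDiffAt_mul_of_tsupport hΩ hf hψ (hmem p hp h0)
  have hG0 : ∀ p : ℝ × ℝ, p.1 ∈ Icc a b → ¬ (p.1 ∈ Ioo a b ∧ |p.2| < A) →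
      G (strip γ c p) = 0 := by
    intro p hp hn
    have : strip γ c p ∉ tsupport ψ := fun h => hn (hbox p.1 hp p.2 (hsupp h))
    simp [hG, image_eq_zero_of_notMem_tsupport this]
  have hDt : ∀ t ∈ Icc a b, ∀ v > 0, HasDerivAt (fun t => G (strip γ c (t, v)))
      (fderiv ℝ G (strip γ c (t, v)) (γ' t)) t := by
    intro t ht v hv
    have h1 := ((hGC (t, v) ht hv).differentiableAt one_ne_zero).hasFDerivAt
    exact h1.comp_hasDerivAt t ((hγ t ht).add_const _)
  have hDv : ∀ t ∈ Icc a b, ∀ v > 0, HasDerivAt (fun v => G (strip γ c (t, v)))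
      (fderiv ℝ G (strip γ c (t, v)) (Complex.I * c)) v := by
    intro t ht v hv
    have h1 := ((hGC (t, v) ht hv).differentiableAt one_ne_zero).hasFDerivAt
    refine HasFDerivAt.comp_hasDerivAt (f := fun v : ℝ => strip γ c (t, v)) v h1 ?_
    have := ((Complex.ofRealCLM.hasDerivAt (x := v)).const_mul (Complex.I * c)).const_add (γ t)
    simpa [strip] using this
  have hDc : ∀ n, ContinuousOn (fun p => fderiv ℝ G (strip γ c p)) (Icc a b ×ˢ Icc (η n) A) := by
    intro n p hp
    have h1 := (hGC p hp.1 ((hη0 n).trans_le hp.2.1)).continuousAt_fderiv one_ne_zero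
    exact ContinuousAt.comp_continuousWithinAt (f := strip γ c) h1
      ((hcs p ⟨hp.1, trivial⟩).mono (prod_mono_right (subset_univ _)))
  have E : ∀ n, ∫ p in Icc a b ×ˢ Icc (η n) A, F p =
      s / (2 * Complex.I) * ∫ t in Icc a b, γ' t * G (strip γ c (t, η n)) := by
    intro n
    rw [← strip_green (q := fun t v => G (strip γ c (t, v)))
      (qt := fun t v => fderiv ℝ G (strip γ c (t, v)) (γ' t))
      (qv := fun t v => fderiv ℝ G (strip γ c (t, v)) (Complex.I * c)) (Complex.I * c) hab.le
      (hηA n) (fun t ht v hv => hDt t ht v ((hη0 n).trans_le hv.1))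
      (fun t ht v hv => hDv t ht v ((hη0 n).trans_le hv.1))
      ((hDc n).clm_apply (hγ'.comp continuousOn_fst fun p hp => hp.1))
      ((hDc n).clm_apply continuousOn_const) hγ'
      (fun v hv => hG0 (a, v) (left_mem_Icc.2 hab.le) fun h => lt_irrefl _ h.1.1)
      (fun v hv => hG0 (b, v) (right_mem_Icc.2 hab.le) fun h => lt_irrefl _ h.1.2)
      (fun t ht => hG0 (t, A) ht fun h => lt_irrefl _ ((le_abs_self A).trans_lt h.2)),
      ← integral_const_mul]
    refine setIntegral_congr_fun (measurableSet_Icc.prod measurableSet_Icc) fun p hp => ?_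
    rw [strip_identity, dbar_mul_of_tsupport hΩ hf hψ (hmem p hp.1 ((hη0 n).trans_le hp.2.1)), hF]
    beta_reduce
    -- Here the orientation `s` enters: the change of variables uses the absolute value of the
    -- Jacobian, Green's formula its signed value.
    have : |(γ' p.1 * (starRingEnd ℂ) c).re| = s * (γ' p.1 * (starRingEnd ℂ) c).re := by
      rw [← abs_of_pos (hpos p.1 hp.1), abs_mul]
      rcases hs with rfl | rfl <;> simp
    rw [this]
    have hI := Complex.I_ne_zero
    push_cast
    field_simp
  obtain ⟨D', hD'⟩ := hψ.continuous.bounded_above_of_compact_support hcpt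
  obtain ⟨J', hJ'⟩ := isCompact_Icc.exists_bound_of_continuousOn hγ'
  have m1 : ∀ n, AEStronglyMeasurable (fun t => γ' t * G (strip γ c (t, η n)))
      (volume.restrict (Icc a b)) := by
    intro n
    refine (hγ'.mul fun t ht => ?_).aestronglyMeasurable measurableSet_Icc
    exact (hDt t ht _ (hη0 n)).continuousAt.continuousWithinAt
  have m2 : ∀ n, ∀ t ∈ Icc a b, ‖γ' t * G (strip γ c (t, η n))‖ ≤ |J'| * (|M| * |D'|) := by
    intro n t ht
    by_cases h : strip γ c (t, η n) ∈ tsupport ψ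
    · rw [hG, norm_mul, norm_mul]
      have h1 := (hJ' t ht).trans (le_abs_self _)
      have h2 := (hM _ ⟨hsupp h, hmem (t, η n) ht (hη0 n) h⟩).trans (le_abs_self _)
      have h3 := (hD' (strip γ c (t, η n))).trans (le_abs_self _)
      gcongr
    · simp only [hG, image_eq_zero_of_notMem_tsupport h, mul_zero, norm_zero]
      positivity
  have m3 : ∀ t ∈ Icc a b, Tendsto (fun n => γ' t * G (strip γ c (t, η n))) atTop
      (𝓝 (γ' t * (fl t * ψ (γ t)))) := by
    intro t ht
    refine Tendsto.const_mul _ ?_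
    have hη' : Tendsto η atTop (𝓝[>] 0) :=
      tendsto_nhdsWithin_iff.2 ⟨hηt, Eventually.of_forall hη0⟩
    have hst : Tendsto (fun n => strip γ c (t, η n)) atTop (𝓝 (γ t)) := by
      have : Tendsto (fun n => γ t + Complex.I * c * (η n : ℂ)) atTop
          (𝓝 (γ t + Complex.I * c * ((0 : ℝ) : ℂ))) :=
        tendsto_const_nhds.add (((Complex.continuous_ofReal.tendsto 0).comp hηt).const_mul _)
      simpa [strip] using this
    by_cases h : γ t ∈ tsupport ψ
    · have ht' : t ∈ Ioo a b := (hbox t ht 0 (by simpa [strip] using hsupp h)).1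
      exact ((hlim t ht' (hsupp h)).comp hη').mul ((hψ.continuous.tendsto _).comp hst)
    · rw [image_eq_zero_of_notMem_tsupport h, mul_zero]
      refine tendsto_const_nhds.congr' ?_
      filter_upwards [hst.eventually ((isClosed_tsupport ψ).isOpen_compl.mem_nhds h)] with n hn
      simp [hG, image_eq_zero_of_notMem_tsupport hn]
  have m3' := (ae_restrict_iff' (μ := volume) measurableSet_Icc).2 (ae_of_all _ m3)
  have L2 : Tendsto (fun n => ∫ t in Icc a b, γ' t * G (strip γ c (t, η n))) atTop
      (𝓝 (∫ t in Icc a b, γ' t * (fl t * ψ (γ t)))) :=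
    tendsto_integral_of_dominated_convergence (fun _ => |J'| * (|M| * |D'|)) m1
      (integrableOn_const isCompact_Icc.measure_lt_top.ne)
      (fun n => (ae_restrict_iff' measurableSet_Icc).2 (ae_of_all _ (m2 n))) m3'
  refine ⟨IntegrableOn.of_bound (C := |J'| * (|M| * |D'|)) isCompact_Icc.measure_lt_top
    (aestronglyMeasurable_of_tendsto_ae atTop m1 m3') ((ae_restrict_iff' measurableSet_Icc).2
    (ae_of_all _ fun t ht => le_of_tendsto (m3 t ht).norm
      (Eventually.of_forall fun n => m2 n t ht))), ?_⟩
  rw [integral_strip (measurableSet_Ioo.prod measurableSet_Ioi)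
    (fun p hp => hγ p.1 (Ioo_subset_Icc_self hp.1)) hinj, e1]
  refine tendsto_nhds_unique L1 ?_
  simp_rw [E]
  exact L2.const_mul _

/-! ### Curves in a cone; comparison of collar and strip coordinates. -/

/-- `γ` is a `C¹` curve over `[a, b]` whose direction stays in a cone around `c`. -/
structure InCone (γ : ℝ → ℂ) (c : ℂ) (a b : ℝ) : Prop where
  lt : a < b
  diff : ∀ t ∈ Icc a b, HasDerivAt γ (deriv γ t) t
  cont : ContinuousOn (deriv γ) (Icc a b)
  pos : ∀ t ∈ Icc a b, 0 < (deriv γ t / c).re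
  cone : ∀ t ∈ Icc a b, |(deriv γ t / c).im| ≤ (deriv γ t / c).re / 2

lemma ContDiffAt.contDiffAt_deriv_two {γ : ℝ → ℂ} {t : ℝ} (h : ContDiffAt ℝ 2 γ t) :
    ContDiffAt ℝ 1 (deriv γ) t := by
  have := (h.fderiv_right (m := 1) (by norm_num)).clm_apply
    (contDiffAt_const (c := (1 : ℝ)))
  simpa using this

lemma exists_inCone {γ : ℝ → ℂ} {t₀ : ℝ} (h : ContDiffAt ℝ 2 γ t₀) (h0 : deriv γ t₀ ≠ 0)
    {U : Set ℝ} (hU : U ∈ 𝓝 t₀) :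
    ∃ a b, a < t₀ ∧ t₀ < b ∧ Icc a b ⊆ U ∧ InCone γ (deriv γ t₀) a b := by
  set c := deriv γ t₀ with hc0
  have h1 : ∀ᶠ t in 𝓝 t₀, ContDiffAt ℝ 2 γ t := h.eventually (by simp)
  have hc : ContinuousAt (fun t => deriv γ t / c) t₀ :=
    h.contDiffAt_deriv_two.continuousAt.div_const c
  have hd : deriv γ t₀ / c = 1 := div_self h0
  have h2 : ∀ᶠ t in 𝓝 t₀, 1 / 2 < (deriv γ t / c).re := by
    refine (Complex.continuous_re.continuousAt.comp hc).eventually (lt_mem_nhds ?_)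
    simp only [hd, Function.comp]; norm_num
  have h3 : ∀ᶠ t in 𝓝 t₀, |(deriv γ t / c).im| < 1 / 4 := by
    refine (Complex.continuous_im.continuousAt.comp hc).abs.eventually (gt_mem_nhds ?_)
    simp only [hd, Function.comp]; norm_num
  obtain ⟨ε, hε, hs⟩ := Metric.eventually_nhds_iff_ball.1
    (h1.and (h2.and (h3.and hU)))
  have hsub : ∀ t ∈ Icc (t₀ - ε / 2) (t₀ + ε / 2), t ∈ Metric.ball t₀ ε := by
    intro t ht
    rw [Metric.mem_ball, Real.dist_eq, abs_lt]
    constructor <;> linarith [ht.1, ht.2]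
  refine ⟨t₀ - ε / 2, t₀ + ε / 2, by linarith, by linarith,
    fun t ht => (hs t (hsub t ht)).2.2.2, ⟨by linarith, fun t ht => ?_, fun t ht => ?_,
    fun t ht => ?_, fun t ht => ?_⟩⟩
  · exact ((hs t (hsub t ht)).1.differentiableAt two_ne_zero).hasDerivAt
  · exact (hs t (hsub t ht)).1.contDiffAt_deriv_two.continuousAt.continuousWithinAt
  · linarith [(hs t (hsub t ht)).2.1]
  · linarith [(hs t (hsub t ht)).2.1, (hs t (hsub t ht)).2.2.1]

namespace InCone
variable {γ : ℝ → ℂ} {c : ℂ} {a b : ℝ}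

lemma neg_strip (t u : ℝ) : strip γ (-c) (t, u) = strip γ c (t, -u) := by
  simp [strip]

lemma ne_zero (h : InCone γ c a b) : c ≠ 0 := by
  rintro rfl
  simpa using h.pos a (left_mem_Icc.2 h.lt.le)

lemma hasDerivAt_div (h : InCone γ c a b) {t : ℝ} (ht : t ∈ Icc a b) :
    HasDerivAt (fun t => γ t / c) (deriv γ t / c) t := (h.diff t ht).div_const c

lemma hasDerivAt_re (h : InCone γ c a b) {t : ℝ} (ht : t ∈ Icc a b) :
    HasDerivAt (fun t => (γ t / c).re) (deriv γ t / c).re t :=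
  Complex.reCLM.hasFDerivAt.comp_hasDerivAt _ (h.hasDerivAt_div ht)

lemma hasDerivAt_im (h : InCone γ c a b) {t : ℝ} (ht : t ∈ Icc a b) :
    HasDerivAt (fun t => (γ t / c).im) (deriv γ t / c).im t :=
  Complex.imCLM.hasFDerivAt.comp_hasDerivAt _ (h.hasDerivAt_div ht)

lemma strictMonoOn_re (h : InCone γ c a b) : StrictMonoOn (fun t => (γ t / c).re) (Icc a b) := by
  refine strictMonoOn_of_deriv_pos (convex_Icc a b)
    (fun t ht => (h.hasDerivAt_re ht).continuousAt.continuousWithinAt) fun t ht => ?_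
  rw [interior_Icc] at ht
  rw [(h.hasDerivAt_re (Ioo_subset_Icc_self ht)).deriv]
  exact h.pos t (Ioo_subset_Icc_self ht)

/-- The cone condition says that `re / 2 ± im` has nonnegative derivative. Integrated for both
signs, it shows that the curve is a graph of slope at most `1/2` over the direction `c`. -/
lemma monotoneOn_aux (h : InCone γ c a b) {s : ℝ} (hs : |s| = 1) :
    MonotoneOn (fun t => (γ t / c).re / 2 + s * (γ t / c).im) (Icc a b) := by
  have hd : ∀ t ∈ Icc a b, HasDerivAt (fun t => (γ t / c).re / 2 + s * (γ t / c).im)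
      ((deriv γ t / c).re / 2 + s * (deriv γ t / c).im) t := fun t ht =>
    ((h.hasDerivAt_re ht).div_const 2).add ((h.hasDerivAt_im ht).const_mul s)
  refine monotoneOn_of_deriv_nonneg (convex_Icc a b)
    (fun t ht => (hd t ht).continuousAt.continuousWithinAt)
    (fun t ht => (hd t (interior_subset ht)).differentiableAt.differentiableWithinAt)
    fun t ht => ?_
  rw [(hd t (interior_subset ht)).deriv]
  have h1 := h.cone t (interior_subset ht)
  have h2 : |s * (deriv γ t / c).im| = |(deriv γ t / c).im| := by rw [abs_mul, hs, one_mul]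
  have h3 := neg_abs_le (s * (deriv γ t / c).im)
  linarith

lemma abs_im_sub_le (h : InCone γ c a b) {t τ : ℝ} (ht : t ∈ Icc a b) (hτ : τ ∈ Icc a b) :
    |(γ τ / c).im - (γ t / c).im| ≤ |(γ τ / c).re - (γ t / c).re| / 2 := by
  wlog hle : t ≤ τ generalizing t τ
  · rw [abs_sub_comm, abs_sub_comm (γ τ / c).re]
    exact this hτ ht (le_of_not_ge hle)
  have h1 := h.monotoneOn_aux (s := 1) (by simp) ht hτ hle
  have h2 := h.monotoneOn_aux (s := -1) (by simp) ht hτ hle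
  have h3 := h.strictMonoOn_re.monotoneOn ht hτ hle
  simp only at h1 h2 h3
  rw [abs_of_nonneg (sub_nonneg.2 h3), abs_le]
  constructor <;> linarith

lemma strip_div (h : InCone γ c a b) (t u : ℝ) :
    strip γ c (t, u) / c = γ t / c + Complex.I * u := by
  have := h.ne_zero
  simp only [strip]; field_simp

lemma re_strip (h : InCone γ c a b) (t u : ℝ) : (strip γ c (t, u) / c).re = (γ t / c).re := by
  rw [h.strip_div]; simp

lemma im_strip (h : InCone γ c a b) (t u : ℝ) :
    (strip γ c (t, u) / c).im = (γ t / c).im + u := by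
  rw [h.strip_div]; simp

/-- `Re(z/c)` does not see `u` and is strictly monotone in `t`; afterwards `Im(z/c)` recovers `u`.
Unlike the collar, the strip is therefore injective at all heights. -/
lemma injOn_strip (h : InCone γ c a b) : InjOn (strip γ c) (Icc a b ×ˢ univ) := by
  rintro ⟨t, u⟩ ⟨ht, -⟩ ⟨τ, v⟩ ⟨hτ, -⟩ he
  have h1 : (γ t / c).re = (γ τ / c).re := by rw [← h.re_strip t u, he, h.re_strip]
  have h2 : t = τ := h.strictMonoOn_re.injOn ht hτ h1
  subst h2
  have h3 : (γ t / c).im + u = (γ t / c).im + v := by rw [← h.im_strip, he, h.im_strip]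
  simpa using h3

/-- The collar and the strip coordinates agree on the sides of the curve. -/
lemma collar_side (h : InCone γ c a b) {t τ k u : ℝ} (ht : t ∈ Icc a b) (hτ : τ ∈ Icc a b)
    (he : collar γ (t, k) = strip γ c (τ, u)) : (0 < u ↔ 0 < k) ∧ (u < 0 ↔ k < 0) := by
  have hc := h.ne_zero
  have e1 : collar γ (t, k) / c = γ t / c + Complex.I * k * (deriv γ t / c) := by
    simp only [collar]; field_simp
  have hre : (γ t / c).re - k * (deriv γ t / c).im = (γ τ / c).re := by
    rw [← h.re_strip τ u, ← he, e1]; simp; ring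
  have him : (γ t / c).im + k * (deriv γ t / c).re = (γ τ / c).im + u := by
    rw [← h.im_strip τ u, ← he, e1]; simp
  have h1 := h.abs_im_sub_le ht hτ
  have h2 := h.cone t ht
  have h3 := h.pos t ht
  have h4 : |(γ τ / c).re - (γ t / c).re| = |k| * |(deriv γ t / c).im| := by
    rw [← hre, ← abs_mul, ← abs_neg]; congr 1; ring
  rw [h4] at h1
  -- Passing from the foot `t` to the foot `τ` changes the height of the curve by at most a quarter
  -- of the collar displacement `k · re`, which therefore decides the sign of `u`.
  have h5 : |(γ τ / c).im - (γ t / c).im| ≤ |k| * (deriv γ t / c).re / 4 := by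
    nlinarith [abs_nonneg k]
  have h6 := abs_le.1 h5
  rcases lt_trichotomy k 0 with hk | hk | hk
  · rw [abs_of_neg hk] at h6
    have : k * (deriv γ t / c).re < 0 := mul_neg_of_neg_of_pos hk h3
    have hu : u < 0 := by linarith
    exact ⟨⟨fun h => absurd h hu.not_gt, fun h => absurd h hk.not_gt⟩, by simp [hu, hk]⟩
  · subst hk
    simp only [abs_zero, zero_mul, zero_div, neg_zero] at h6 him
    have : u = 0 := by linarith
    simp [this]
  · rw [abs_of_pos hk] at h6
    have : 0 < k * (deriv γ t / c).re := mul_pos hk h3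
    have hu : 0 < u := by linarith
    exact ⟨by simp [hu, hk], ⟨fun h => absurd h hu.not_gt, fun h => absurd h hk.not_gt⟩⟩

end InCone

/-- The derivative of the collar at `(t, 0)` is `(x, y) ↦ (x + iy) γ'(t)`, which is surjective, so
the collar covers a neighbourhood of `γ t`. Since `γ'` occurs in the collar, `γ` has to be `C²` for
the collar to be `C¹`. -/
lemma map_collar_nhds {γ : ℝ → ℂ} {t : ℝ} (h : ContDiffAt ℝ 2 γ t) (h0 : deriv γ t ≠ 0) :
    map (collar γ) (𝓝 (t, 0)) = 𝓝 (γ t) := by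
  have h1 := h.contDiffAt_deriv_two
  have hof : ContDiff ℝ 1 (fun p : ℝ × ℝ => (p.2 : ℂ)) :=
    Complex.ofRealCLM.contDiff.comp contDiff_snd
  have hC : ContDiffAt ℝ 1 (collar γ) (t, 0) := by
    unfold collar
    exact ((h.of_le (by norm_num)).comp (t, (0 : ℝ)) contDiffAt_fst).add
      ((contDiffAt_const.mul hof.contDiffAt).mul (h1.comp (t, (0 : ℝ)) contDiffAt_fst))
  have hs := hC.hasStrictFDerivAt one_ne_zero
  have hr : (fderiv ℝ (collar γ) (t, 0)).range = ⊤ := by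
    rw [LinearMap.range_eq_top]
    intro z
    refine ⟨((z / deriv γ t).re, (z / deriv γ t).im), ?_⟩
    have e0 : HasFDerivAt (Prod.fst : ℝ × ℝ → ℝ) (ContinuousLinearMap.fst ℝ ℝ ℝ) (t, (0 : ℝ)) :=
      hasFDerivAt_fst
    have e1 : HasFDerivAt (fun p : ℝ × ℝ => γ p.1)
        ((ContinuousLinearMap.fst ℝ ℝ ℝ).smulRight (deriv γ t)) (t, (0 : ℝ)) := by
      have := HasFDerivAt.comp (t, (0 : ℝ))
        ((h.differentiableAt two_ne_zero).hasDerivAt.hasFDerivAt : HasFDerivAt γ _ t) e0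
      convert! this using 1
    have e2 : HasFDerivAt (fun p : ℝ × ℝ => deriv γ p.1)
        ((ContinuousLinearMap.fst ℝ ℝ ℝ).smulRight (deriv (deriv γ) t)) (t, (0 : ℝ)) := by
      have := HasFDerivAt.comp (t, (0 : ℝ))
        ((h1.differentiableAt one_ne_zero).hasDerivAt.hasFDerivAt : HasFDerivAt (deriv γ) _ t) e0
      convert! this using 1
    have e3 : HasFDerivAt (fun p : ℝ × ℝ => (p.2 : ℂ)) _ (t, (0 : ℝ)) :=
      Complex.ofRealCLM.hasFDerivAt.comp (t, (0 : ℝ)) hasFDerivAt_snd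
    have e4 := e1.add ((e3.const_mul Complex.I).mul e2)
    have e5 : fderiv ℝ (collar γ) (t, 0) = _ := HasFDerivAt.fderiv e4
    rw [e5]
    have hz : (((z / deriv γ t).re : ℂ) + (z / deriv γ t).im * Complex.I) * deriv γ t = z := by
      rw [Complex.re_add_im]; field_simp
    refine Eq.trans ?_ hz
    generalize z / deriv γ t = w
    simp [-Complex.re_add_im]
    ring
  have := hs.map_nhds_eq_of_surj hr
  simpa [collar] using this

lemma exists_collar_nhds {γ : ℝ → ℂ} {t : ℝ} (h : ContDiffAt ℝ 2 γ t) (h0 : deriv γ t ≠ 0)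
    {N : Set (ℝ × ℝ)} (hN : N ∈ 𝓝 (t, (0 : ℝ))) : ∀ᶠ z in 𝓝 (γ t), ∃ p ∈ N, collar γ p = z := by
  rw [← map_collar_nhds h h0]
  filter_upwards [image_mem_map hN] with z hz using hz

lemma tendsto_strip (γ : ℝ → ℂ) (c : ℂ) (t : ℝ) :
    Tendsto (fun u : ℝ => strip γ c (t, u)) (𝓝[>] 0) (𝓝 (γ t)) := by
  have : Continuous (fun u : ℝ => γ t + Complex.I * c * (u : ℂ)) := by fun_prop
  have h := this.tendsto 0
  simp only [Complex.ofReal_zero, mul_zero, add_zero] at h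
  exact h.mono_left nhdsWithin_le_nhds

/-- A filter on `ℝ × ℝ` of points `(t', k)` near `(t, 0)` with `k` in `s`. -/
lemma eventually_prod_nhdsWithin {t : ℝ} {s : Set ℝ} {p : ℝ × ℝ → Prop} :
    (∀ᶠ q in 𝓝 t ×ˢ 𝓝[s] (0 : ℝ), p q) ↔ ∀ᶠ q in 𝓝 (t, (0 : ℝ)), q.2 ∈ s → p q := by
  have : 𝓝 t ×ˢ 𝓝[s] (0 : ℝ) = 𝓝 (t, (0 : ℝ)) ⊓ 𝓟 (univ ×ˢ s) := by
    rw [← nhdsWithin_univ, ← nhdsWithin_prod_eq]; rfl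
  rw [this, eventually_inf_principal]
  simp

namespace InCone
variable {γ : ℝ → ℂ} {c : ℂ} {a b : ℝ}

/-- A strip point above the curve is also a nearby collar point, of positive height by
`collar_side`, so the boundary value in collar coordinates is also the limit along the strip, as
Green's formula requires. -/
lemma tendsto_strip_left (hC : InCone γ c a b) {t : ℝ} (ht : t ∈ Ioo a b)
    (h : ContDiffAt ℝ 2 γ t) (h0 : deriv γ t ≠ 0) {f : ℂ → ℂ} {l : ℂ}
    (hl : Tendsto (fun p => f (collar γ p)) (𝓝 t ×ˢ 𝓝[>] 0) (𝓝 l)) :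
    Tendsto (fun u => f (strip γ c (t, u))) (𝓝[>] 0) (𝓝 l) := by
  intro V hV
  have h1 := eventually_prod_nhdsWithin.1 (hl hV)
  have h2 : ∀ᶠ q : ℝ × ℝ in 𝓝 (t, (0 : ℝ)), q.1 ∈ Icc a b :=
    continuousAt_fst.eventually (Icc_mem_nhds ht.1 ht.2)
  have h3 := (tendsto_strip γ c t).eventually (exists_collar_nhds h h0 (h1.and h2))
  rw [mem_map]
  filter_upwards [h3, self_mem_nhdsWithin] with u ⟨p, hp, he⟩ hu
  rw [mem_preimage, ← he]
  exact hp.1 ((hC.collar_side hp.2 (Ioo_subset_Icc_self ht) he).1.1 hu)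

lemma tendsto_strip_right (hC : InCone γ c a b) {t : ℝ} (ht : t ∈ Ioo a b)
    (h : ContDiffAt ℝ 2 γ t) (h0 : deriv γ t ≠ 0) {f : ℂ → ℂ} {l : ℂ}
    (hl : Tendsto (fun p => f (collar γ p)) (𝓝 t ×ˢ 𝓝[<] 0) (𝓝 l)) :
    Tendsto (fun u => f (strip γ (-c) (t, u))) (𝓝[>] 0) (𝓝 l) := by
  intro V hV
  have h1 := eventually_prod_nhdsWithin.1 (hl hV)
  have h2 : ∀ᶠ q : ℝ × ℝ in 𝓝 (t, (0 : ℝ)), q.1 ∈ Icc a b :=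
    continuousAt_fst.eventually (Icc_mem_nhds ht.1 ht.2)
  have h3 := (tendsto_strip γ (-c) t).eventually (exists_collar_nhds h h0 (h1.and h2))
  rw [mem_map]
  filter_upwards [h3, self_mem_nhdsWithin] with u ⟨p, hp, he⟩ hu
  rw [mem_preimage, ← he]
  rw [neg_strip] at he
  exact hp.1 ((hC.collar_side hp.2 (Ioo_subset_Icc_self ht) he).2.1 (neg_neg_of_pos hu))

end InCone

/-! ### Topology and measure of a contour system. -/

namespace ContourSystem
variable {ι : Type*} (C : ContourSystem ι)

lemma contDiffAt_path (j : ι) {t : ℝ} (ht : t ∈ Ioo (0 : ℝ) 1) : ContDiffAt ℝ 2 (C.path j) t :=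
  (C.smooth j).contDiffAt (isOpen_Ioo.mem_nhds ht)

lemma continuousOn_path (j : ι) : ContinuousOn (C.path j) (Ioo 0 1) := (C.smooth j).continuousOn

lemma differentiableAt_path (j : ι) {t : ℝ} (ht : t ∈ Ioo (0 : ℝ) 1) :
    DifferentiableAt ℝ (C.path j) t := (C.contDiffAt_path j ht).differentiableAt two_ne_zero

lemma path_mem_compl (j : ι) {t : ℝ} (ht : t ∈ Ioo (0 : ℝ) 1) : C.path j t ∈ C.domainᶜ := by
  rw [domain, compl_compl]
  exact Or.inl (mem_iUnion.2 ⟨j, mem_image_of_mem _ ht⟩)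

lemma node_mem_compl {a : ℂ} (ha : a ∈ C.nodes) : a ∈ C.domainᶜ := by
  rw [domain, compl_compl]
  exact Or.inr ha

lemma not_node_of_mem {z : ℂ} (hz : z ∈ C.domain) : z ∉ C.nodes := fun h =>
  C.node_mem_compl h hz

lemma ne_zero_of_mem {z : ℂ} (hz : z ∈ C.domain) : z ≠ 0 := fun h =>
  C.not_node_of_mem hz (h ▸ C.zero_mem)

lemma isOpen_compl_nodes : IsOpen ((C.nodes : Set ℂ)ᶜ) := C.nodes.finite_toSet.isClosed.isOpen_compl

lemma eventually_ne_of_end {γ : ℝ → ℂ} {l : Filter ℝ} {x : ℂ}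
    (h : (∃ a, a ≠ x ∧ Tendsto γ l (𝓝 a)) ∨ Tendsto γ l (cobounded ℂ)) :
    ∃ V ∈ 𝓝 x, ∀ᶠ t in l, γ t ∉ V := by
  rcases h with ⟨a, ha, h⟩ | h
  · obtain ⟨u, v, hu, hv, huv⟩ := t2_separation_nhds ha
    exact ⟨v, hv, (h.eventually hu).mono fun t ht hv => disjoint_left.1 huv ht hv⟩
  · refine ⟨Metric.ball x 1, Metric.ball_mem_nhds x one_pos, ?_⟩
    exact h.eventually (isBounded_def.1 Metric.isBounded_ball)

/-- A closed part of an arc that misses a point which is not a node stays away from it. -/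
lemma eventually_avoid (i : ι) {x : ℂ} (hx : x ∉ C.nodes) {U : Set ℝ} (hU : IsOpen U)
    (h : ∀ t ∈ Ioo (0 : ℝ) 1 \ U, C.path i t ≠ x) :
    ∀ᶠ z in 𝓝 x, ∀ t ∈ Ioo (0 : ℝ) 1 \ U, C.path i t ≠ z := by
  -- Near each of its two ends the arc leaves some neighbourhood of `x`, because it runs to infinity
  -- or to a node, and `x` is not a node. What remains of the parameter interval outside `U` is
  -- compact.
  obtain ⟨V, hV, hV'⟩ := eventually_ne_of_end (γ := C.path i) (l := 𝓝[>] 0) (x := x)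
    ((C.source i).imp (fun ⟨a, ha, h⟩ => ⟨a, fun e => hx (e ▸ ha), h⟩) id)
  obtain ⟨W, hW, hW'⟩ := eventually_ne_of_end (γ := C.path i) (l := 𝓝[<] 1) (x := x)
    ((C.target i).imp (fun ⟨a, ha, h⟩ => ⟨a, fun e => hx (e ▸ ha), h⟩) id)
  obtain ⟨p, hp, hp'⟩ := mem_nhdsGT_iff_exists_Ioo_subset.1 hV'
  obtain ⟨q, hq, hq'⟩ := mem_nhdsLT_iff_exists_Ioo_subset.1 hW'
  
  have hp0 : (0 : ℝ) < p := hp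
  have hq1 : q < (1 : ℝ) := hq
  have hK : IsCompact (Icc p q \ U) := isCompact_Icc.diff hU
  have hK1 : Icc p q \ U ⊆ Ioo 0 1 := fun t ht => ⟨hp0.trans_le ht.1.1, ht.1.2.trans_lt hq1⟩
  have hc : IsClosed (C.path i '' (Icc p q \ U)) :=
    (hK.image_of_continuousOn ((C.continuousOn_path i).mono hK1)).isClosed
  have hn : x ∉ C.path i '' (Icc p q \ U) := by
    rintro ⟨t, ht, e⟩; exact h t ⟨hK1 ht, ht.2⟩ e
  filter_upwards [hV, hW, hc.isOpen_compl.mem_nhds hn] with z h1 h2 h3 t ht e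
  by_cases htp : t < p
  · exact hp' ⟨ht.1.1, htp⟩ (by simpa [e] using h1)
  by_cases htq : q < t
  · exact hq' ⟨htq, ht.1.2⟩ (by simpa [e] using h2)
  · exact h3 ⟨t, ⟨⟨not_lt.1 htp, not_lt.1 htq⟩, ht.2⟩, e⟩

lemma isOpen_domain [Finite ι] : IsOpen C.domain := by
  rw [isOpen_iff_mem_nhds]
  intro x hx
  have h1 : ∀ᶠ z in 𝓝 x, ∀ i, ∀ t ∈ Ioo (0 : ℝ) 1 \ ∅, C.path i t ≠ z := by
    rw [eventually_all]
    intro i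
    exact C.eventually_avoid i (C.not_node_of_mem hx) isOpen_empty
      fun t ht e => C.path_mem_compl i ht.1 (e ▸ hx)
  filter_upwards [h1, C.isOpen_compl_nodes.mem_nhds (C.not_node_of_mem hx)] with z h2 h3
  rw [domain, mem_compl_iff]
  rintro (h | h)
  · obtain ⟨i, t, ht, e⟩ := mem_iUnion.1 h
    exact h2 i t ⟨ht, notMem_empty t⟩ e
  · exact h3 h

/-- Near a point of an arc which is not a node, the contours consist of this arc only. -/
lemma eventually_mem_arc [Finite ι] {j : ι} {t₀ : ℝ} (ht : t₀ ∈ Ioo (0 : ℝ) 1)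
    (hn : C.path j t₀ ∉ C.nodes) {U : Set ℝ} (hU : IsOpen U) (hU0 : t₀ ∈ U) :
    ∀ᶠ z in 𝓝 (C.path j t₀), (z ∉ C.domain → ∃ t ∈ U ∩ Ioo 0 1, C.path j t = z) ∧
      z ∉ C.nodes ∧ ∀ i ≠ j, ∀ t ∈ Ioo (0 : ℝ) 1, C.path i t ≠ z := by
  have h1 : ∀ᶠ z in 𝓝 (C.path j t₀), ∀ i, i ≠ j → ∀ t ∈ Ioo (0 : ℝ) 1 \ ∅, C.path i t ≠ z := by
    rw [eventually_all]
    intro i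
    by_cases hij : i = j
    · simp [hij]
    · filter_upwards [C.eventually_avoid i hn isOpen_empty fun t h e =>
        hn (e ▸ C.meet i j hij t h.1 t₀ ht e)] with z hz _ using hz
  have h2 := C.eventually_avoid j hn hU fun t h e => h.2 (C.injOn j h.1 ht e ▸ hU0)
  filter_upwards [h1, h2, C.isOpen_compl_nodes.mem_nhds hn] with z h1 h2 h3
  refine ⟨fun hz => ?_, h3, fun i hi t ht => h1 i hi t ⟨ht, notMem_empty t⟩⟩
  rw [domain, mem_compl_iff, not_not] at hz
  rcases hz with h | h
  · obtain ⟨i, t, ht', e⟩ := mem_iUnion.1 h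
    have hij : i = j := by
      by_contra hij
      exact h1 i hij t ⟨ht', notMem_empty t⟩ e
    subst hij
    refine ⟨t, ⟨?_, ht'⟩, e⟩
    by_contra htU
    exact h2 t ⟨ht', htU⟩ e
  · exact absurd h h3

lemma exists_inCone (j : ι) {t₀ : ℝ} (ht : t₀ ∈ Ioo (0 : ℝ) 1) :
    ∃ a b, a < t₀ ∧ t₀ < b ∧ Icc a b ⊆ Ioo 0 1 ∧
      InCone (C.path j) (deriv (C.path j) t₀) a b :=
  _root_.exists_inCone (C.contDiffAt_path j ht) (C.regular j t₀ ht) (isOpen_Ioo.mem_nhds ht)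

/-- A nearby collar point on the contours lies on the `j`-th arc itself, hence is a strip point of
height zero, and `collar_side` forces its collar height to vanish. -/
lemma eventually_collar_nhds [Finite ι] {j : ι} {t₀ : ℝ} (ht : t₀ ∈ Ioo (0 : ℝ) 1)
    (hn : C.path j t₀ ∉ C.nodes) :
    ∀ᶠ p in 𝓝 (t₀, (0 : ℝ)), (p.2 ≠ 0 ↔ collar (C.path j) p ∈ C.domain) := by
  obtain ⟨a, b, ha, hb, hab, hC⟩ := C.exists_inCone j ht
  have h1 := map_collar_nhds (C.contDiffAt_path j ht) (C.regular j t₀ ht)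
  have h2 := C.eventually_mem_arc ht hn isOpen_Ioo (U := Ioo a b) ⟨ha, hb⟩
  rw [← h1, eventually_map] at h2
  have h3 : ∀ᶠ q : ℝ × ℝ in 𝓝 (t₀, (0 : ℝ)), q.1 ∈ Icc a b :=
    continuousAt_fst.eventually (Icc_mem_nhds ha hb)
  filter_upwards [h2, h3] with p hp hp3
  constructor
  · intro hp0
    by_contra hd
    obtain ⟨τ, hτ, e⟩ := hp.1 hd
    have e' : collar (C.path j) (p.1, p.2) = strip (C.path j) (deriv (C.path j) t₀) (τ, 0) := by
      rw [Prod.mk.eta, ← e]; simp [strip]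
    have := hC.collar_side hp3 (Ioo_subset_Icc_self hτ.1) e'
    simp only [lt_self_iff_false, false_iff, not_lt] at this
    exact hp0 (le_antisymm this.1 this.2)
  · intro hd h0
    refine C.path_mem_compl j (hab hp3) ?_
    have : collar (C.path j) p = C.path j p.1 := by simp [collar, h0]
    rwa [this] at hd

/-- An arc is the image of a real segment, a null set in the plane, under `z ↦ γ(Re z)`, and a map
of the plane to itself which is differentiable on a null set sends it to a null set. -/
lemma volume_compl_domain [Finite ι] : volume C.domainᶜ = 0 := by
  rw [domain, compl_compl]
  have hline : volume {z : ℂ | z.im = 0} = 0 := by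
    have : {z : ℂ | z.im = 0} = (LinearMap.ker (Complex.imLm : ℂ →ₗ[ℝ] ℝ) : Set ℂ) := by
      ext z; simp
    rw [this]
    apply Measure.addHaar_submodule
    intro h
    have : Complex.I ∈ LinearMap.ker (Complex.imLm : ℂ →ₗ[ℝ] ℝ) := by rw [h]; trivial
    simp at this
  refine measure_union_null ?_ (C.nodes.finite_toSet.measure_zero _)
  refine (measure_iUnion_null_iff).2 fun j => ?_
  have : C.path j '' Ioo 0 1 = (fun z : ℂ => C.path j z.re) '' {z : ℂ | z.im = 0 ∧ z.re ∈ Ioo (0 : ℝ) 1} := by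
    ext z; constructor
    · rintro ⟨t, ht, rfl⟩; exact ⟨t, by simpa using ht, by simp⟩
    · rintro ⟨t, ht, rfl⟩; exact ⟨t.re, ht.2, rfl⟩
  rw [this]
  refine addHaar_image_eq_zero_of_differentiableOn_of_addHaar_eq_zero _ ?_
    (measure_mono_null (fun z hz => hz.1) hline)
  intro z hz
  exact ((C.differentiableAt_path j hz.2).comp z
    Complex.reCLM.differentiableAt).differentiableWithinAt

lemma dense_domain [Finite ι] : Dense C.domain := by
  have : ∀ᵐ z : ℂ, z ∈ C.domain := by
    rw [ae_iff]; exact C.volume_compl_domain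
  exact Measure.dense_of_ae this

end ContourSystem

/-! ### The jump formula in the sense of distributions. -/

namespace ContourSystem
variable {ι : Type*} {C : ContourSystem ι}

/-- `f` is holomorphic off the contours with boundary values `L` from the left and `R` from the
right. -/
structure Sides (C : ContourSystem ι) (f : ℂ → ℂ) (L R : ι → ℝ → ℂ) : Prop where
  holo : DifferentiableOn ℂ f C.domain
  left : ∀ j, ∀ t ∈ Ioo (0 : ℝ) 1, C.path j t ∉ C.nodes →
    Tendsto (fun p => f (collar (C.path j) p)) (𝓝 t ×ˢ 𝓝[>] 0) (𝓝 (L j t))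
  right : ∀ j, ∀ t ∈ Ioo (0 : ℝ) 1, C.path j t ∉ C.nodes →
    Tendsto (fun p => f (collar (C.path j) p)) (𝓝 t ×ˢ 𝓝[<] 0) (𝓝 (R j t))

namespace Sides
variable [Finite ι] {f : ℂ → ℂ} {L R : ι → ℝ → ℂ}

/-- The boundary values are limits in `(t, h)` jointly, so they bound `f` on a full one-sided
neighbourhood. This gives the domination for Green's formula at the curve and the integrability of
`f` against test functions. -/
lemma locally_bounded (h : C.Sides f L R) {x : ℂ} (hx : x ∉ C.nodes) :
    ∃ M : ℝ, ∀ᶠ z in 𝓝 x, z ∈ C.domain → ‖f z‖ ≤ M := by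
  by_cases hd : x ∈ C.domain
  · refine ⟨‖f x‖ + 1, ?_⟩
    have := (h.holo.continuousOn.continuousAt (C.isOpen_domain.mem_nhds hd)).norm.eventually
      (ge_mem_nhds (lt_add_one ‖f x‖))
    filter_upwards [this] with z hz _ using hz
  · rw [domain, mem_compl_iff, not_not] at hd
    obtain ⟨j, t, ht, rfl⟩ := mem_iUnion.1 (hd.resolve_right hx)
    have h1 := eventually_prod_nhdsWithin.1
      ((h.left j t ht hx).norm.eventually (ge_mem_nhds (lt_add_one ‖L j t‖)))
    have h2 := eventually_prod_nhdsWithin.1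
      ((h.right j t ht hx).norm.eventually (ge_mem_nhds (lt_add_one ‖R j t‖)))
    have h3 := C.eventually_collar_nhds ht hx
    refine ⟨max (‖L j t‖ + 1) (‖R j t‖ + 1), ?_⟩
    filter_upwards [exists_collar_nhds (C.contDiffAt_path j ht) (C.regular j t ht)
      (h1.and (h2.and h3))] with z ⟨p, hp, e⟩ hz
    rw [← e] at hz ⊢
    rcases (hp.2.2.2 hz).lt_or_gt with h0 | h0
    · exact le_max_of_le_right (hp.2.1 h0)
    · exact le_max_of_le_left (hp.1 h0)

lemma aestronglyMeasurable (h : C.Sides f L R) : AEStronglyMeasurable f volume := by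
  have h1 := h.holo.continuousOn.aestronglyMeasurable (μ := volume) C.isOpen_domain.measurableSet
  rwa [Measure.restrict_eq_self_of_ae_mem] at h1
  rw [ae_iff]; exact C.volume_compl_domain

lemma ae_mem_domain (C : ContourSystem ι) : ∀ᵐ z : ℂ, z ∈ C.domain := by
  rw [ae_iff]; exact C.volume_compl_domain

lemma integrable_mul (h : C.Sides f L R) {φ : ℂ → ℂ} (hφ : Continuous φ)
    (hc : HasCompactSupport φ) (hn : ∀ a ∈ C.nodes, a ∉ tsupport φ) :
    Integrable (fun z => f z * φ z) := by
  have hloc : LocallyIntegrableOn f (tsupport φ) := by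
    intro x hx
    obtain ⟨M, hM⟩ := h.locally_bounded fun hx' => hn x hx' hx
    obtain ⟨ε, hε, hs⟩ := Metric.eventually_nhds_iff_ball.1 hM
    refine ⟨Metric.ball x ε, mem_nhdsWithin_of_mem_nhds (Metric.ball_mem_nhds x hε), ?_⟩
    refine IntegrableOn.of_bound measure_ball_lt_top h.aestronglyMeasurable.restrict M ?_
    filter_upwards [ae_restrict_of_ae (ae_mem_domain C), ae_restrict_mem measurableSet_ball]
      with z h1 h2 using hs z h2 h1
  have h1 := hloc.integrableOn_isCompact hc
  have h2 : IntegrableOn (fun z => f z * φ z) (tsupport φ) :=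
    h1.mul_continuousOn hφ.continuousOn hc
  rwa [integrableOn_iff_integrable_of_support_subset] at h2
  exact fun z hz => subset_tsupport φ (Function.support_mul_subset_right f φ hz)

end Sides
end ContourSystem

lemma integral_dbar_eq_zero {G : ℂ → ℂ} (hG : ContDiff ℝ 1 G) (hc : HasCompactSupport G) :
    ∫ z, dbar G z = 0 := by
  have hi : ∀ v : ℂ, Integrable (fun z => fderiv ℝ G z v) := fun v =>
    ((hG.continuous_fderiv one_ne_zero).clm_apply continuous_const).integrable_of_hasCompactSupport
      (hc.fderiv_apply (𝕜 := ℝ) v)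
  have h0 : ∀ v : ℂ, ∫ z, fderiv ℝ G z v = 0 := by
    intro v
    have := integral_mul_fderiv_eq_neg_fderiv_mul_of_integrable (μ := (volume : Measure ℂ))
      (f := fun _ : ℂ => (1 : ℂ)) (g := G) (v := v) (by simp) (by simpa using hi v)
      (by simpa using hG.continuous.integrable_of_hasCompactSupport hc)
      (fun _ _ => differentiableAt_const _) (fun _ _ => hG.differentiable one_ne_zero _)
    simpa using this
  simp only [dbar]
  rw [integral_div, integral_add (hi 1) ((hi _).const_mul _), integral_const_mul, h0, h0]
  simp

namespace ContourSystem.Sides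
variable {ι : Type*} {C : ContourSystem ι} [Fintype ι] {f : ℂ → ℂ} {L R : ι → ℝ → ℂ}

lemma hasCompactSupport_dbar {ψ : ℂ → ℂ} (hc : HasCompactSupport ψ) :
    HasCompactSupport (dbar ψ) :=
  HasCompactSupport.intro hc fun _ hz => dbar_eq_zero_of_notMem_tsupport hz

lemma tsupport_dbar_subset (ψ : ℂ → ℂ) : tsupport (dbar ψ) ⊆ tsupport ψ :=
  closure_minimal (fun z hz => by
    by_contra h; exact hz (dbar_eq_zero_of_notMem_tsupport h)) (isClosed_tsupport ψ)

lemma local_formula_domain (h : C.Sides f L R) {ψ : ℂ → ℂ} (hψ : ContDiff ℝ 1 ψ)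
    (hc : HasCompactSupport ψ) (hs : tsupport ψ ⊆ C.domain) :
    ∫ z, f z * dbar ψ z = 1 / (2 * Complex.I) *
      ∑ j, ∫ t in Ioo (0 : ℝ) 1, (L j t - R j t) * ψ (C.path j t) * deriv (C.path j) t := by
  have h1 : ∀ z, f z * dbar ψ z = dbar (fun z => f z * ψ z) z := fun z =>
    (dbar_mul_of_tsupport C.isOpen_domain h.holo hψ fun hz => hs hz).symm
  simp_rw [h1]
  rw [integral_dbar_eq_zero]
  · rw [Finset.sum_eq_zero, mul_zero]
    intro j _
    refine setIntegral_eq_zero_of_forall_eq_zero fun t ht => ?_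
    have : C.path j t ∉ tsupport ψ := fun h' => C.path_mem_compl j ht (hs h')
    rw [image_eq_zero_of_notMem_tsupport this]; simp
  · exact contDiff_iff_contDiffAt.2 fun z =>
      contDiffAt_mul_of_tsupport C.isOpen_domain h.holo hψ fun hz => hs hz
  · exact hc.mul_left

/-- In a small ball the contours reduce to a piece of one arc, and up to a null set the ball lies in
two half strips, with directions `c` and `-c`. `half_strip` on each of them gives boundary terms of
opposite signs, hence the difference `L - R`. -/
lemma local_formula_arc (h : C.Sides f L R) {j : ι} {t₀ : ℝ} (ht₀ : t₀ ∈ Ioo (0 : ℝ) 1)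
    (hn : C.path j t₀ ∉ C.nodes) :
    ∃ W, IsOpen W ∧ C.path j t₀ ∈ W ∧ ∀ ψ : ℂ → ℂ, ContDiff ℝ 1 ψ → HasCompactSupport ψ →
      tsupport ψ ⊆ W → ∫ z, f z * dbar ψ z = 1 / (2 * Complex.I) *
      ∑ j, ∫ t in Ioo (0 : ℝ) 1, (L j t - R j t) * ψ (C.path j t) * deriv (C.path j) t := by
  obtain ⟨a, b, ha, hb, hab, hC⟩ := C.exists_inCone j ht₀
  set γ := C.path j
  set c := deriv γ t₀
  have hc0 := hC.ne_zero
  obtain ⟨M, hM⟩ := h.locally_bounded hn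
  have h1 := C.eventually_mem_arc ht₀ hn isOpen_Ioo (U := Ioo a b) ⟨ha, hb⟩
  have ht₀' : t₀ ∈ Icc a b := ⟨ha.le, hb.le⟩
  have hre : ContinuousAt (fun z : ℂ => (z / c).re) (γ t₀) :=
    (Complex.continuous_re.comp (continuous_id.div_const c)).continuousAt
  have him : ContinuousAt (fun z : ℂ => |(z / c).im|) (γ t₀) :=
    (Complex.continuous_im.comp (continuous_id.div_const c)).abs.continuousAt
  have h2 := hre.eventually
    (lt_mem_nhds (hC.strictMonoOn_re (left_mem_Icc.2 hC.lt.le) ht₀' ha))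
  have h3 := hre.eventually
    (gt_mem_nhds (hC.strictMonoOn_re ht₀' (right_mem_Icc.2 hC.lt.le) hb))
  have h4 := him.eventually (gt_mem_nhds (lt_add_one _))
  set K₁ := |(γ t₀ / c).im| + 1
  have hcγ : ContinuousOn γ (Icc a b) := fun t ht => (hC.diff t ht).continuousAt.continuousWithinAt
  obtain ⟨K₂, hK₂⟩ := isCompact_Icc.exists_bound_of_continuousOn
    ((Complex.continuous_im.comp_continuousOn (hcγ.div_const c)))
  obtain ⟨ε, hε, hB⟩ := Metric.eventually_nhds_iff_ball.1
    (h1.and (hM.and (h2.and (h3.and h4))))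
  set B := Metric.ball (γ t₀) ε with hBdef
  -- `K₁` bounds `|Im(z/c)|` in the ball and `|K₂|` bounds it on the curve; the height `u` is the
  -- difference of the two.
  have hbox : ∀ t ∈ Icc a b, ∀ u, strip γ c (t, u) ∈ B → t ∈ Ioo a b ∧ |u| < K₁ + |K₂| := by
    intro t ht u hu
    obtain ⟨-, -, g1, g2, g3⟩ := hB _ hu
    rw [hC.re_strip] at g1 g2
    rw [hC.im_strip] at g3
    refine ⟨⟨?_, ?_⟩, ?_⟩
    · exact (hC.strictMonoOn_re.lt_iff_lt (left_mem_Icc.2 hC.lt.le) ht).1 g1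
    · exact (hC.strictMonoOn_re.lt_iff_lt ht (right_mem_Icc.2 hC.lt.le)).1 g2
    · have g4 : |(γ t / c).im| ≤ |K₂| := (hK₂ t ht).trans (le_abs_self _)
      calc |u| = |((γ t / c).im + u) - (γ t / c).im| := by congr 1; ring
        _ ≤ |(γ t / c).im + u| + |(γ t / c).im| := abs_sub _ _
        _ < _ := by linarith
  have hdom : ∀ t ∈ Icc a b, ∀ u ≠ 0, strip γ c (t, u) ∈ B → strip γ c (t, u) ∈ C.domain := by
    intro t ht u hu0 hu
    by_contra hd
    obtain ⟨τ, hτ, e⟩ := (hB _ hu).1.1 hd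
    have : strip γ c (t, u) = strip γ c (τ, 0) := by
      rw [← e]; simp [strip, γ]
    have := hC.injOn_strip ⟨ht, trivial⟩ ⟨Ioo_subset_Icc_self hτ.1, trivial⟩ this
    exact hu0 (Prod.mk.inj this).2
  have hmap : B ⊆ strip γ c '' (Ioo a b ×ˢ Ioi 0) ∪ strip γ (-c) '' (Ioo a b ×ˢ Ioi 0) ∪
      C.domainᶜ := by
    intro z hz
    obtain ⟨-, -, g1, g2, -⟩ := hB z hz
    obtain ⟨t, ht, e⟩ := intermediate_value_Ioo hC.lt.le
      (Complex.continuous_re.comp_continuousOn (hcγ.div_const c)) ⟨g1, g2⟩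
    simp only [Function.comp] at e
    set u := (z / c).im - (γ t / c).im
    have hz' : z = strip γ c (t, u) := by
      have : z / c = strip γ c (t, u) / c := by
        apply Complex.ext
        · rw [hC.re_strip, e]
        · rw [hC.im_strip]; simp [u]
      field_simp at this
      exact this
    rcases lt_trichotomy u 0 with hu | hu | hu
    · refine Or.inl (Or.inr ⟨(t, -u), ⟨ht, neg_pos.2 hu⟩, ?_⟩)
      rw [InCone.neg_strip, neg_neg, hz']
    · refine Or.inr ?_
      rw [hz', hu]
      have : strip γ c (t, 0) = C.path j t := by simp [strip, γ]
      rw [this]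
      exact C.path_mem_compl j (hab (Ioo_subset_Icc_self ht))
    · exact Or.inl (Or.inl ⟨(t, u), ⟨ht, hu⟩, hz'.symm⟩)
  have hinj1 : InjOn (strip γ c) (Ioo a b ×ˢ Ioi 0) :=
    hC.injOn_strip.mono (prod_mono Ioo_subset_Icc_self (subset_univ _))
  have hinj : ∀ t ∈ Ioo a b, ∀ τ ∈ Ioo a b, ∀ u v, strip γ c (t, u) = strip γ c (τ, v) →
      t = τ ∧ u = v := fun t ht τ hτ u v e => Prod.mk.inj <| hC.injOn_strip
        (x₁ := (t, u)) (x₂ := (τ, v))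
        ⟨Ioo_subset_Icc_self ht, trivial⟩ ⟨Ioo_subset_Icc_self hτ, trivial⟩ e
  have hinj2 : InjOn (strip γ (-c)) (Ioo a b ×ˢ Ioi 0) := by
    rintro ⟨t, u⟩ ht ⟨τ, v⟩ hτ e
    rw [InCone.neg_strip, InCone.neg_strip] at e
    obtain ⟨h1, h2⟩ := hinj t ht.1 τ hτ.1 _ _ e
    rw [h1, neg_inj.1 h2]
  have hdisj : Disjoint (strip γ c '' (Ioo a b ×ˢ Ioi 0))
      (strip γ (-c) '' (Ioo a b ×ˢ Ioi 0)) := by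
    rw [disjoint_left]
    rintro _ ⟨⟨t, u⟩, ht, rfl⟩ ⟨⟨τ, v⟩, hτ, e⟩
    rw [InCone.neg_strip] at e
    have h1 := (hinj τ hτ.1 t ht.1 _ _ e).2
    have h2 : 0 < u := ht.2
    have h3 : 0 < v := hτ.2
    linarith
  have hd' : ∀ p ∈ Ioo a b ×ˢ Ioi (0 : ℝ), HasDerivAt γ (deriv γ p.1) p.1 :=
    fun p hp => hC.diff p.1 (Ioo_subset_Icc_self hp.1)
  have hm1 := measurableSet_strip (c := c) (measurableSet_Ioo.prod measurableSet_Ioi) hd' hinj1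
  have hm2 := measurableSet_strip (c := -c) (measurableSet_Ioo.prod measurableSet_Ioi) hd' hinj2
  have hpos : ∀ t ∈ Icc a b, 0 < (deriv γ t * (starRingEnd ℂ) c).re := by
    intro t ht
    have h1 : deriv γ t * (starRingEnd ℂ) c = (Complex.normSq c : ℂ) * (deriv γ t / c) := by
      rw [← Complex.mul_conj]; field_simp
    rw [h1, Complex.re_ofReal_mul]
    exact mul_pos (Complex.normSq_pos.2 hc0) (hC.pos t ht)
  have hnode : ∀ t ∈ Ioo a b, γ t ∈ B → γ t ∉ C.nodes := fun t _ htB => (hB _ htB).1.2.1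
  refine ⟨B, Metric.isOpen_ball, Metric.mem_ball_self hε, fun ψ hψ hcpt hsupp => ?_⟩
  obtain ⟨i1, e1⟩ := half_strip (s := 1) (A := K₁ + |K₂|) (M := M) (c := c) (fl := L j) (Or.inl rfl) hC.lt
    (by positivity) hC.diff hC.cont (by simpa using hpos)
    C.isOpen_domain h.holo hψ hsupp hcpt hbox (fun t ht u hu => hdom t ht u hu.ne')
    (fun z hz => (hB z hz.1).2.1 hz.2)
    (fun t ht htB => hC.tendsto_strip_left ht (C.contDiffAt_path j (hab (Ioo_subset_Icc_self ht)))
      (C.regular j t (hab (Ioo_subset_Icc_self ht)))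
      (h.left j t (hab (Ioo_subset_Icc_self ht)) (hnode t ht htB))) hinj1
  obtain ⟨i2, e2⟩ := half_strip (s := -1) (A := K₁ + |K₂|) (M := M) (c := -c) (fl := R j) (Or.inr rfl) hC.lt
    (by positivity) hC.diff hC.cont (by simpa using hpos)
    C.isOpen_domain h.holo hψ hsupp hcpt
    (fun t ht u hu => by
      rw [InCone.neg_strip] at hu
      simpa using hbox t ht (-u) hu)
    (fun t ht u hu hB' => by
      rw [InCone.neg_strip] at hB' ⊢
      exact hdom t ht (-u) (neg_ne_zero.2 hu.ne') hB')
    (fun z hz => (hB z hz.1).2.1 hz.2)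
    (fun t ht htB => hC.tendsto_strip_right ht (C.contDiffAt_path j (hab (Ioo_subset_Icc_self ht)))
      (C.regular j t (hab (Ioo_subset_Icc_self ht)))
      (h.right j t (hab (Ioo_subset_Icc_self ht)) (hnode t ht htB))) hinj2
  have hint : Integrable (fun z => f z * dbar ψ z) :=
    h.integrable_mul (continuous_dbar hψ) (hasCompactSupport_dbar hcpt)
      fun a ha ha' => (hB a (hsupp (tsupport_dbar_subset ψ ha'))).1.2.1 ha
  have e3 : ∫ z, f z * dbar ψ z = ∫ z in strip γ c '' (Ioo a b ×ˢ Ioi 0) ∪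
      strip γ (-c) '' (Ioo a b ×ˢ Ioi 0), f z * dbar ψ z := by
    refine (setIntegral_eq_integral_of_ae_compl_eq_zero ?_).symm
    filter_upwards [ae_mem_domain C] with z hz hn
    have : z ∉ tsupport ψ := fun h' =>
      (hmap (hsupp h')).elim hn fun h'' => h'' hz
    rw [dbar_eq_zero_of_notMem_tsupport this, mul_zero]
  rw [e3, setIntegral_union hdisj hm2 hint.integrableOn hint.integrableOn, e1, e2,
    Finset.sum_eq_single j]
  · have e4 : ∫ t in Ioo (0 : ℝ) 1, (L j t - R j t) * ψ (C.path j t) * deriv (C.path j) t =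
        ∫ t in Icc a b, (L j t - R j t) * ψ (C.path j t) * deriv (C.path j) t := by
      refine setIntegral_eq_of_subset_of_forall_sdiff_eq_zero measurableSet_Ioo hab ?_
      intro t ht
      have : γ t ∉ tsupport ψ := by
        intro h'
        obtain ⟨τ, hτ, e⟩ := (hB _ (hsupp h')).1.1 (C.path_mem_compl j ht.1)
        exact ht.2 (C.injOn j hτ.2 ht.1 e ▸ Ioo_subset_Icc_self hτ.1)
      rw [image_eq_zero_of_notMem_tsupport this]; simp
    have e5 : ∫ t in Icc a b, (L j t - R j t) * ψ (C.path j t) * deriv (C.path j) t =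
        (∫ t in Icc a b, deriv γ t * (L j t * ψ (γ t))) -
        ∫ t in Icc a b, deriv γ t * (R j t * ψ (γ t)) := by
      rw [← integral_sub i1 i2]
      congr 1; ext t; simp only [γ]; ring
    rw [e4, e5]
    push_cast
    ring
  · intro i _ hi
    refine setIntegral_eq_zero_of_forall_eq_zero fun t ht => ?_
    have : C.path i t ∉ tsupport ψ := fun h' => (hB _ (hsupp h')).1.2.2 i hi t ht rfl
    rw [image_eq_zero_of_notMem_tsupport this]; simp
  · simp

end ContourSystem.Sides

lemma dbar_sum {κ : Type*} (s : Finset κ) (φ : κ → ℂ → ℂ) (z : ℂ)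
    (h : ∀ i ∈ s, DifferentiableAt ℝ (φ i) z) :
    dbar (fun z => ∑ i ∈ s, φ i z) z = ∑ i ∈ s, dbar (φ i) z := by
  simp only [dbar]
  rw [fderiv_fun_sum h]
  simp only [FunLike.coe_sum, Finset.sum_apply]
  rw [Finset.mul_sum, ← Finset.sum_add_distrib, Finset.sum_div]

namespace ContourSystem.Sides
variable {ι : Type*} {C : ContourSystem ι} [Fintype ι] {f : ℂ → ℂ} {L R : ι → ℝ → ℂ}

lemma local_formula (h : C.Sides f L R) {x : ℂ} (hx : x ∉ C.nodes) :
    ∃ W, IsOpen W ∧ x ∈ W ∧ ∀ ψ : ℂ → ℂ, ContDiff ℝ 1 ψ → HasCompactSupport ψ →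
      tsupport ψ ⊆ W → ∫ z, f z * dbar ψ z = 1 / (2 * Complex.I) *
      ∑ j, ∫ t in Ioo (0 : ℝ) 1, (L j t - R j t) * ψ (C.path j t) * deriv (C.path j) t := by
  by_cases hd : x ∈ C.domain
  · exact ⟨C.domain, C.isOpen_domain, hd, fun ψ h1 h2 h3 => h.local_formula_domain h1 h2 h3⟩
  · rw [domain, mem_compl_iff, not_not] at hd
    obtain ⟨j, t, ht, rfl⟩ := mem_iUnion.1 (hd.resolve_right hx)
    exact h.local_formula_arc ht hx

/-- The jump formula `∂f/∂z̄ = (f_L - f_R) dx / 2i` in the sense of distributions, off the nodes. -/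
lemma jump_formula (h : C.Sides f L R)
    (hi : ∀ j, IntegrableOn (fun t => (L j t - R j t) * deriv (C.path j) t) (Ioo 0 1))
    {ψ : ℂ → ℂ} (hψ : ContDiff ℝ 1 ψ) (hc : HasCompactSupport ψ)
    (hs : ∀ a ∈ C.nodes, a ∉ tsupport ψ) :
    ∫ z, f z * dbar ψ z = 1 / (2 * Complex.I) *
      ∑ j, ∫ t in Ioo (0 : ℝ) 1, (L j t - R j t) * ψ (C.path j t) * deriv (C.path j) t := by
  choose! W hWo hWx hW using fun x (hx : x ∉ C.nodes) => h.local_formula hx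
  have hK : ∀ x ∈ tsupport ψ, x ∉ C.nodes := fun x hx hx' => hs x hx' hx
  obtain ⟨T, hT, hcov⟩ := hc.isCompact.elim_nhds_subcover W
    fun x hx => (hWo x (hK x hx)).mem_nhds (hWx x (hK x hx))
  -- Both sides are linear in `ψ`, so a partition of unity reduces the claim to the neighbourhoods
  -- given by `local_formula`.
  obtain ⟨ρ, hρ⟩ := SmoothPartitionOfUnity.exists_isSubordinate (I := modelWithCornersSelf ℝ ℂ)
    (s := tsupport ψ) (isClosed_tsupport ψ)
    (fun i : T => W i) (fun i => hWo _ (hK _ (hT i i.2))) (by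
      intro x hx
      obtain ⟨i, hi, hx'⟩ := mem_iUnion₂.1 (hcov hx)
      exact mem_iUnion.2 ⟨⟨i, hi⟩, hx'⟩)
  set φ : T → ℂ → ℂ := fun i z => (ρ i z : ℂ) * ψ z with hφ
  have hρs : ∀ i, ContDiff ℝ 1 (fun z => (ρ i z : ℂ)) := fun i =>
    Complex.ofRealCLM.contDiff.comp ((ρ i).contMDiff.contDiff.of_le (by simp))
  have hφs : ∀ i, ContDiff ℝ 1 (φ i) := fun i => (hρs i).mul hψ
  have hφc : ∀ i, HasCompactSupport (φ i) := fun i => hc.mul_left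
  have hφt : ∀ i, tsupport (φ i) ⊆ tsupport ψ := fun i =>
    closure_mono (Function.support_mul_subset_right _ _)
  have hφW : ∀ i : T, tsupport (φ i) ⊆ W i := fun i => by
    refine (closure_mono ?_).trans (hρ i)
    intro z hz h0
    exact hz (by simp [hφ, h0])
  have hsum : ψ = fun z => ∑ i, φ i z := by
    ext z
    by_cases hz : z ∈ tsupport ψ
    · have := ρ.sum_eq_one hz
      rw [finsum_eq_sum_of_fintype] at this
      simp only [hφ]
      rw [← Finset.sum_mul, ← Complex.ofReal_sum, this]; simp
    · simp [hφ, image_eq_zero_of_notMem_tsupport hz]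
  have hloc : ∀ i : T, _ := fun i => hW i (hK _ (hT i i.2)) (φ i) (hφs i) (hφc i) (hφW i)
  have e1 : ∀ z, f z * dbar ψ z = ∑ i, f z * dbar (φ i) z := by
    intro z
    conv_lhs => rw [hsum]
    rw [dbar_sum _ _ _ fun i _ => (hφs i).differentiable one_ne_zero z, Finset.mul_sum]
  simp_rw [e1]
  rw [integral_finsetSum _ fun i _ => h.integrable_mul (continuous_dbar (hφs i))
    (hasCompactSupport_dbar (hφc i)) fun a ha ha' =>
      hs a ha (hφt i (tsupport_dbar_subset _ ha'))]
  rw [Finset.sum_congr rfl fun i _ => hloc i, ← Finset.mul_sum, Finset.sum_comm]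
  congr 1
  refine Finset.sum_congr rfl fun j _ => ?_
  rw [← integral_finsetSum]
  · refine setIntegral_congr_fun measurableSet_Ioo fun t _ => ?_
    rw [congrFun hsum (C.path j t), Finset.mul_sum, Finset.sum_mul]
  · intro i _
    obtain ⟨M, hM⟩ := (hφs i).continuous.bounded_above_of_compact_support (hφc i)
    have := (hi j).bdd_mul (c := M) (f := fun t => φ i (C.path j t))
      (((hφs i).continuous.comp_continuousOn (C.continuousOn_path j)).aestronglyMeasurable
        measurableSet_Ioo) (ae_of_all _ fun t => hM _)
    refine this.congr (ae_of_all _ fun t => ?_)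
    simp only; ring

end ContourSystem.Sides

/-! ### Weyl's lemma and removal of the contours. -/

open scoped Convolution in
/-- Weyl's lemma for `∂/∂z̄`: a continuous distributional solution of `∂F/∂z̄ = 0` is
holomorphic. -/
lemma differentiableOn_of_integral_dbar_eq_zero {F : ℂ → ℂ} {W : Set ℂ} (hW : IsOpen W)
    (hF : ContinuousOn F W)
    (h : ∀ ψ : ℂ → ℂ, ContDiff ℝ 1 ψ → HasCompactSupport ψ → tsupport ψ ⊆ W →
      ∫ z, F z * dbar ψ z = 0) : DifferentiableOn ℂ F W := by
  suffices H : ∀ x ∈ W, ∃ ε > 0, DifferentiableOn ℂ F (Metric.ball x ε) by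
    intro x hx
    obtain ⟨ε, hε, hd⟩ := H x hx
    exact (hd.differentiableAt (Metric.ball_mem_nhds x hε)).differentiableWithinAt
  intro x hx
  obtain ⟨r, hr, hrW⟩ := Metric.isOpen_iff.1 hW x hx
  -- With centres within `ε` of `x` and mollifiers of radius at most `ε`, everything stays in the
  -- closed ball of radius `2ε`, which lies in `W`.
  set ε := r / 3 with hε
  have hε0 : 0 < ε := by positivity
  refine ⟨ε, hε0, ?_⟩
  set K := Metric.closedBall x (2 * ε) with hK
  have hKc : IsCompact K := isCompact_closedBall _ _
  have hKW : K ⊆ W := (Metric.closedBall_subset_ball (by linarith)).trans hrW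
  have hFK : ContinuousOn F K := hF.mono hKW
  -- Truncation makes the function integrable on the plane; the mollifications at points of the
  -- small ball do not see it.
  set g : ℂ → ℂ := K.indicator F with hg
  have hgi : Integrable g := (integrable_indicator_iff hKc.measurableSet).2
    (hFK.integrableOn_compact hKc)
  set φ : ℕ → ContDiffBump (0 : ℂ) := fun n =>
    ⟨ε / (n + 1) / 2, ε / (n + 1), by positivity, by
      have : 0 < ε / (n + 1) := by positivity
      linarith⟩ with hφ
  have hφr : ∀ n, (φ n).rOut = ε / (n + 1) := fun n => rfl
  have hφle : ∀ n, (φ n).rOut ≤ ε := fun n => by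
    rw [hφr]; exact div_le_self hε0.le (by linarith [n.cast_nonneg (α := ℝ)])
  set ρ : ℕ → ℂ → ℝ := fun n => (φ n).normed volume with hρ
  have hρs : ∀ n, ContDiff ℝ 1 (ρ n) := fun n => (φ n).contDiff_normed
  have hρc : ∀ n, HasCompactSupport (ρ n) := fun n => (φ n).hasCompactSupport_normed
  set G : ℕ → ℂ → ℂ := fun n => ρ n ⋆[ContinuousLinearMap.lsmul ℝ ℝ, volume] g with hG
  have hGd : ∀ n z, HasFDerivAt (G n) ((g ⋆[(ContinuousLinearMap.lsmul ℝ ℝ).flip.precompR ℂ,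
      volume] fderiv ℝ (ρ n)) z) z := by
    intro n z
    have := (hρc n).hasFDerivAt_convolution_right (ContinuousLinearMap.lsmul ℝ ℝ).flip
      hgi.locallyIntegrable (hρs n) z
    rwa [convolution_flip] at this
  have hGa : ∀ n z v, fderiv ℝ (G n) z v = ∫ t, (fderiv ℝ (ρ n) (z - t) v : ℝ) • g t := by
    intro n z v
    rw [(hGd n z).fderiv, convolution_precompR_apply _ hgi.locallyIntegrable ((hρc n).fderiv ℝ)
      ((hρs n).continuous_fderiv one_ne_zero), convolution_def]
    rfl
  have hgK : ∀ z ∈ K, g z = F z := fun z hz => indicator_of_mem hz F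
  have hGh : ∀ n, ∀ z ∈ Metric.ball x ε, DifferentiableAt ℂ (G n) z := by
    intro n z hz
    rw [differentiableAt_complex_iff_differentiableAt_real]
    refine ⟨(hGd n z).differentiableAt, ?_⟩
    -- The reflected mollifier centred at `z` is itself a test function, and `∂̄(ρ ⋆ g)(z)` is minus
    -- the pairing of `F` with its `∂̄`, which vanishes by hypothesis.
    set ψ : ℂ → ℂ := fun w => (ρ n (z - w) : ℂ) with hψ
    have hψs : ContDiff ℝ 1 ψ := Complex.ofRealCLM.contDiff.comp
      ((hρs n).comp (contDiff_const.sub contDiff_id))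
    have hψ0 : ∀ w, w ∉ Metric.closedBall z ε → ψ w = 0 := by
      intro w hw
      have : z - w ∉ Function.support (ρ n) := by
        rw [hρ, (φ n).support_normed_eq, Metric.mem_ball, dist_zero_right, not_lt]
        rw [Metric.mem_closedBall, not_le, dist_comm, dist_eq_norm] at hw
        exact (hφle n).trans hw.le
      rw [hψ]; simpa using this
    have hψt : tsupport ψ ⊆ Metric.closedBall z ε :=
      closure_minimal (fun w hw => by by_contra h; exact hw (hψ0 w h)) Metric.isClosed_closedBall
    have hzK : Metric.closedBall z ε ⊆ K := Metric.closedBall_subset_closedBall' (by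
      rw [Metric.mem_ball] at hz; linarith)
    have hψc : HasCompactSupport ψ := HasCompactSupport.intro (isCompact_closedBall z ε) hψ0
    have hz0 := h ψ hψs hψc ((hψt.trans hzK).trans hKW)
    have hdψ : ∀ w v, fderiv ℝ ψ w v = -(fderiv ℝ (ρ n) (z - w) v : ℝ) := by
      intro w v
      have h1 : HasFDerivAt (ρ n) (fderiv ℝ (ρ n) (z - w)) (z - w) :=
        ((hρs n).differentiable one_ne_zero _).hasFDerivAt
      have h2 := h1.comp w ((hasFDerivAt_id w).const_sub z)
      have h3 := Complex.ofRealCLM.hasFDerivAt.comp w h2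
      have h4 : fderiv ℝ ψ w = _ := HasFDerivAt.fderiv h3
      rw [h4]
      simp
    have hi : ∀ v, Integrable (fun t => (fderiv ℝ (ρ n) (z - t) v : ℝ) • g t) := by
      intro v
      have hc : Continuous (fun t => fderiv ℝ (ρ n) (z - t) v) :=
        ((((hρs n).continuous_fderiv one_ne_zero).comp (continuous_const.sub continuous_id))).clm_apply
          continuous_const
      obtain ⟨M, hM⟩ := ((hρs n).continuous_fderiv one_ne_zero).bounded_above_of_compact_support
        ((hρc n).fderiv ℝ)
      exact hgi.bdd_smul (M * ‖v‖) hc.aestronglyMeasurable (ae_of_all _ fun t =>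
        (ContinuousLinearMap.le_opNorm _ _).trans (by gcongr; exact hM _))
    have key : fderiv ℝ (G n) z 1 + Complex.I * fderiv ℝ (G n) z Complex.I = 0 := by
      rw [hGa, hGa, ← integral_const_mul, ← integral_add (hi 1) ((hi _).const_mul _)]
      have h5 : ∀ t, (fderiv ℝ (ρ n) (z - t) 1 : ℝ) • g t +
          Complex.I * ((fderiv ℝ (ρ n) (z - t) Complex.I : ℝ) • g t) =
          -2 * (F t * dbar ψ t) := by
        intro t
        rw [dbar, hdψ, hdψ]
        by_cases ht : t ∈ K
        · rw [hgK t ht, Complex.real_smul, Complex.real_smul]; ring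
        · have : t ∉ tsupport ψ := fun h' => ht (hzK (hψt h'))
          have h6 : ∀ v, fderiv ℝ (ρ n) (z - t) v = 0 := by
            intro v
            have := hdψ t v
            rw [fderiv_of_notMem_tsupport ℝ ‹t ∉ tsupport ψ›] at this
            simpa using this.symm
          simp [h6]
      simp_rw [h5]
      rw [integral_const_mul, hz0, mul_zero]
    rw [smul_eq_mul]
    linear_combination (-Complex.I) * key + fderiv ℝ (G n) z Complex.I * Complex.I_sq
  have hlim : TendstoUniformlyOn G F atTop (Metric.ball x ε) := by
    rw [Metric.tendstoUniformlyOn_iff]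
    intro δ hδ
    have huc := hKc.uniformContinuousOn_of_continuous hFK
    rw [Metric.uniformContinuousOn_iff] at huc
    obtain ⟨η, hη, hu⟩ := huc (δ / 2) (by positivity)
    have ht : Tendsto (fun n : ℕ => ε / (n + 1 : ℝ)) atTop (𝓝 0) := by
      have := (tendsto_one_div_add_atTop_nhds_zero_nat (𝕜 := ℝ)).const_mul ε
      simpa [div_eq_mul_inv] using this
    filter_upwards [ht.eventually (gt_mem_nhds hη)] with n hn z hz
    have hzK : z ∈ K := (Metric.ball_subset_closedBall.trans
      (Metric.closedBall_subset_closedBall (by linarith))) hz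
    have := (φ n).dist_normed_convolution_le (μ := volume) (x₀ := z) (g := g) (ε := δ / 2)
      hgi.aestronglyMeasurable (by
        intro w hw
        have hwK : w ∈ K := by
          rw [Metric.mem_ball] at hw hz
          rw [hK, Metric.mem_closedBall]
          linarith [dist_triangle w z x, hφle n]
        rw [hgK w hwK, hgK z hzK]
        exact (hu w hwK z hzK (by rw [Metric.mem_ball] at hw; exact hw.trans hn)).le)
    rw [hgK z hzK, dist_comm] at this
    exact this.trans_lt (by linarith)
  exact hlim.tendstoLocallyUniformlyOn.differentiableOn
    (Eventually.of_forall fun n z hz => (hGh n z hz).differentiableWithinAt) Metric.isOpen_ball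

namespace ContourSystem
variable {ι : Type*} {C : ContourSystem ι} [Fintype ι] {f : ℂ → ℂ}

lemma tendsto_domain_of_sides {j : ι} {t : ℝ} (ht : t ∈ Ioo (0 : ℝ) 1)
    (hn : C.path j t ∉ C.nodes) {l : ℂ}
    (hl : Tendsto (fun p => f (collar (C.path j) p)) (𝓝 t ×ˢ 𝓝[>] 0) (𝓝 l))
    (hr : Tendsto (fun p => f (collar (C.path j) p)) (𝓝 t ×ˢ 𝓝[<] 0) (𝓝 l)) :
    Tendsto f (𝓝[C.domain] (C.path j t)) (𝓝 l) := by
  intro V hV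
  have h1 := eventually_prod_nhdsWithin.1 (hl hV)
  have h2 := eventually_prod_nhdsWithin.1 (hr hV)
  rw [mem_map, mem_nhdsWithin_iff_eventually]
  filter_upwards [exists_collar_nhds (C.contDiffAt_path j ht) (C.regular j t ht)
      (h1.and (h2.and (C.eventually_collar_nhds ht hn)))] with z ⟨p, hp, e⟩ hz
  rw [← e] at hz ⊢
  rcases (hp.2.2.2 hz).lt_or_gt with h0 | h0
  · exact hp.2.1 h0
  · exact hp.1 h0

/-- A function without jump on the contours and with mild singularities at the nodes extends to
an entire function. -/
lemma exists_entire (hf : DifferentiableOn ℂ f C.domain)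
    (hj : ∀ j, ∀ t ∈ Ioo (0 : ℝ) 1, C.path j t ∉ C.nodes → ∃ l,
      Tendsto (fun p => f (collar (C.path j) p)) (𝓝 t ×ˢ 𝓝[>] 0) (𝓝 l) ∧
      Tendsto (fun p => f (collar (C.path j) p)) (𝓝 t ×ˢ 𝓝[<] 0) (𝓝 l))
    (hnode : ∀ a ∈ C.nodes, f =o[𝓝[C.domain] a] fun z => (z - a)⁻¹) :
    ∃ E : ℂ → ℂ, Differentiable ℂ E ∧ ∀ z ∈ C.domain, E z = f z := by
  choose! l hl hr using hj
  have hS : C.Sides f l l := ⟨hf, hl, hr⟩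
  set E := extendFrom C.domain f with hE
  have hEf : ∀ z ∈ C.domain, E z = f z := extendFrom_extends hf.continuousOn
  have hlim : ∀ x ∈ ((C.nodes : Set ℂ)ᶜ), ∃ y, Tendsto f (𝓝[C.domain] x) (𝓝 y) := by
    intro x hx
    by_cases hd : x ∈ C.domain
    · exact ⟨f x, hf.continuousOn x hd⟩
    · rw [domain, mem_compl_iff, not_not] at hd
      obtain ⟨j, t, ht, rfl⟩ := mem_iUnion.1 (hd.resolve_right hx)
      exact ⟨_, tendsto_domain_of_sides ht hx (hl j t ht hx) (hr j t ht hx)⟩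
  have hc : ContinuousOn E ((C.nodes : Set ℂ)ᶜ) :=
    continuousOn_extendFrom (fun x _ => C.dense_domain x) hlim
  -- Equal boundary values make the right side of the jump formula zero, so the continuous extension
  -- `E` is holomorphic off the nodes by Weyl's lemma.
  have hd : DifferentiableOn ℂ E ((C.nodes : Set ℂ)ᶜ) := by
    refine differentiableOn_of_integral_dbar_eq_zero C.isOpen_compl_nodes hc ?_
    intro ψ h1 h2 h3
    have e1 : ∫ z, E z * dbar ψ z = ∫ z, f z * dbar ψ z := by
      refine integral_congr_ae ?_
      filter_upwards [Sides.ae_mem_domain C] with z hz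
      rw [hEf z hz]
    rw [e1, hS.jump_formula (by simp) h1 h2 fun a ha ha' => h3 ha' ha]
    simp
  have hpun : ∀ a ∈ C.nodes, ∀ᶠ z in 𝓝[≠] a, z ∉ C.nodes := by
    intro a ha
    have : IsClosed ((C.nodes : Set ℂ) \ {a}) := (C.nodes.finite_toSet.sdiff).isClosed
    have h1 : ∀ᶠ z in 𝓝 a, z ∉ (C.nodes : Set ℂ) \ {a} := this.isOpen_compl.mem_nhds (by simp)
    filter_upwards [nhdsWithin_le_nhds h1, self_mem_nhdsWithin] with z hz hne hz'
    exact hz ⟨hz', hne⟩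
  have hlim' : ∀ x, ∃ y, Tendsto f (𝓝[C.domain] x) (𝓝 y) := by
    intro a
    by_cases ha : a ∈ C.nodes
    swap
    · exact hlim a ha
    have hdif : ∀ᶠ z in 𝓝[≠] a, DifferentiableAt ℂ E z := by
      filter_upwards [hpun a ha] with z hz
      exact hd.differentiableAt (C.isOpen_compl_nodes.mem_nhds hz)
    -- The growth bound is known only off the contours; density and continuity of `E` carry it over
    -- to all points near the node.
    have ho : E =o[𝓝[≠] a] fun z => (z - a)⁻¹ := by
      rw [isLittleO_iff]
      intro ε hε
      have h1 := (hnode a ha).def hε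
      rw [eventually_nhdsWithin_iff] at h1
      obtain ⟨δ, hδ, h2⟩ := Metric.eventually_nhds_iff_ball.1 h1
      filter_upwards [hpun a ha, self_mem_nhdsWithin,
        mem_nhdsWithin_of_mem_nhds (Metric.ball_mem_nhds a hδ)] with z hz hza hzb
      have hcz : ContinuousAt (fun y => ‖E y‖ - ε * ‖(y - a)⁻¹‖) z := by
        refine ContinuousAt.sub (hc.continuousAt (C.isOpen_compl_nodes.mem_nhds hz)).norm ?_
        refine continuousAt_const.mul (ContinuousAt.norm ?_)
        exact (continuousAt_id.sub continuousAt_const).inv₀ (sub_ne_zero.2 hza)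
      have : ‖E z‖ - ε * ‖(z - a)⁻¹‖ ≤ 0 := by
        have hne : (𝓝[C.domain] z).NeBot := mem_closure_iff_nhdsWithin_neBot.1 (C.dense_domain z)
        have hcz' : Tendsto _ (𝓝[C.domain] z) _ := hcz.mono_left nhdsWithin_le_nhds
        refine le_of_tendsto hcz' ?_
        filter_upwards [self_mem_nhdsWithin,
          mem_nhdsWithin_of_mem_nhds (Metric.isOpen_ball.mem_nhds hzb)] with y hy hyb
        rw [hEf y hy]
        linarith [h2 y hyb hy]
      linarith
    -- The removable singularity theorem is applied in a form that subtracts the value at `a`; a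
    -- constant is `o(1/(z - a))`.
    have ho' : (fun z => E z - E a) =o[𝓝[≠] a] fun z => (z - a)⁻¹ := by
      refine ho.sub ?_
      rw [isLittleO_const_left]
      right
      have h1 : Tendsto (fun z => z - a) (𝓝[≠] a) (𝓝[≠] 0) := by
        refine tendsto_nhdsWithin_iff.2 ⟨?_, ?_⟩
        · have : Tendsto (fun z => z - a) (𝓝 a) (𝓝 (a - a)) :=
            tendsto_id.sub tendsto_const_nhds
          rw [sub_self] at this
          exact this.mono_left nhdsWithin_le_nhds
        · filter_upwards [self_mem_nhdsWithin] with z hz using sub_ne_zero.2 hz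
      exact (tendsto_norm_cobounded_atTop.comp (tendsto_inv₀_nhdsNE_zero.comp h1))
    have := Complex.tendsto_limUnder_of_differentiable_on_punctured_nhds_of_isLittleO hdif ho'
    refine ⟨_, (this.mono_left (nhdsWithin_mono a ?_)).congr' ?_⟩
    · intro z hz h
      exact C.not_node_of_mem hz (h ▸ ha)
    · filter_upwards [self_mem_nhdsWithin] with z hz using hEf z hz
  have hcont : Continuous E := continuous_extendFrom C.dense_domain hlim'
  refine ⟨E, fun a => ?_, hEf⟩
  by_cases ha : a ∈ C.nodes
  · refine (Complex.analyticAt_of_differentiable_on_punctured_nhds_of_continuousAt ?_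
      hcont.continuousAt).differentiableAt
    filter_upwards [hpun a ha] with z hz
    exact hd.differentiableAt (C.isOpen_compl_nodes.mem_nhds hz)
  · exact hd.differentiableAt (C.isOpen_compl_nodes.mem_nhds ha)

end ContourSystem

/-! ### Growth at infinity and Liouville's theorem. -/

lemma zpow_isBigO_zpow {l : Filter ℂ} (hl : l ≤ cobounded ℂ) {p q : ℤ} (h : p ≤ q) :
    (fun z : ℂ => z ^ p) =O[l] fun z => z ^ q := by
  refine IsBigO.of_bound 1 ?_
  have : ∀ᶠ z : ℂ in cobounded ℂ, 1 ≤ ‖z‖ :=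
    tendsto_norm_cobounded_atTop.eventually_ge_atTop 1
  filter_upwards [hl this] with z hz
  rw [norm_zpow, norm_zpow, one_mul]
  exact zpow_le_zpow_right₀ hz h

lemma eventually_ne_zero_cobounded : ∀ᶠ z : ℂ in cobounded ℂ, z ≠ 0 :=
  eventually_ne_cobounded 0

/-- An entire function which is `O(z^(n-1))` at infinity is a polynomial of degree `< n`. -/
lemma exists_polynomial_of_isBigO (n : ℕ) : ∀ {E : ℂ → ℂ}, Differentiable ℂ E →
    (E =O[cobounded ℂ] fun z => z ^ ((n : ℤ) - 1)) →
    ∃ p : Polynomial ℂ, p.degree < n ∧ ∀ z, E z = p.eval z := by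
  induction n with
  | zero =>
    intro E hE h
    have h0 : Tendsto E (cobounded ℂ) (𝓝 0) := by
      refine h.trans_tendsto ?_
      simpa using tendsto_inv₀_cobounded (α := ℂ)
    refine ⟨0, by simp, fun z => ?_⟩
    simp only [Polynomial.eval_zero]
    exact hE.apply_eq_of_tendsto_cocompact z (by rwa [← Metric.cobounded_eq_cocompact])
  | succ n ih =>
    intro E hE h
    -- Induction on the growth: `(E(z) - E(0))/z`, extended to the origin, is entire and grows by
    -- one power less.
    have hd : Differentiable ℂ (dslope E 0) := by
      rw [← differentiableOn_univ, Complex.differentiableOn_dslope univ_mem]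
      exact hE.differentiableOn
    have hO : dslope E 0 =O[cobounded ℂ] fun z => z ^ ((n : ℤ) - 1) := by
      have h1 : (fun z => E z - E 0) =O[cobounded ℂ] fun z => z ^ (n : ℤ) := by
        refine IsBigO.sub (by simpa using h) ?_
        have := zpow_isBigO_zpow (le_refl (cobounded ℂ)) (p := 0) (q := n) (by positivity)
        simp only [zpow_zero] at this
        exact (isBigO_const_const (E 0) one_ne_zero _).trans this
      have h2 := (isBigO_refl (fun z : ℂ => z⁻¹) (cobounded ℂ)).mul h1
      refine h2.congr' ?_ ?_
      · filter_upwards [eventually_ne_zero_cobounded] with z hz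
        rw [dslope_of_ne _ hz, slope_def_field, sub_zero]; ring
      · filter_upwards [eventually_ne_zero_cobounded] with z hz
        rw [zpow_sub_one₀ hz]; ring
    obtain ⟨p, hp, hpE⟩ := ih hd hO
    refine ⟨Polynomial.C (E 0) + Polynomial.X * p, ?_, fun z => ?_⟩
    · refine (Polynomial.degree_add_le _ _).trans_lt (max_lt ?_ ?_)
      · exact Polynomial.degree_C_le.trans_lt (by exact_mod_cast n.succ_pos)
      · by_cases h0 : p = 0
        · simp only [h0, mul_zero, Polynomial.degree_zero]; exact WithBot.bot_lt_coe _
        · have := (Polynomial.natDegree_lt_iff_degree_lt h0).2 hp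
          rw [← Polynomial.natDegree_lt_iff_degree_lt (by simpa using h0),
            Polynomial.natDegree_X_mul h0]
          omega
    · simp only [Polynomial.eval_add, Polynomial.eval_C, Polynomial.eval_mul, Polynomial.eval_X]
      rw [← hpE]
      have := sub_smul_dslope E 0 z
      simp only [sub_zero, smul_eq_mul] at this
      rw [this]; ring

/-- The Riemann-Hilbert asymptotics hold off the contours only, whereas Liouville's theorem needs
them in all directions; since arcs may be unbounded, the bound is extended by continuity. -/
lemma isBigO_cobounded_of_dense {Ω : Set ℂ} (hΩ : Dense Ω) {E g : ℂ → ℂ} (hE : Continuous E)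
    (hg : ∀ z ≠ 0, ContinuousAt g z) (h : E =O[cobounded ℂ ⊓ 𝓟 Ω] g) : E =O[cobounded ℂ] g := by
  obtain ⟨c, hc⟩ := h.bound
  rw [eventually_inf_principal, ← comap_norm_atTop, eventually_comap] at hc
  obtain ⟨r, hr⟩ := eventually_atTop.1 hc
  refine IsBigO.of_bound c ?_
  filter_upwards [tendsto_norm_cobounded_atTop.eventually_gt_atTop r,
    eventually_ne_zero_cobounded] with z hz hz0
  have hct : Tendsto (fun y => ‖E y‖ - c * ‖g y‖) (𝓝[Ω] z) (𝓝 (‖E z‖ - c * ‖g z‖)) :=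
    (hE.continuousAt.norm.sub (continuousAt_const.mul (hg z hz0).norm)).mono_left
      nhdsWithin_le_nhds
  have hne : (𝓝[Ω] z).NeBot := mem_closure_iff_nhdsWithin_neBot.1 (hΩ z)
  have : ‖E z‖ - c * ‖g z‖ ≤ 0 := by
    refine le_of_tendsto hct ?_
    filter_upwards [self_mem_nhdsWithin, mem_nhdsWithin_of_mem_nhds
      (continuous_norm.continuousAt.eventually (lt_mem_nhds hz))] with y hy hyr
    linarith [hr ‖y‖ hyr.le y rfl hy]
  linarith

/-! ### First column and determinant of a solution. -/

lemma tendsto_collar {γ : ℝ → ℂ} {t : ℝ} (h : ContDiffAt ℝ 2 γ t) (h0 : deriv γ t ≠ 0)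
    (s : Set ℝ) : Tendsto (collar γ) (𝓝 t ×ˢ 𝓝[s] 0) (𝓝 (γ t)) := by
  rw [← map_collar_nhds h h0, nhds_prod_eq]
  exact tendsto_map.mono_left (prod_mono le_rfl nhdsWithin_le_nhds)

lemma PlusSide.exists_filters (σ : PlusSide) {Y : Type*} [TopologicalSpace Y] {t : ℝ} {p m : Y}
    {g : ℝ × ℝ → Y}
    (hp : Tendsto g (𝓝 t ×ˢ σ.plusFilter) (𝓝 p)) (hm : Tendsto g (𝓝 t ×ˢ σ.minusFilter) (𝓝 m)) :
    (σ = .left ∧ Tendsto g (𝓝 t ×ˢ 𝓝[>] 0) (𝓝 p) ∧ Tendsto g (𝓝 t ×ˢ 𝓝[<] 0) (𝓝 m)) ∨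
    (σ = .right ∧ Tendsto g (𝓝 t ×ˢ 𝓝[>] 0) (𝓝 m) ∧ Tendsto g (𝓝 t ×ˢ 𝓝[<] 0) (𝓝 p)) := by
  cases σ
  · exact Or.inl ⟨rfl, hp, hm⟩
  · exact Or.inr ⟨rfl, hm, hp⟩

namespace IsSolution
variable {ι : Type*} {σ : PlusSide} {C : ContourSystem ι} {n : ℕ} {ℓ : ℤ}
  {w : ι → ℂ → ℂ} {Γ : ℂ → Matrix (Fin 2) (Fin 2) ℂ}

lemma tendsto_entry {l : Filter (ℝ × ℝ)} {γ : ℝ → ℂ} {A : Matrix (Fin 2) (Fin 2) ℂ}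
    (h : Tendsto (fun p => Γ (collar γ p)) l (𝓝 A)) (i k : Fin 2) :
    Tendsto (fun p => Γ (collar γ p) i k) l (𝓝 (A i k)) :=
  ((continuous_id.matrix_elem i k).tendsto A).comp h

lemma node_fst (h : IsSolution σ C n ℓ w Γ) {a : ℂ} (ha : a ∈ C.nodes) (i : Fin 2) :
    (fun z => Γ z i 0) =o[𝓝[C.domain] a] fun z => (z - a)⁻¹ := by
  simpa [Matrix.mul_apply, Fin.sum_univ_two, Matrix.diagonal] using h.node a ha i 0

lemma node_snd (h : IsSolution σ C n ℓ w Γ) {a : ℂ} (ha : a ∈ C.nodes) (i : Fin 2) :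
    (fun z => z ^ (ℓ + 1 - n) * Γ z i 1) =o[𝓝[C.domain] a] fun z => (z - a)⁻¹ := by
  have := h.node a ha i 1
  rw [show -((n : ℤ) - ℓ - 1) = ℓ + 1 - n by ring] at this
  simpa [Matrix.mul_apply, Fin.sum_univ_two, Matrix.diagonal, mul_comm] using this

lemma infinity_fst (h : IsSolution σ C n ℓ w Γ) (i : Fin 2) :
    (fun z => z ^ (-(n : ℤ)) * Γ z i 0 - if i = 0 then 1 else 0)
      =O[cobounded ℂ ⊓ 𝓟 C.domain] fun z => z⁻¹ := by
  have := h.infinity i 0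
  fin_cases i <;>
  simpa [Matrix.mul_apply, Fin.sum_univ_two, Matrix.diagonal, mul_comm] using this

lemma infinity_snd (h : IsSolution σ C n ℓ w Γ) (i : Fin 2) :
    (fun z => z ^ (ℓ + 1) * Γ z i 1 - if i = 1 then 1 else 0)
      =O[cobounded ℂ ⊓ 𝓟 C.domain] fun z => z⁻¹ := by
  have := h.infinity i 1
  fin_cases i <;>
  simpa [Matrix.mul_apply, Fin.sum_univ_two, Matrix.diagonal, mul_comm] using this

lemma eventually_ne_zero : ∀ᶠ z : ℂ in cobounded ℂ ⊓ 𝓟 C.domain, z ≠ 0 :=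
  eventually_ne_zero_cobounded.filter_mono inf_le_left

lemma fst_isBigO (h : IsSolution σ C n ℓ w Γ) (i : Fin 2) :
    (fun z => Γ z i 0 - if i = 0 then z ^ n else 0)
      =O[cobounded ℂ ⊓ 𝓟 C.domain] fun z => z ^ ((n : ℤ) - 1) := by
  have := (isBigO_refl (fun z : ℂ => z ^ (n : ℤ)) _).mul (h.infinity_fst i)
  refine this.congr' ?_ ?_
  · filter_upwards [eventually_ne_zero] with z hz
    rw [mul_sub, ← mul_assoc, ← zpow_add₀ hz, add_neg_cancel]
    split_ifs <;> simp
  · filter_upwards [eventually_ne_zero] with z hz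
    rw [zpow_sub_one₀ hz]

/-- Right multiplication by an upper unipotent matrix leaves the first column unchanged, so there is
no jump. -/
lemma exists_entire_fst [Fintype ι] (h : IsSolution σ C n ℓ w Γ) (i : Fin 2) :
    ∃ E : ℂ → ℂ, Differentiable ℂ E ∧ ∀ z ∈ C.domain, E z = Γ z i 0 := by
  refine ContourSystem.exists_entire (h.holo i 0) (fun j t ht hn => ?_)
    fun a ha => h.node_fst ha i
  obtain ⟨P, N, hP, hN, e⟩ := h.jump j t ht hn
  have hPN : P i 0 = N i 0 := by rw [e]; simp [Matrix.mul_apply, jumpMatrix]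
  have h1 := tendsto_entry hP i 0
  have h2 := tendsto_entry hN i 0
  rw [hPN] at h1
  rcases σ.exists_filters h1 h2 with h | h <;> exact ⟨_, h.2⟩

lemma exists_polynomial_fst [Fintype ι] (h : IsSolution σ C n ℓ w Γ) :
    ∃ P Q : Polynomial ℂ, P.Monic ∧ P.natDegree = n ∧ Q.degree < n ∧
      ∀ z ∈ C.domain, Γ z 0 0 = P.eval z ∧ Γ z 1 0 = Q.eval z := by
  obtain ⟨E, hE, hEΓ⟩ := h.exists_entire_fst 0
  obtain ⟨F, hF, hFΓ⟩ := h.exists_entire_fst 1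
  have hg : ∀ z : ℂ, z ≠ 0 → ContinuousAt (fun z : ℂ => z ^ ((n : ℤ) - 1)) z :=
    fun z hz => continuousAt_zpow₀ z _ (Or.inl hz)
  have hmem : ∀ᶠ z : ℂ in cobounded ℂ ⊓ 𝓟 C.domain, z ∈ C.domain :=
    mem_inf_of_right (mem_principal_self _)
  have h1 : (fun z => E z - z ^ n) =O[cobounded ℂ] fun z => z ^ ((n : ℤ) - 1) := by
    refine isBigO_cobounded_of_dense C.dense_domain (hE.continuous.sub (continuous_pow n)) hg ?_
    refine (h.fst_isBigO 0).congr' ?_ EventuallyEq.rfl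
    filter_upwards [hmem] with z hz
    simp [hEΓ z hz]
  have h2 : F =O[cobounded ℂ] fun z => z ^ ((n : ℤ) - 1) := by
    refine isBigO_cobounded_of_dense C.dense_domain hF.continuous hg ?_
    refine (h.fst_isBigO 1).congr' ?_ EventuallyEq.rfl
    filter_upwards [hmem] with z hz
    simp [hFΓ z hz]
  obtain ⟨p, hp, hpE⟩ := exists_polynomial_of_isBigO n (hE.sub (differentiable_pow n)) h1
  obtain ⟨Q, hQ, hQF⟩ := exists_polynomial_of_isBigO n hF h2
  refine ⟨Polynomial.X ^ n + p, Q, Polynomial.monic_X_pow_add hp, ?_, hQ, fun z hz => ⟨?_, ?_⟩⟩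
  · refine Polynomial.natDegree_eq_of_degree_eq_some ?_
    rw [Polynomial.degree_add_eq_left_of_degree_lt (by simpa using hp), Polynomial.degree_X_pow]
  · have := hpE z
    simp only [Pi.sub_apply] at this
    rw [← hEΓ z hz, Polynomial.eval_add, Polynomial.eval_pow, Polynomial.eval_X, ← this]; ring
  · rw [← hFΓ z hz, hQF]

lemma path_ne_zero {j : ι} {t : ℝ} (hn : C.path j t ∉ C.nodes) : C.path j t ≠ 0 :=
  fun e => hn (e ▸ C.zero_mem)

lemma tendsto_collar_zpow {j : ι} {t : ℝ} (ht : t ∈ Ioo (0 : ℝ) 1) (hn : C.path j t ∉ C.nodes)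
    (s : Set ℝ) (k : ℤ) : Tendsto (fun p => collar (C.path j) p ^ k) (𝓝 t ×ˢ 𝓝[s] 0)
      (𝓝 (C.path j t ^ k)) :=
  ((continuousAt_zpow₀ _ k (Or.inl (path_ne_zero hn))).tendsto).comp
    (tendsto_collar (C.contDiffAt_path j ht) (C.regular j t ht) s)

/-- The jump matrices have determinant one, so `z^(ℓ+1-n) det Γ` has no jump. Near a node the first
column is polynomial, hence bounded, and the product with the second column remains `o(1/|z - a|)`.
The resulting entire function tends to `1` at infinity. -/
lemma det_eq [Fintype ι] (h : IsSolution σ C n ℓ w Γ) {z : ℂ} (hz : z ∈ C.domain) :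
    (Γ z).det = z ^ ((n : ℤ) - ℓ - 1) := by
  obtain ⟨P, Q, -, -, -, hPQ⟩ := h.exists_polynomial_fst
  have hmem : ∀ᶠ z : ℂ in cobounded ℂ ⊓ 𝓟 C.domain, z ∈ C.domain :=
    mem_inf_of_right (mem_principal_self _)
  set D : ℂ → ℂ := fun z => z ^ (ℓ + 1 - n) * (Γ z).det with hD
  have hdet : ∀ z, D z = Γ z 0 0 * (z ^ (ℓ + 1 - n) * Γ z 1 1) -
      Γ z 1 0 * (z ^ (ℓ + 1 - n) * Γ z 0 1) := by
    intro z; rw [hD]; simp only [Matrix.det_fin_two]; ring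
  have hpow : DifferentiableOn ℂ (fun z : ℂ => z ^ (ℓ + 1 - n)) C.domain := fun z hz =>
    (differentiableAt_zpow.2 (Or.inl (C.ne_zero_of_mem hz))).differentiableWithinAt
  obtain ⟨E, hE, hED⟩ : ∃ E : ℂ → ℂ, Differentiable ℂ E ∧ ∀ z ∈ C.domain, E z = D z := by
    refine ContourSystem.exists_entire ?_ (fun j t ht hn => ?_) fun a ha => ?_
    · have : D = _ := funext hdet
      rw [this]
      exact ((h.holo 0 0).mul (hpow.mul (h.holo 1 1))).sub
        ((h.holo 1 0).mul (hpow.mul (h.holo 0 1)))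
    · obtain ⟨A, N, hA, hN, e⟩ := h.jump j t ht hn
      have hdA : A.det = N.det := by
        rw [e, Matrix.det_mul]; simp [jumpMatrix, Matrix.det_fin_two]
      have h1 := ((continuous_id.matrix_det).tendsto A).comp hA
      have h2 := ((continuous_id.matrix_det).tendsto N).comp hN
      simp only [id] at h1 h2
      rw [hdA] at h1
      refine ⟨C.path j t ^ (ℓ + 1 - n) * N.det, ?_⟩
      rcases σ.exists_filters h1 h2 with h | h <;>
      exact ⟨(tendsto_collar_zpow ht hn _ _).mul h.2.1, (tendsto_collar_zpow ht hn _ _).mul h.2.2⟩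
    · have hb : ∀ p : Polynomial ℂ, (fun z => p.eval z) =O[𝓝[C.domain] a] fun _ => (1 : ℂ) :=
        fun p => (p.continuous.continuousAt.norm.isBoundedUnder_le.isBigO_one ℂ).mono
          nhdsWithin_le_nhds
      have := ((hb P).mul_isLittleO (h.node_snd ha 1)).sub ((hb Q).mul_isLittleO (h.node_snd ha 0))
      simp only [one_mul] at this
      refine this.congr' ?_ EventuallyEq.rfl
      filter_upwards [self_mem_nhdsWithin] with z hz
      rw [hdet, (hPQ z hz).1, (hPQ z hz).2]
  -- The bound `O(z⁻¹)` is the case of degree below `0`: the polynomial that represents `E - 1` is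
  -- zero.
  have hO : (fun z => E z - 1) =O[cobounded ℂ] fun z => z ^ (((0 : ℕ) : ℤ) - 1) := by
    refine isBigO_cobounded_of_dense C.dense_domain (hE.continuous.sub continuous_const)
      (fun z hz => continuousAt_zpow₀ z _ (Or.inl hz)) ?_
    simp only [Nat.cast_zero, zero_sub, zpow_neg_one]
    have a0 := h.infinity_fst 0
    have a1 := h.infinity_fst 1
    have b0 := h.infinity_snd 0
    have b1 := h.infinity_snd 1
    simp only [if_true, one_ne_zero, zero_ne_one, if_false, sub_zero] at a0 a1 b0 b1
    have hbd : (fun z : ℂ => z⁻¹) =O[cobounded ℂ ⊓ 𝓟 C.domain] fun _ => (1 : ℂ) :=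
      ((tendsto_inv₀_cobounded (α := ℂ)).mono_left inf_le_left).isBigO_one ℂ
    have c1 := (a0.mul (b1.trans hbd))
    have c2 := (a1.mul (b0.trans hbd))
    simp only [mul_one] at c1 c2
    refine ((c1.add (a0.add b1)).sub c2).congr' ?_ EventuallyEq.rfl
    filter_upwards [hmem] with z hz
    have hz0 := C.ne_zero_of_mem hz
    have hpw : z ^ (ℓ + 1 - (n : ℤ)) = z ^ (-(n : ℤ)) * z ^ (ℓ + 1) := by
      rw [← zpow_add₀ hz0]; congr 1; ring
    rw [hED z hz, hdet, hpw]
    ring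
  obtain ⟨p, hp, hpE⟩ := exists_polynomial_of_isBigO 0 (hE.sub (differentiable_const 1)) hO
  have hp0 : p = 0 := Polynomial.degree_eq_bot.1 (by
    have h1 : p.degree < 0 := hp
    exact Nat.WithBot.lt_zero_iff.1 h1)
  have h1 := hpE z
  simp only [Pi.sub_apply, hp0, Polynomial.eval_zero] at h1
  have h2 : D z = 1 := by rw [← hED z hz]; linear_combination h1
  have hz0 := C.ne_zero_of_mem hz
  rw [hD] at h2
  simp only at h2
  rw [show (n : ℤ) - ℓ - 1 = -(ℓ + 1 - n) by ring, zpow_neg]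
  exact eq_inv_of_mul_eq_one_right h2

end IsSolution

/-! ### Cutoffs and the total jump over the contours. -/

lemma dbar_radial {g : ℝ → ℝ} (hg : Differentiable ℝ g) (a z : ℂ) :
    dbar (fun z => (g (Complex.normSq (z - a)) : ℂ)) z =
      ((deriv g (Complex.normSq (z - a)) : ℝ) : ℂ) * (z - a) := by
  have h1 : HasFDerivAt (fun z : ℂ => (z - a).re) Complex.reCLM z :=
    Complex.reCLM.hasFDerivAt.comp z ((hasFDerivAt_id z).sub_const a)
  have h2 : HasFDerivAt (fun z : ℂ => (z - a).im) Complex.imCLM z :=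
    Complex.imCLM.hasFDerivAt.comp z ((hasFDerivAt_id z).sub_const a)
  have h3 : HasFDerivAt (fun z : ℂ => Complex.normSq (z - a)) _ z := (h1.mul h1).add (h2.mul h2)
  have h4 := (hg (Complex.normSq (z - a))).hasDerivAt.comp_hasFDerivAt z h3
  have h5 := Complex.ofRealCLM.hasFDerivAt.comp z h4
  have h6 : fderiv ℝ (fun z => (g (Complex.normSq (z - a)) : ℂ)) z = _ := HasFDerivAt.fderiv h5
  rw [dbar, h6]
  simp [-Complex.sub_re, -Complex.sub_im]
  linear_combination ((deriv g (Complex.normSq (z - a)) : ℝ) : ℂ) * Complex.re_add_im (z - a)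

lemma contDiff_radial {g : ℝ → ℝ} (hg : ContDiff ℝ 1 g) (a : ℂ) :
    ContDiff ℝ 1 (fun z => (g (Complex.normSq (z - a)) : ℂ)) := by
  have h1 : ContDiff ℝ 1 (fun z : ℂ => (z - a).re) :=
    Complex.reCLM.contDiff.comp (contDiff_id.sub contDiff_const)
  have h2 : ContDiff ℝ 1 (fun z : ℂ => (z - a).im) :=
    Complex.imCLM.contDiff.comp (contDiff_id.sub contDiff_const)
  exact Complex.ofRealCLM.contDiff.comp (hg.comp ((h1.mul h1).add (h2.mul h2)))

lemma norm_dbar_prod_le {κ : Type*} [DecidableEq κ] (s : Finset κ) (θ : κ → ℂ → ℂ) (z : ℂ)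
    (hd : ∀ i, ContDiff ℝ 1 (θ i)) (h1 : ∀ i, ‖θ i z‖ ≤ 1) :
    ‖dbar (fun z => ∏ i ∈ s, θ i z) z‖ ≤ ∑ i ∈ s, ‖dbar (θ i) z‖ := by
  induction s using Finset.induction_on with
  | empty => simp [dbar]
  | insert a s ha ih =>
    simp only [Finset.prod_insert ha, Finset.sum_insert ha]
    rw [dbar_mul ((hd a).differentiable one_ne_zero z)
      ((contDiff_prod fun i _ => hd i).differentiable one_ne_zero z)]
    refine (norm_add_le _ _).trans ?_
    rw [norm_mul, norm_mul, add_comm]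
    refine add_le_add ?_ ?_
    · refine mul_le_of_le_one_right (norm_nonneg _) ?_
      rw [norm_prod]
      exact Finset.prod_le_one (fun _ _ => norm_nonneg _) fun i _ => h1 i
    · exact (mul_le_of_le_one_left (norm_nonneg _) (h1 a)).trans ih

section cutoff

open Real (smoothTransition)

lemma differentiable_smoothTransition : Differentiable ℝ smoothTransition :=
  (Real.smoothTransition.contDiff (n := 1)).differentiable one_ne_zero

lemma deriv_smoothTransition_ne_zero {x : ℝ} (h : deriv smoothTransition x ≠ 0) :
    0 ≤ x ∧ x ≤ 1 := by
  constructor <;> by_contra! hx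
  · refine h ?_
    have : smoothTransition =ᶠ[𝓝 x] fun _ => 0 := by
      filter_upwards [gt_mem_nhds hx] with y hy
      exact Real.smoothTransition.zero_of_nonpos (le_of_lt hy)
    rw [this.deriv_eq]; simp
  · refine h ?_
    have : smoothTransition =ᶠ[𝓝 x] fun _ => 1 := by
      filter_upwards [lt_mem_nhds hx] with y hy
      exact Real.smoothTransition.one_of_one_le (le_of_lt hy)
    rw [this.deriv_eq]; simp

lemma continuous_deriv_smoothTransition : Continuous (deriv smoothTransition) :=
  (Real.smoothTransition.contDiff (n := 1)).continuous_deriv le_rfl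

lemma exists_bound_deriv_smoothTransition : ∃ c : ℝ, 0 < c ∧ ∀ x, |deriv smoothTransition x| ≤ c := by
  obtain ⟨c, hc⟩ := continuous_deriv_smoothTransition.bounded_above_of_compact_support
    (HasCompactSupport.intro (isCompact_Icc (a := (0 : ℝ)) (b := 1)) fun x hx => by
      by_contra h; exact hx (deriv_smoothTransition_ne_zero h))
  exact ⟨|c| + 1, by positivity, fun x => (hc x).trans (by linarith [le_abs_self c])⟩

/-- In polar coordinates the integrand is the derivative of `-(k²/2) smoothTransition(2 - r²/k²)`,
which rises by `k²/2` in total. This normalisation of the outer cutoff produces the factor of `d` in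
the total jump. -/
lemma integral_deriv_smoothTransition_normSq {k : ℝ} (hk : 0 < k) :
    ∫ z : ℂ, ((deriv smoothTransition (2 - Complex.normSq z / k ^ 2) : ℝ) : ℂ) =
      Real.pi * k ^ 2 := by
  rw [← Complex.integral_comp_polarCoord_symm]
  have e1 : ∀ p ∈ polarCoord.target, p.1 • ((deriv smoothTransition
      (2 - Complex.normSq (Complex.polarCoord.symm p) / k ^ 2) : ℝ) : ℂ) =
      ((p.1 * deriv smoothTransition (2 - p.1 ^ 2 / k ^ 2) : ℝ) : ℂ) * (1 : ℂ) := by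
    intro p hp
    rw [Complex.normSq_eq_norm_sq, Complex.norm_polarCoord_symm, sq_abs]
    simp
  rw [setIntegral_congr_fun polarCoord.open_target.measurableSet e1, polarCoord_target,
    Measure.volume_eq_prod, setIntegral_prod_mul (μ := volume) (ν := volume)
      (fun r : ℝ => ((r * deriv smoothTransition (2 - r ^ 2 / k ^ 2) : ℝ) : ℂ))
      (fun _ : ℝ => (1 : ℂ))]
  have e2 : ∫ r in Ioi (0 : ℝ), ((r * deriv smoothTransition (2 - r ^ 2 / k ^ 2) : ℝ) : ℂ) =
      ((k ^ 2 / 2 : ℝ) : ℂ) := by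
    rw [integral_complex_ofReal]
    congr 1
    set h : ℝ → ℝ := fun r => -(k ^ 2 / 2) * smoothTransition (2 - r ^ 2 / k ^ 2) with hh
    have hd : ∀ r, HasDerivAt h (r * deriv smoothTransition (2 - r ^ 2 / k ^ 2)) r := by
      intro r
      have h1 : HasDerivAt (fun r : ℝ => 2 - r ^ 2 / k ^ 2) (-(2 * r / k ^ 2)) r := by
        have := (((hasDerivAt_pow 2 r).div_const (k ^ 2)).const_sub 2)
        simpa using this
      have h2 := ((differentiable_smoothTransition (2 - r ^ 2 / k ^ 2)).hasDerivAt.comp r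
        h1).const_mul (-(k ^ 2 / 2))
      convert! h2 using 1
      field_simp
    have hz : ∀ r ∈ Ioi (0 : ℝ) \ Ioc 0 (2 * k), r * deriv smoothTransition (2 - r ^ 2 / k ^ 2) = 0 := by
      rintro r ⟨hr0, hr⟩
      have hr0' : 0 < r := hr0
      have hr' : 2 * k < r := by
        by_contra! hle; exact hr ⟨hr0, hle⟩
      by_contra hne
      have := (deriv_smoothTransition_ne_zero (right_ne_zero_of_mul hne)).1
      have h3 : 4 ≤ r ^ 2 / k ^ 2 := by
        rw [le_div_iff₀ (by positivity)]; nlinarith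
      linarith
    rw [setIntegral_eq_of_subset_of_forall_sdiff_eq_zero measurableSet_Ioi Ioc_subset_Ioi_self hz,
      ← intervalIntegral.integral_of_le (by positivity),
      intervalIntegral.integral_eq_sub_of_hasDerivAt (fun r _ => hd r)]
    · have h4 : smoothTransition (2 - (2 * k) ^ 2 / k ^ 2) = 0 := by
        apply Real.smoothTransition.zero_of_nonpos
        have : (2 * k) ^ 2 / k ^ 2 = 4 := by field_simp; norm_num
        rw [this]; norm_num
      have h5 : smoothTransition (2 - 0 ^ 2 / k ^ 2) = 1 := by
        apply Real.smoothTransition.one_of_one_le; simp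
      rw [hh]; simp only [h4, h5]; ring
    · apply Continuous.intervalIntegrable
      have := continuous_deriv_smoothTransition
      fun_prop
  have e3 : max (Real.pi + Real.pi) 0 = Real.pi + Real.pi := max_eq_left (by positivity)
  rw [e2]
  simp
  rw [e3]
  push_cast
  ring

end cutoff

namespace ContourSystem
variable {ι : Type*} {C : ContourSystem ι}

/-- An arc may pass through nodes, but by injectivity only for finitely many parameters. -/
lemma ae_not_node (C : ContourSystem ι) (j : ι) :
    ∀ᵐ t ∂(volume.restrict (Ioo (0 : ℝ) 1)), C.path j t ∉ C.nodes := by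
  have hfin : {t ∈ Ioo (0 : ℝ) 1 | C.path j t ∈ C.nodes}.Finite := by
    refine Set.Finite.of_finite_image (f := C.path j) (C.nodes.finite_toSet.subset ?_)
      ((C.injOn j).mono fun t ht => ht.1)
    rintro _ ⟨t, ht, rfl⟩; exact ht.2
  rw [ae_restrict_iff' measurableSet_Ioo, ae_iff]
  refine measure_mono_null (fun t ht => ?_) (hfin.measure_zero volume)
  simpa [and_assoc] using ht

variable [Fintype ι] {F : ℂ → ℂ} {L R : ι → ℝ → ℂ}

set_option maxHeartbeats 1600000 in
open Real (smoothTransition) in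
/-- The total jump of `F = d/z + O(z⁻²)` along the contours. -/
lemma Sides.total_jump (h : C.Sides F L R) {d : ℂ}
    (hi : ∀ j, IntegrableOn (fun t => (L j t - R j t) * deriv (C.path j) t) (Ioo 0 1))
    (hnode : ∀ a ∈ C.nodes, F =o[𝓝[C.domain] a] fun z => (z - a)⁻¹)
    (hinf : (fun z => F z - d / z) =O[cobounded ℂ ⊓ 𝓟 C.domain] fun z => z ^ (-2 : ℤ)) :
    ∑ j, ∫ t in Ioo (0 : ℝ) 1, (L j t - R j t) * deriv (C.path j) t =
      -(2 * Real.pi * Complex.I) * d := by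
  classical
  obtain ⟨c, hc0, hc⟩ := exists_bound_deriv_smoothTransition
  set k : ℕ → ℝ := fun m => m + 1 with hk
  have hk0 : ∀ m, 0 < k m := fun m => by positivity
  have hkt : Tendsto k atTop atTop := tendsto_atTop_add_const_right _ _ tendsto_natCast_atTop_atTop
  -- As functions of a squared distance `s`: the outer cutoff is `1` for `s ≤ k²` and `0` for `s ≥
  -- 2k²`; the inner one, used at each node, is `0` for `s ≤ 1/k²` and `1` for `s ≥ 2/k²`.
  set gO : ℕ → ℝ → ℝ := fun m s => smoothTransition (2 - s / k m ^ 2) with hgO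
  set gI : ℕ → ℝ → ℝ := fun m s => smoothTransition (s * k m ^ 2 - 1) with hgI
  have hgOs : ∀ m, ContDiff ℝ 1 (gO m) := fun m =>
    Real.smoothTransition.contDiff.comp (by fun_prop)
  have hgIs : ∀ m, ContDiff ℝ 1 (gI m) := fun m =>
    Real.smoothTransition.contDiff.comp (by fun_prop)
  have hgOd : ∀ m s, deriv (gO m) s = -(deriv smoothTransition (2 - s / k m ^ 2) / k m ^ 2) := by
    intro m s
    have h1 : HasDerivAt (fun s : ℝ => 2 - s / k m ^ 2) (-(1 / k m ^ 2)) s :=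
      ((hasDerivAt_id s).div_const _).const_sub 2
    have := ((differentiable_smoothTransition _).hasDerivAt.comp s h1).deriv
    simp only [hgO]
    exact this.trans (by ring)
  have hgId : ∀ m s, deriv (gI m) s = deriv smoothTransition (s * k m ^ 2 - 1) * k m ^ 2 := by
    intro m s
    have h1 : HasDerivAt (fun s : ℝ => s * k m ^ 2 - 1) (1 * k m ^ 2) s :=
      ((hasDerivAt_id s).mul_const _).sub_const 1
    have := ((differentiable_smoothTransition _).hasDerivAt.comp s h1).deriv
    simp only [hgI]
    exact this.trans (by ring)
  set χ : ℕ → ℂ → ℂ := fun m z => (gO m (Complex.normSq (z - 0)) : ℂ) with hχ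
  set θ : ℕ → ℂ → ℂ → ℂ := fun m a z => (gI m (Complex.normSq (z - a)) : ℂ) with hθ
  set Θ : ℕ → ℂ → ℂ := fun m z => ∏ a ∈ C.nodes, θ m a z with hΘ
  set ψ : ℕ → ℂ → ℂ := fun m z => χ m z * Θ m z with hψ
  have hχs : ∀ m, ContDiff ℝ 1 (χ m) := fun m => contDiff_radial (hgOs m) 0
  have hθs : ∀ m a, ContDiff ℝ 1 (θ m a) := fun m a => contDiff_radial (hgIs m) a
  have hΘs : ∀ m, ContDiff ℝ 1 (Θ m) := fun m => contDiff_prod fun a _ => hθs m a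
  have hψs : ∀ m, ContDiff ℝ 1 (ψ m) := fun m => (hχs m).mul (hΘs m)
  have hnT : ∀ x : ℝ, ‖((smoothTransition x : ℝ) : ℂ)‖ ≤ 1 := fun x => by
    rw [Complex.norm_real, Real.norm_of_nonneg (Real.smoothTransition.nonneg x)]
    exact Real.smoothTransition.le_one x
  have hχ1 : ∀ m z, ‖χ m z‖ ≤ 1 := fun m z => hnT _
  have hθ1 : ∀ m a z, ‖θ m a z‖ ≤ 1 := fun m a z => hnT _
  have hΘ1 : ∀ m z, ‖Θ m z‖ ≤ 1 := fun m z => by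
    rw [hΘ, norm_prod]
    exact Finset.prod_le_one (fun _ _ => norm_nonneg _) fun a _ => hθ1 m a z
  have hψ1 : ∀ m z, ‖ψ m z‖ ≤ 1 := fun m z => by
    rw [hψ, norm_mul]; exact mul_le_one₀ (hχ1 m z) (norm_nonneg _) (hΘ1 m z)
  -- supports
  have hχ0 : ∀ m z, z ∉ Metric.closedBall (0 : ℂ) (2 * k m) → χ m z = 0 := by
    intro m z hz
    rw [Metric.mem_closedBall, dist_zero_right, not_le] at hz
    have : smoothTransition (2 - Complex.normSq (z - 0) / k m ^ 2) = 0 := by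
      apply Real.smoothTransition.zero_of_nonpos
      rw [sub_zero, Complex.normSq_eq_norm_sq]
      have : 4 ≤ ‖z‖ ^ 2 / k m ^ 2 := by
        rw [le_div_iff₀ (by have := hk0 m; positivity)]; nlinarith [hk0 m]
      linarith
    simp only [hχ, hgO, this, Complex.ofReal_zero]
  have hψc : ∀ m, HasCompactSupport (ψ m) := fun m =>
    HasCompactSupport.intro (isCompact_closedBall (0 : ℂ) (2 * k m)) fun z hz => by
      simp only [hψ, hχ0 m z hz, zero_mul]
  have hψn : ∀ m, ∀ a ∈ C.nodes, a ∉ tsupport (ψ m) := by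
    intro m a ha
    rw [notMem_tsupport_iff_eventuallyEq]
    filter_upwards [Metric.ball_mem_nhds a (inv_pos.2 (hk0 m))] with z hz
    have : θ m a z = 0 := by
      simp only [hθ, hgI]
      rw [Real.smoothTransition.zero_of_nonpos]; · simp
      rw [Metric.mem_ball, dist_eq_norm] at hz
      rw [Complex.normSq_eq_norm_sq]
      have h1 : ‖z - a‖ * k m ≤ 1 := by
        have := mul_le_mul_of_nonneg_right hz.le (hk0 m).le
        rwa [inv_mul_cancel₀ (hk0 m).ne'] at this
      have h2 : 0 ≤ ‖z - a‖ * k m := mul_nonneg (norm_nonneg _) (hk0 m).le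
      nlinarith
    simp only [hψ, hΘ]
    rw [Finset.prod_eq_zero ha this, mul_zero]; rfl
  have hJ : ∀ m, ∫ z, F z * dbar (ψ m) z = 1 / (2 * Complex.I) *
      ∑ j, ∫ t in Ioo (0 : ℝ) 1, (L j t - R j t) * ψ m (C.path j t) * deriv (C.path j) t :=
    fun m => h.jump_formula hi (hψs m) (hψc m) (hψn m)
  -- the cutoffs tend to 1
  have hlimχ : ∀ z, Tendsto (fun m => χ m z) atTop (𝓝 1) := by
    intro z
    refine tendsto_const_nhds.congr' ?_
    filter_upwards [hkt.eventually_ge_atTop (‖z‖ + 1)] with m hm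
    simp only [hχ, hgO]
    rw [Real.smoothTransition.one_of_one_le]; · simp
    rw [sub_zero, Complex.normSq_eq_norm_sq]
    have : ‖z‖ ^ 2 / k m ^ 2 ≤ 1 := by
      rw [div_le_one (by have := hk0 m; positivity)]
      nlinarith [norm_nonneg z]
    linarith
  have hlimθ : ∀ a z, z ≠ a → Tendsto (fun m => θ m a z) atTop (𝓝 1) := by
    intro a z hza
    have hp : 0 < ‖z - a‖ := norm_pos_iff.2 (sub_ne_zero.2 hza)
    refine tendsto_const_nhds.congr' ?_
    filter_upwards [hkt.eventually_ge_atTop (2 / ‖z - a‖)] with m hm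
    simp only [hθ, hgI]
    rw [Real.smoothTransition.one_of_one_le]; · simp
    rw [Complex.normSq_eq_norm_sq]
    rw [div_le_iff₀ hp] at hm
    nlinarith
  have hlimψ : ∀ z, z ∉ C.nodes → Tendsto (fun m => ψ m z) atTop (𝓝 1) := by
    intro z hz
    have : Tendsto (fun m => Θ m z) atTop (𝓝 (∏ a ∈ C.nodes, 1)) :=
      tendsto_finsetProd _ fun a ha => hlimθ a z fun e => hz (e ▸ ha)
    simpa using (hlimχ z).mul this
  have hRHS : Tendsto (fun m => ∫ z, F z * dbar (ψ m) z) atTop (𝓝 (1 / (2 * Complex.I) *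
      ∑ j, ∫ t in Ioo (0 : ℝ) 1, (L j t - R j t) * deriv (C.path j) t)) := by
    simp_rw [hJ]
    refine Tendsto.const_mul _ (tendsto_finsetSum _ fun j _ => ?_)
    refine tendsto_integral_of_dominated_convergence
      (fun t => ‖(L j t - R j t) * deriv (C.path j) t‖) ?_ (hi j).norm ?_ ?_
    · intro m
      have h1 : AEStronglyMeasurable (fun t => ψ m (C.path j t)) (volume.restrict (Ioo 0 1)) :=
        ((hψs m).continuous.comp_continuousOn (C.continuousOn_path j)).aestronglyMeasurable
          measurableSet_Ioo
      refine (h1.mul (hi j).aestronglyMeasurable).congr (ae_of_all _ fun t => ?_)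
      simp only [Pi.mul_apply]; ring
    · intro m
      refine ae_of_all _ fun t => ?_
      rw [mul_right_comm, norm_mul]
      exact mul_le_of_le_one_right (norm_nonneg _) (hψ1 m _)
    · filter_upwards [C.ae_not_node j] with t ht
      have := ((hlimψ _ ht).const_mul (L j t - R j t)).mul_const (deriv (C.path j) t)
      simpa using this
  -- the area integral
  have hΘone : ∀ᶠ m in atTop, ∀ z, deriv smoothTransition (2 - Complex.normSq z / k m ^ 2) ≠ 0 →
      Θ m z = 1 := by
    have h1 : ∀ᶠ m in atTop, ∀ a ∈ C.nodes, ‖a‖ + 2 ≤ k m :=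
      (Finset.eventually_all _).2 fun a _ => hkt.eventually_ge_atTop _
    filter_upwards [h1] with m hm z hz
    -- For large `k` the ring where the outer cutoff varies is far from the nodes, so the inner
    -- cutoffs equal `1` there.
    refine Finset.prod_eq_one fun a ha => ?_
    have h2 := (deriv_smoothTransition_ne_zero hz).2
    have h3 : k m ≤ ‖z‖ := by
      have : 1 ≤ Complex.normSq z / k m ^ 2 := by linarith
      rw [le_div_iff₀ (by have := hk0 m; positivity), one_mul, Complex.normSq_eq_norm_sq] at this
      exact le_of_sq_le_sq this (norm_nonneg z)
    have h4 : 2 ≤ ‖z - a‖ := by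
      have := norm_sub_norm_le z a
      linarith [hm a ha]
    simp only [hθ, hgI]
    rw [Real.smoothTransition.one_of_one_le]; · simp
    rw [Complex.normSq_eq_norm_sq]
    have h5 : 1 ≤ k m := by simp [hk]
    have h6 : 2 ≤ ‖z - a‖ * k m := by nlinarith
    nlinarith
  obtain ⟨K, hK⟩ := hinf.bound
  rw [eventually_inf_principal, ← comap_norm_atTop, eventually_comap] at hK
  obtain ⟨r, hr⟩ := eventually_atTop.1 hK
  have hdχ : ∀ m z, dbar (χ m) z =
      -((deriv smoothTransition (2 - Complex.normSq z / k m ^ 2) : ℝ) / k m ^ 2 : ℂ) * z := by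
    intro m z
    rw [hχ, dbar_radial ((hgOs m).differentiable one_ne_zero), hgOd, sub_zero]
    push_cast; ring
  have hdθ : ∀ m a z, dbar (θ m a) z =
      ((deriv smoothTransition (Complex.normSq (z - a) * k m ^ 2 - 1) : ℝ) * k m ^ 2 : ℂ) *
        (z - a) := by
    intro m a z
    rw [hθ, dbar_radial ((hgIs m).differentiable one_ne_zero), hgId]
    push_cast; ring
  have hLHS : Tendsto (fun m => ∫ z, F z * dbar (ψ m) z) atTop (𝓝 (-(Real.pi * d))) := by
    rw [Metric.tendsto_atTop']
    intro ε' hε'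
    -- Each node will contribute at most `4πcε`; this choice keeps their sum below `ε'/2`.
    set ε : ℝ := ε' / (2 * (C.nodes.card * (4 * Real.pi * c) + 1)) with hε
    have hpc : 0 ≤ C.nodes.card * (4 * Real.pi * c) := by
      have := Real.pi_pos; positivity
    have hε0 : 0 < ε := by positivity
    have hn1 : ∀ᶠ m in atTop, ∀ a ∈ C.nodes, ∀ z ∈ C.domain, ‖z - a‖ ≤ 2 / k m →
        ‖F z‖ ≤ ε * ‖(z - a)⁻¹‖ := by
      refine (Finset.eventually_all _).2 fun a ha => ?_
      have h1 := (hnode a ha).def hε0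
      rw [eventually_nhdsWithin_iff] at h1
      obtain ⟨δ, hδ, h2⟩ := Metric.eventually_nhds_iff_ball.1 h1
      have h3 : Tendsto (fun m => 2 / k m) atTop (𝓝 0) := hkt.const_div_atTop 2
      filter_upwards [h3.eventually (gt_mem_nhds hδ)] with m hm z hz hza
      exact h2 z (by rw [Metric.mem_ball, dist_eq_norm]; exact hza.trans_lt hm) hz
    have hn2 : ∀ᶠ m in atTop, 4 * Real.pi * (|K| * c) / k m < ε' / 2 :=
      (hkt.const_div_atTop (4 * Real.pi * (|K| * c))).eventually (gt_mem_nhds (by positivity))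
    obtain ⟨m₀, hm₀⟩ := eventually_atTop.1
      (hn1.and (hn2.and (hΘone.and (hkt.eventually_ge_atTop r))))
    refine ⟨m₀, fun m hm => ?_⟩
    obtain ⟨g1, g2, g3, g4⟩ := hm₀ m (le_of_lt hm)
    set T : ℂ → ℂ := fun z => ((deriv smoothTransition (2 - Complex.normSq z / k m ^ 2) : ℝ) : ℂ)
      with hT
    have hkm := hk0 m
    have hTi : Integrable T := by
      refine Continuous.integrable_of_hasCompactSupport ?_ ?_
      · exact Complex.continuous_ofReal.comp (continuous_deriv_smoothTransition.comp
          (continuous_const.sub (Complex.continuous_normSq.div_const _)))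
      · refine HasCompactSupport.intro (isCompact_closedBall (0 : ℂ) (2 * k m)) fun z hz => ?_
        rw [Metric.mem_closedBall, dist_zero_right, not_le] at hz
        rw [hT]
        simp only [Complex.ofReal_eq_zero]
        by_contra hne
        have h1 := (deriv_smoothTransition_ne_zero hne).1
        have : 4 ≤ ‖z‖ ^ 2 / k m ^ 2 := by
          rw [le_div_iff₀ (by positivity)]; nlinarith
        rw [Complex.normSq_eq_norm_sq] at h1
        linarith
    have hFi : Integrable (fun z => F z * dbar (ψ m) z) :=
      h.integrable_mul (continuous_dbar (hψs m)) (Sides.hasCompactSupport_dbar (hψc m))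
        fun a ha ha' => hψn m a ha (Sides.tsupport_dbar_subset _ ha')
    have hTint : ∫ z, d / k m ^ 2 * T z = Real.pi * d := by
      rw [integral_const_mul, integral_deriv_smoothTransition_normSq hkm]
      have : (k m : ℂ) ≠ 0 := by exact_mod_cast hkm.ne'
      field_simp
    -- Majorant of the error. Near a node `|F| ≤ ε/|z - a|` and `|∂̄θ| ≤ c k² |z - a|`, on a disk of
    -- area `4π/k²`: this is where `o(1/|z - a|)` is exactly enough. In the outer ring `|F - d/z| ≤
    -- |K|/|z|²` and `|∂̄χ| ≤ c|z|/k²` with `|z| ≥ k`, inside a disk of area `4πk²`.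
    set bd : ℂ → ℝ := fun z => (∑ a ∈ C.nodes, (Metric.closedBall a (2 / k m)).indicator
      (fun _ => ε * c * k m ^ 2) z) + (Metric.closedBall (0 : ℂ) (2 * k m)).indicator
      (fun _ => |K| * c / k m ^ 3) z with hbd
    have hvol : ∀ (a : ℂ) (r : ℝ), 0 ≤ r → volume.real (Metric.closedBall a r) = Real.pi * r ^ 2 := by
      intro a r hr
      rw [measureReal_def, Complex.volume_closedBall]
      simp [hr, mul_comm]
    have hii : ∀ (a : ℂ) (r x : ℝ), Integrable ((Metric.closedBall a r).indicator fun _ => x) :=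
      fun a r x => (integrable_indicator_iff measurableSet_closedBall).2
        (integrableOn_const measure_closedBall_lt_top.ne)
    have hbi : Integrable bd := (integrable_finsetSum _ fun a _ => hii _ _ _).add (hii _ _ _)
    have hbint : ∫ z, bd z < ε' := by
      rw [hbd, integral_add (integrable_finsetSum _ fun a _ => hii _ _ _) (hii _ _ _),
        integral_finsetSum _ fun a _ => hii _ _ _]
      simp only [integral_indicator_const _ measurableSet_closedBall]
      rw [hvol _ _ (by positivity)]
      simp only [hvol _ (2 / k m) (by positivity)]
      rw [Finset.sum_const, nsmul_eq_mul, smul_eq_mul, smul_eq_mul]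
      have e1 : Real.pi * (2 / k m) ^ 2 * (ε * c * k m ^ 2) = 4 * Real.pi * c * ε := by
        field_simp; ring
      have e2 : Real.pi * (2 * k m) ^ 2 * (|K| * c / k m ^ 3) = 4 * Real.pi * (|K| * c) / k m := by
        field_simp; ring
      rw [e1, e2]
      have e3 : C.nodes.card * (4 * Real.pi * c * ε) ≤ ε' / 2 := by
        rw [hε, show (C.nodes.card : ℝ) * (4 * Real.pi * c *
          (ε' / (2 * (C.nodes.card * (4 * Real.pi * c) + 1)))) =
          (ε' / 2) * ((C.nodes.card * (4 * Real.pi * c)) / (C.nodes.card * (4 * Real.pi * c) + 1)) by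
            field_simp]
        refine mul_le_of_le_one_right (by positivity) ?_
        rw [div_le_one (by positivity)]; linarith
      linarith
    have hpt : ∀ᵐ z, ‖F z * dbar (ψ m) z + d / k m ^ 2 * T z‖ ≤ bd z := by
      filter_upwards [Sides.ae_mem_domain C] with z hz
      have hz0 := C.ne_zero_of_mem hz
      have e1 : dbar (ψ m) z = χ m z * dbar (Θ m) z + dbar (χ m) z * Θ m z :=
        dbar_mul ((hχs m).differentiable one_ne_zero z) ((hΘs m).differentiable one_ne_zero z)
      have e2 : dbar (χ m) z * Θ m z = dbar (χ m) z := by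
        by_cases hne : deriv smoothTransition (2 - Complex.normSq z / k m ^ 2) = 0
        · rw [hdχ, hne]; simp
        · rw [g3 z hne, mul_one]
      -- Since `∂̄χ = -T z/k²`, the leading part `d/z` contributes exactly `-d T/k²`, whose integral
      -- is `-πd`.
      have e3 : F z * dbar (ψ m) z + d / k m ^ 2 * T z =
          F z * (χ m z * dbar (Θ m) z) + (F z - d / z) * dbar (χ m) z := by
        rw [e1, e2, hdχ, hT]
        field_simp
        ring
      rw [e3]
      refine (norm_add_le _ _).trans (add_le_add ?_ ?_)
      · have h1 : ‖F z * (χ m z * dbar (Θ m) z)‖ ≤ ∑ a ∈ C.nodes, ‖F z‖ * ‖dbar (θ m a) z‖ := by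
          rw [norm_mul, norm_mul, ← Finset.mul_sum]
          refine mul_le_mul_of_nonneg_left ?_ (norm_nonneg _)
          exact (mul_le_of_le_one_left (norm_nonneg _) (hχ1 m z)).trans
            (norm_dbar_prod_le _ _ _ (hθs m)
              fun a => hθ1 m a z)
        refine h1.trans (Finset.sum_le_sum fun a ha => ?_)
        by_cases hne : deriv smoothTransition (Complex.normSq (z - a) * k m ^ 2 - 1) = 0
        · rw [hdθ, hne]
          simp only [Complex.ofReal_zero, zero_mul, norm_zero, mul_zero]
          exact indicator_nonneg (fun _ _ => by positivity) _
        · have h2 := (deriv_smoothTransition_ne_zero hne).2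
          have hza : ‖z - a‖ ≤ 2 / k m := by
            rw [le_div_iff₀ hkm]
            rw [Complex.normSq_eq_norm_sq] at h2
            have : (‖z - a‖ * k m) ^ 2 ≤ 2 ^ 2 := by nlinarith
            exact le_of_sq_le_sq this (by norm_num)
          rw [indicator_of_mem (by rwa [Metric.mem_closedBall, dist_eq_norm])]
          have hne' : z - a ≠ 0 := sub_ne_zero.2 fun e => C.not_node_of_mem hz (e ▸ ha)
          have hp : 0 < ‖z - a‖ := norm_pos_iff.2 hne'
          rw [hdθ, norm_mul, norm_mul, norm_pow, Complex.norm_real, Complex.norm_real,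
            Real.norm_of_nonneg hkm.le]
          calc ‖F z‖ * (‖deriv smoothTransition (Complex.normSq (z - a) * k m ^ 2 - 1)‖ * k m ^ 2 *
              ‖z - a‖) ≤ (ε * ‖(z - a)⁻¹‖) * (c * k m ^ 2 * ‖z - a‖) := by
                gcongr
                · exact g1 a ha z hz hza
                · exact hc _
            _ = ε * c * k m ^ 2 := by
                rw [norm_inv]; field_simp
      · by_cases hne : deriv smoothTransition (2 - Complex.normSq z / k m ^ 2) = 0
        · rw [hdχ, hne]
          simp only [Complex.ofReal_zero, zero_div, neg_zero, zero_mul, mul_zero, norm_zero]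
          exact indicator_nonneg (fun _ _ => by positivity) _
        · obtain ⟨h1, h2⟩ := deriv_smoothTransition_ne_zero hne
          rw [Complex.normSq_eq_norm_sq] at h1 h2
          have h3 : k m ≤ ‖z‖ := by
            have : 1 ≤ ‖z‖ ^ 2 / k m ^ 2 := by linarith
            rw [le_div_iff₀ (by positivity), one_mul] at this
            exact le_of_sq_le_sq this (norm_nonneg z)
          have h4 : ‖z‖ ≤ 2 * k m := by
            have : ‖z‖ ^ 2 / k m ^ 2 ≤ 2 := by linarith
            rw [div_le_iff₀ (by positivity)] at this
            have : ‖z‖ ^ 2 ≤ (2 * k m) ^ 2 := by nlinarith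
            exact le_of_sq_le_sq this (by positivity)
          rw [indicator_of_mem (by rwa [Metric.mem_closedBall, dist_zero_right])]
          have h5 : ‖F z - d / z‖ ≤ |K| * (‖z‖ ^ 2)⁻¹ := by
            refine (hr ‖z‖ (g4.trans h3) z rfl hz).trans ?_
            rw [norm_zpow, zpow_neg]
            exact mul_le_mul_of_nonneg_right (le_abs_self K) (by positivity)
          have hzp : 0 < ‖z‖ := norm_pos_iff.2 hz0
          rw [norm_mul, hdχ, norm_mul, norm_neg, norm_div, norm_pow, Complex.norm_real,
            Complex.norm_real, Real.norm_of_nonneg hkm.le]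
          calc ‖F z - d / z‖ * (‖deriv smoothTransition (2 - Complex.normSq z / k m ^ 2)‖ / k m ^ 2 *
              ‖z‖) ≤ (|K| * (‖z‖ ^ 2)⁻¹) * (c / k m ^ 2 * ‖z‖) := by
                gcongr
                exact hc _
            _ = |K| * c / (k m ^ 2 * ‖z‖) := by field_simp
            _ ≤ |K| * c / (k m ^ 2 * k m) := by gcongr
            _ = |K| * c / k m ^ 3 := by ring
    rw [dist_eq_norm, sub_neg_eq_add, ← hTint, ← integral_add hFi (hTi.const_mul _)]
    exact (norm_integral_le_of_norm_le hbi hpt).trans_lt hbint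
  have := tendsto_nhds_unique hRHS hLHS
  have hI := Complex.I_ne_zero
  field_simp at this
  linear_combination this

end ContourSystem

/-! ### Hankel determinants and orthogonal polynomials. -/

/-- Jacobi's formula. -/
lemma HasDerivAt.matrix_det {m : Type*} [Fintype m] [DecidableEq m] {M : ℂ → Matrix m m ℂ}
    {M' : Matrix m m ℂ} {s : ℂ} (h : ∀ i j, HasDerivAt (fun s => M s i j) (M' i j) s) :
    HasDerivAt (fun s => (M s).det) ((M s).adjugate * M').trace s := by
  -- By Cramer's rule the trace is the sum of the determinants with one column replaced by its
  -- derivative, as the Leibniz rule produces them.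
  have e : ((M s).adjugate * M').trace = ∑ i, ((M s).updateCol i (fun j => M' j i)).det := by
    rw [Matrix.trace]
    refine Finset.sum_congr rfl fun i _ => ?_
    rw [← Matrix.cramer_apply, Matrix.cramer_eq_adjugate_mulVec]
    rfl
  rw [e]
  simp only [Matrix.det_apply]
  rw [Finset.sum_comm]
  refine HasDerivAt.fun_sum fun π _ => ?_
  rw [← Finset.smul_sum]
  have h1 := HasDerivAt.fun_finsetProd (u := Finset.univ) (f := fun i s => M s (π i) i)
    (f' := fun i => M' (π i) i) fun i _ => h (π i) i
  refine (h1.const_smul (Equiv.Perm.sign π)).congr_deriv ?_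
  congr 1
  refine Finset.sum_congr rfl fun i _ => ?_
  rw [← Finset.mul_prod_erase _ _ (Finset.mem_univ i), Matrix.updateCol_self, smul_eq_mul, mul_comm]
  congr 1
  refine Finset.prod_congr rfl fun j hj => ?_
  rw [Matrix.updateCol_ne (Finset.ne_of_mem_erase hj)]

open Polynomial

lemma degree_C_mul_le_degree (a : ℂ) (p : ℂ[X]) : (C a * p).degree ≤ p.degree := by
  rw [C_mul']; exact degree_smul_le a p

/-- The linear functional on polynomials with moments `m k`. -/
noncomputable def momentFunctional (m : ℕ → ℂ) : ℂ[X] →ₗ[ℂ] ℂ :=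
  Polynomial.lsum fun k => LinearMap.mulRight ℂ (m k)

lemma momentFunctional_apply (m : ℕ → ℂ) (p : ℂ[X]) :
    momentFunctional m p = p.sum fun k a => a * m k := rfl

@[simp] lemma momentFunctional_X_pow (m : ℕ → ℂ) (k : ℕ) : momentFunctional m (X ^ k) = m k := by
  rw [momentFunctional_apply, ← monomial_one_right_eq_X_pow, sum_monomial_index] <;> simp

@[simp] lemma momentFunctional_C_mul (m : ℕ → ℂ) (a : ℂ) (p : ℂ[X]) :
    momentFunctional m (C a * p) = a * momentFunctional m p := by
  rw [C_mul', map_smul, smul_eq_mul]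

lemma momentFunctional_eq_sum (m : ℕ → ℂ) {p : ℂ[X]} {n : ℕ} (hp : p.degree < n) :
    momentFunctional m p = ∑ i : Fin n, p.coeff i * m i := by
  rw [momentFunctional_apply, ← sum_fin (fun k a => a * m k) (fun i => zero_mul _) hp]

lemma eq_sum_of_degree_lt {p : ℂ[X]} {n : ℕ} (hp : p.degree < n) :
    p = ∑ i : Fin n, C (p.coeff i) * X ^ (i : ℕ) :=
  p.sum_C_mul_X_pow_eq.symm.trans
    (sum_fin (fun i a => C a * X ^ i) (fun i => by simp) hp).symm

lemma coeff_eq_one_of_monic {p : ℂ[X]} {k : ℕ} (h : p.Monic) (hk : p.natDegree = k) :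
    p.coeff k = 1 := by
  rw [← hk]; exact h

/-- The Hankel matrix of the moments `m k`. -/
def hankel (n : ℕ) (m : ℕ → ℂ) : Matrix (Fin n) (Fin n) ℂ := Matrix.of fun i j => m (i + j)

/-- `P` is monic of degree `n`, orthogonal to `1, …, X^(n-1)`, and `Q` is of degree less than `n`,
orthogonal to `1, …, X^(n-2)`, with normalization `c`. -/
structure OrthogonalPair (n : ℕ) (m : ℕ → ℂ) (c : ℂ) (P Q : ℂ[X]) : Prop where
  ne_zero : c ≠ 0
  monic : P.Monic
  natDegree : P.natDegree = n
  degree_lt : Q.degree < n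
  left : ∀ k < n, momentFunctional m (P * X ^ k) = 0
  right : ∀ k < n, momentFunctional m (Q * X ^ k) = if k + 1 = n then c else 0

/-- The Christoffel-Darboux numerator on the diagonal. -/
noncomputable def cdPoly (P Q : ℂ[X]) : ℂ[X] := Q * derivative P - P * derivative Q

namespace OrthogonalPair
variable {n : ℕ} {m : ℕ → ℂ} {c : ℂ} {P Q : ℂ[X]}

lemma left_mul (h : OrthogonalPair n m c P Q) {A : ℂ[X]} (hA : A.degree < n) :
    momentFunctional m (P * A) = 0 := by
  rw [eq_sum_of_degree_lt hA, Finset.mul_sum, map_sum]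
  refine Finset.sum_eq_zero fun i _ => ?_
  rw [mul_left_comm, momentFunctional_C_mul, h.left i i.2, mul_zero]

lemma right_mul (h : OrthogonalPair n m c P Q) {A : ℂ[X]} (hA : A.degree < n) :
    momentFunctional m (Q * A) = c * A.coeff (n - 1) := by
  conv_lhs => rw [eq_sum_of_degree_lt hA, Finset.mul_sum, map_sum]
  simp_rw [mul_left_comm Q, momentFunctional_C_mul]
  -- For `n = 0` the polynomial `A` is zero, so the truncated index `n - 1 = 0` does no harm.
  rcases n with _ | n
  · rw [coeff_eq_zero_of_degree_lt (by simpa using hA)]; simp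
  rw [Finset.sum_eq_single (Fin.last n)]
  · rw [h.right _ (Fin.last n).2]; simp [mul_comm]
  · intro i _ hi
    rw [h.right _ i.2, if_neg, mul_zero]
    intro e; exact hi (Fin.ext (by simpa using e))
  · simp

lemma degree_left (h : OrthogonalPair n m c P Q) : P.degree = n := by
  rw [degree_eq_natDegree h.monic.ne_zero, h.natDegree]

/-- The kernel `(Q(x) P(y) - P(x) Q(y)) / (y - x)` as a polynomial in `y`. -/
lemma exists_kernel (h : OrthogonalPair n m c P Q) (x : ℂ) : ∃ k : ℂ[X], k.degree < n ∧
    (X - C x) * k = C (Q.eval x) * P - C (P.eval x) * Q ∧ k.eval x = (cdPoly P Q).eval x ∧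
    ∀ i < n, momentFunctional m (k * X ^ i) = c * x ^ i := by
  obtain ⟨A, hA⟩ := X_sub_C_dvd_sub_C_eval (a := x) (p := P)
  obtain ⟨B, hB⟩ := X_sub_C_dvd_sub_C_eval (a := x) (p := Q)
  have hX := X_sub_C_ne_zero x
  -- `A` and `B` are the difference quotients of `P` and `Q` at `x`; the terms `P(x)Q(x)` cancel.
  have hk : (X - C x) * (Q * A - P * B) = C (Q.eval x) * P - C (P.eval x) * Q := by
    linear_combination (-Q) * hA + P * hB
  have hdeg : (Q * A - P * B).degree < n := by
    have h1 : ((X - C x) * (Q * A - P * B)).degree ≤ (n : WithBot ℕ) := by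
      rw [hk]
      refine (degree_sub_le _ _).trans (max_le ?_ ?_)
      · exact (degree_C_mul_le_degree _ _).trans h.degree_left.le
      · exact (degree_C_mul_le_degree _ _).trans h.degree_lt.le
    by_cases h0 : Q * A - P * B = 0
    · rw [h0, degree_zero]; exact WithBot.bot_lt_coe _
    · rw [degree_mul, degree_X_sub_C, degree_eq_natDegree h0] at h1
      rw [degree_eq_natDegree h0]
      have : 1 + (Q * A - P * B).natDegree ≤ n := by exact_mod_cast h1
      exact_mod_cast (show (Q * A - P * B).natDegree < n by omega)
  have heval : (Q * A - P * B).eval x = (cdPoly P Q).eval x := by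
    have := congr_arg (fun p => (derivative p).eval x) hk
    simp only [derivative_mul, derivative_sub, derivative_X, derivative_C, eval_add, eval_mul,
      eval_sub, eval_X, eval_C, sub_self, zero_mul, sub_zero, one_mul,
      add_zero, zero_add] at this
    rw [eval_sub, eval_mul, eval_mul, this]
    simp [cdPoly]
  refine ⟨Q * A - P * B, hdeg, hk, heval, fun i hi => ?_⟩
  have hn : 0 < n := by omega
  have hAdeg : A.Monic ∧ A.natDegree = n - 1 := by
    have hPs : (P - C (P.eval x)).Monic :=
      h.monic.sub_of_left (degree_C_le.trans_lt (by rw [h.degree_left]; exact_mod_cast hn))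
    have h1 : A.Monic := by
      rw [hA] at hPs; exact (monic_X_sub_C x).of_mul_monic_left hPs
    refine ⟨h1, ?_⟩
    have h2 := congr_arg Polynomial.natDegree hA
    rw [natDegree_sub_C, (monic_X_sub_C x).natDegree_mul h1, natDegree_X_sub_C, h.natDegree] at h2
    omega
  have hBdeg : B.degree < n := by
    by_cases h0 : B = 0
    · rw [h0, degree_zero]; exact WithBot.bot_lt_coe _
    have h2 : ((X - C x) * B).degree < (n : WithBot ℕ) := by
      rw [← hB]
      exact (degree_sub_le _ _).trans_lt (max_lt h.degree_lt
        (degree_C_le.trans_lt (by exact_mod_cast hn)))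
    refine lt_of_le_of_lt ?_ h2
    rw [degree_mul]
    exact le_add_of_nonneg_left (by rw [degree_X_sub_C]; exact zero_le_one)
  -- For `i = 0`, `P` is orthogonal to `B`, and `Q` picks out the leading coefficient `1` of `A`,
  -- which has degree `n - 1`. The step multiplies by `X = x + (X - x)`: `(X - x)k` is a combination
  -- of `P` and `Q`, both orthogonal to `X^i` when `i + 1 < n`.
  induction i with
  | zero =>
    have hAd : A.degree < n := by
      rw [degree_eq_natDegree hAdeg.1.ne_zero, hAdeg.2]
      exact_mod_cast (show n - 1 < n by omega)
    have hc1 : A.coeff (n - 1) = 1 := by rw [← hAdeg.2]; exact hAdeg.1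
    rw [pow_zero, mul_one, map_sub, h.left_mul hBdeg, h.right_mul hAd, hc1]
    simp
  | succ i ih =>
    have e : (Q * A - P * B) * X ^ (i + 1) = C x * ((Q * A - P * B) * X ^ i) +
        (C (Q.eval x) * (P * X ^ i) - C (P.eval x) * (Q * X ^ i)) := by
      linear_combination (X ^ i) * hk
    rw [e, map_add, map_sub, momentFunctional_C_mul, momentFunctional_C_mul,
      momentFunctional_C_mul, ih (by omega), h.left i (by omega), h.right i (by omega),
      if_neg (by omega)]
    ring

lemma hankel_mulVec {p : ℂ[X]} (hp : p.degree < n) (i : Fin n) :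
    (hankel n m).mulVec (fun j => p.coeff j) i = momentFunctional m (p * X ^ (i : ℕ)) := by
  conv_rhs => rw [eq_sum_of_degree_lt hp, Finset.sum_mul, map_sum]
  rw [Matrix.mulVec, dotProduct]
  refine Finset.sum_congr rfl fun j _ => ?_
  rw [mul_assoc, momentFunctional_C_mul, ← pow_add, momentFunctional_X_pow, hankel,
    Matrix.of_apply, mul_comm, add_comm]

/-- The kernel at `x` solves `H k = c (x^i)`. A left null vector `u` of `H` would give `∑ u_i x^i =
0` for every `x`, hence `u = 0`. -/
lemma det_hankel_ne_zero (h : OrthogonalPair n m c P Q) : (hankel n m).det ≠ 0 := by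
  intro h0
  obtain ⟨u, hu, hu0⟩ := Matrix.exists_vecMul_eq_zero_iff.2 h0
  have hx : ∀ x : ℂ, ∑ i : Fin n, u i * x ^ (i : ℕ) = 0 := by
    intro x
    obtain ⟨k, hk, -, -, hL⟩ := h.exists_kernel x
    have h1 : u ⬝ᵥ ((hankel n m).mulVec (fun j => k.coeff j)) = 0 := by
      rw [Matrix.dotProduct_mulVec, hu0, zero_dotProduct]
    rw [dotProduct] at h1
    simp_rw [hankel_mulVec hk] at h1
    rw [Finset.sum_congr rfl fun i _ => by rw [hL i i.2, mul_left_comm], ← Finset.mul_sum] at h1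
    exact (mul_eq_zero.1 h1).resolve_left h.ne_zero
  have hp : (∑ i : Fin n, C (u i) * X ^ (i : ℕ) : ℂ[X]) = 0 := by
    refine Polynomial.funext fun x => ?_
    simpa [eval_finsetSum] using hx x
  refine hu (_root_.funext fun i => ?_)
  have := congr_arg (fun p => p.coeff i) hp
  simpa [finsetSum_coeff, coeff_X_pow, Fin.val_inj] using this

lemma eq_zero (h : OrthogonalPair n m c P Q) {r : ℂ[X]} (hr : r.degree < n)
    (h0 : ∀ k < n, momentFunctional m (r * X ^ k) = 0) : r = 0 := by
  have h1 : (hankel n m).mulVec (fun j => r.coeff j) = 0 := by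
    ext i; rw [hankel_mulVec hr, h0 i i.2]; rfl
  have h2 := Matrix.eq_zero_of_mulVec_eq_zero h.det_hankel_ne_zero h1
  rw [eq_sum_of_degree_lt hr]
  refine Finset.sum_eq_zero fun i _ => ?_
  have := congr_fun h2 i
  simp only [Pi.zero_apply] at this
  rw [this, C_0, zero_mul]

/-- Inverting `H k = c (x^i)` expresses the coefficients of the kernel in `y` through `H⁻¹`; then `y
= x`. -/
lemma inv_hankel (h : OrthogonalPair n m c P Q) :
    ∑ i : Fin n, ∑ j : Fin n, C (c * (hankel n m)⁻¹ j i) * X ^ ((i : ℕ) + j) = cdPoly P Q := by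
  refine Polynomial.funext fun x => ?_
  obtain ⟨k, hk, -, hkx, hL⟩ := h.exists_kernel x
  have hunit : IsUnit (hankel n m).det := isUnit_iff_ne_zero.2 h.det_hankel_ne_zero
  have h1 : (hankel n m).mulVec (fun j => k.coeff j) =
      fun i : Fin n => c * x ^ (i : ℕ) := by
    ext i; rw [hankel_mulVec hk, hL i i.2]
  have h2 : (fun j : Fin n => k.coeff j) =
      (hankel n m)⁻¹.mulVec fun i : Fin n => c * x ^ (i : ℕ) := by
    rw [← h1, Matrix.mulVec_mulVec, Matrix.nonsing_inv_mul _ hunit, Matrix.one_mulVec]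
  rw [← hkx, eq_sum_of_degree_lt hk, Finset.sum_comm]
  simp only [eval_finsetSum, eval_mul, eval_C, eval_pow, eval_X]
  refine Finset.sum_congr rfl fun j _ => ?_
  have h3 : k.coeff j = _ := congr_fun h2 j
  rw [h3, Matrix.mulVec, dotProduct, Finset.sum_mul]
  exact Finset.sum_congr rfl fun i _ => by ring

/-- In Jacobi's formula `H⁻¹` is paired with the matrix `m'_(i+j)`, which depends on `i + j` only.
The trace is thus the functional with moments `m'` applied to `∑ (H⁻¹)_ji X^(i+j)`, which
`inv_hankel` evaluates. Only the moments of index at most `2n - 2` occur. -/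
lemma hasDerivAt_det {μ : ℂ → ℕ → ℂ} {s₀ : ℂ} {m' : ℕ → ℂ}
    (h : OrthogonalPair n (μ s₀) c P Q)
    (hm : ∀ k, k + 1 < 2 * n → HasDerivAt (fun s => μ s k) (m' k) s₀) :
    HasDerivAt (fun s => (hankel n (μ s)).det)
      ((hankel n (μ s₀)).det * (momentFunctional m' (cdPoly P Q) / c)) s₀ := by
  have h1 := HasDerivAt.matrix_det (M := fun s => hankel n (μ s)) (M' := hankel n m') (s := s₀)
    fun i j => hm _ (by omega)
  refine h1.congr_deriv ?_
  have hunit : IsUnit (hankel n (μ s₀)).det := isUnit_iff_ne_zero.2 h.det_hankel_ne_zero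
  have hc := h.ne_zero
  rw [← h.inv_hankel, Matrix.inv_def, Ring.inverse_eq_inv']
  have hdet := h.det_hankel_ne_zero
  simp only [map_sum, momentFunctional_C_mul, momentFunctional_X_pow, Matrix.smul_apply,
    smul_eq_mul, Finset.sum_div, Finset.mul_sum]
  rw [Matrix.trace, Finset.sum_comm]
  refine Finset.sum_congr rfl fun j _ => ?_
  rw [Matrix.diag_apply, Matrix.mul_apply]
  refine Finset.sum_congr rfl fun i _ => ?_
  rw [show hankel n m' i j = m' (i + j) from rfl]
  field_simp

/-- Monic polynomials, one of each degree, form a triangular basis: subtracting a multiple of `p k`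
lowers the degree of `q`. -/
lemma map_mul_eq_zero_of_monic_family {L : ℂ[X] →ₗ[ℂ] ℂ} {p : ℕ → ℂ[X]} {r : ℂ[X]}
    (hp : ∀ i < n, (p i).Monic ∧ (p i).natDegree = i) (h0 : ∀ i < n, L (r * p i) = 0)
    {k : ℕ} (hk : k ≤ n) : ∀ q : ℂ[X], q.degree < k → L (r * q) = 0 := by
  induction k with
  | zero =>
    intro q hq
    have hq0 : q = 0 := degree_eq_bot.1 (Nat.WithBot.lt_zero_iff.1 (by simpa using hq))
    rw [hq0, mul_zero, map_zero]
  | succ k ih =>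
    intro q hq
    obtain ⟨h1, h2⟩ := hp k hk
    have h3 : (q - C (q.coeff k) * p k).degree < k := by
      rw [degree_lt_iff_coeff_zero]
      intro i hi
      rw [coeff_sub, coeff_C_mul]
      rcases hi.eq_or_lt with rfl | hi
      · rw [coeff_eq_one_of_monic h1 h2, mul_one, sub_self]
      · rw [coeff_eq_zero_of_degree_lt (hq.trans_le (by exact_mod_cast hi)),
          coeff_eq_zero_of_natDegree_lt (h2.trans_lt hi), mul_zero, sub_zero]
    have h4 := ih (by omega) _ h3
    rw [mul_sub, map_sub, mul_left_comm, C_mul', map_smul, h0 k hk, smul_zero, sub_zero] at h4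
    exact h4

/-- The Christoffel-Darboux formula. -/
lemma christoffel_darboux (h : OrthogonalPair n m c P Q) (hn : 1 ≤ n) {p : ℕ → ℂ[X]} {η : ℕ → ℂ}
    (hp : ∀ i ≤ n, (p i).Monic ∧ (p i).natDegree = i)
    (ho : ∀ i ≤ n, ∀ k < n, momentFunctional m (p i * p k) = if i = k then η i else 0) :
    P = p n ∧ Q = C (c / η (n - 1)) * p (n - 1) ∧ ∀ x y, x ≠ y →
      (P.eval x * Q.eval y - Q.eval x * P.eval y) / (x - y) =
        c * ∑ i ∈ Finset.range n, (p i).eval x * (p i).eval y / η i := by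
  have hp' : ∀ i < n, (p i).Monic ∧ (p i).natDegree = i := fun i hi => hp i hi.le
  have hdeg : ∀ i ≤ n, (p i).degree = i := fun i hi => by
    rw [degree_eq_natDegree (hp i hi).1.ne_zero, (hp i hi).2]
  have hXk : ∀ k < n, ((X : ℂ[X]) ^ k).degree < n := fun k hk => by
    rw [degree_X_pow]; exact_mod_cast hk
  have zero_of : ∀ r : ℂ[X], r.degree < n → (∀ i < n, momentFunctional m (r * p i) = 0) → r = 0 :=
    fun r hr h0 => h.eq_zero hr fun k hk =>
      map_mul_eq_zero_of_monic_family hp' h0 le_rfl _ (hXk k hk)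
  -- If `η i` were zero, `p i` would be orthogonal to all polynomials of degree below `n`, against
  -- the nondegeneracy of the Hankel form.
  have hη : ∀ i < n, η i ≠ 0 := by
    intro i hi h0
    refine (hp i hi.le).1.ne_zero (zero_of _ (by rw [hdeg i hi.le]; exact_mod_cast hi) ?_)
    intro k hk
    rw [ho i hi.le k hk, h0, ite_self]
  have hpk : ∀ k < n, (p k).degree < n := fun k hk => by
    rw [hdeg k hk.le]; exact_mod_cast hk
  have hP : P = p n := by
    refine (sub_eq_zero.1 (zero_of (P - p n) ?_ fun k hk => ?_))
    · have := degree_sub_lt_left (p := P) (q := p n) (by rw [h.degree_left, hdeg n le_rfl])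
        h.monic.ne_zero (by rw [h.monic.leadingCoeff, (hp n le_rfl).1.leadingCoeff])
      rwa [h.degree_left] at this
    · rw [sub_mul, map_sub, h.left_mul (hpk k hk), ho n le_rfl k hk, if_neg (by omega), sub_zero]
  -- The factor is fixed by pairing with `p (n-1)`: `Q` gives `c` there and `p (n-1)` gives `η
  -- (n-1)`.
  have hQ : Q = C (c / η (n - 1)) * p (n - 1) := by
    refine sub_eq_zero.1 (zero_of _ ?_ fun k hk => ?_)
    · exact (degree_sub_le _ _).trans_lt (max_lt h.degree_lt
        ((degree_C_mul_le_degree _ _).trans_lt (hpk _ (by omega))))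
    · rw [sub_mul, map_sub, h.right_mul (hpk k hk), mul_assoc, momentFunctional_C_mul,
        ho _ (by omega) k hk]
      split_ifs with hk'
      · rw [coeff_eq_one_of_monic (hp k hk.le).1 ((hp k hk.le).2.trans hk'.symm),
        div_mul_cancel₀ _ (hη _ (by omega)), mul_one, sub_self]
      · rw [coeff_eq_zero_of_degree_lt (by rw [hdeg k hk.le]; exact_mod_cast (by omega))]
        simp
  refine ⟨hP, hQ, fun x y hxy => ?_⟩
  obtain ⟨K, hK, hKe, -, hL⟩ := h.exists_kernel x
  have hrep : ∀ k < n, momentFunctional m (K * p k) = c * (p k).eval x := by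
    intro k hk
    conv_lhs => rw [eq_sum_of_degree_lt (hpk k hk), Finset.mul_sum, map_sum]
    conv_rhs => rw [eq_sum_of_degree_lt (hpk k hk), eval_finsetSum, Finset.mul_sum]
    refine Finset.sum_congr rfl fun i _ => ?_
    rw [mul_left_comm, momentFunctional_C_mul, hL i i.2]
    simp only [eval_mul, eval_C, eval_pow, eval_X]
    ring
  -- The reproducing property `hrep` prescribes the Fourier coefficients of `K` in the orthogonal
  -- basis.
  have hKs : K = ∑ i ∈ Finset.range n, C (c * (p i).eval x / η i) * p i := by
    refine sub_eq_zero.1 (zero_of _ ?_ fun k hk => ?_)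
    · refine (degree_sub_le _ _).trans_lt (max_lt hK ?_)
      refine (degree_sum_le _ _).trans_lt ((Finset.sup_lt_iff (WithBot.bot_lt_coe n)).2 ?_)
      exact fun i hi => (degree_C_mul_le_degree _ _).trans_lt (hpk i (Finset.mem_range.1 hi))
    · rw [sub_mul, map_sub, hrep k hk, Finset.sum_mul, map_sum,
        Finset.sum_eq_single_of_mem k (Finset.mem_range.2 hk)]
      · rw [mul_assoc, momentFunctional_C_mul, ho k hk.le k hk, if_pos rfl,
          div_mul_cancel₀ _ (hη k hk), sub_self]
      · intro i hi hik
        rw [mul_assoc, momentFunctional_C_mul, ho i (Finset.mem_range.1 hi).le k hk, if_neg hik,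
          mul_zero]
  have h1 := congr_arg (eval y) hKe
  have h2 := congr_arg (eval y) hKs
  simp only [eval_mul, eval_sub, eval_X, eval_C, eval_finsetSum] at h1 h2
  have h3 : x - y ≠ 0 := sub_ne_zero.2 hxy
  have h4 : (P.eval x * Q.eval y - Q.eval x * P.eval y) / (x - y) = K.eval y := by
    rw [div_eq_iff h3]; linear_combination h1
  rw [h4, h2, Finset.mul_sum]
  exact Finset.sum_congr rfl fun i _ => by ring

end OrthogonalPair

/-! ### From Toeplitz determinants and arc integrals to Hankel moments. -/

/-- Reversing the rows, `i ↦ n - 1 - i`, turns the index `ℓ - i + j` into `ℓ - n + 1 + i + j`. -/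
lemma toeplitzDet_eq {ι : Type*} [Fintype ι] (γ : ι → ℝ → ℂ) (w : ι → ℂ → ℂ) (n : ℕ) (ℓ : ℤ) :
    toeplitzDet γ w n ℓ = (Equiv.Perm.sign (Fin.revPerm : Equiv.Perm (Fin n)) : ℂ) *
      (hankel n fun k => moment γ w (ℓ - n + 1 + k)).det := by
  rw [← Matrix.det_permute, toeplitzDet]
  congr 1
  ext i j
  simp only [Matrix.of_apply, Matrix.submatrix_apply, id, hankel, Fin.revPerm_apply, Fin.val_rev]
  congr 1
  have := i.2
  push_cast [Nat.cast_sub (show (i : ℕ) + 1 ≤ n by omega)]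
  ring

/-- The logarithmic derivative of the Toeplitz determinant. -/
lemma OrthogonalPair.logDeriv_toeplitzDet {ι : Type*} [Fintype ι] {γ : ℂ → ι → ℝ → ℂ}
    {w : ℂ → ι → ℂ → ℂ} {n : ℕ} {ℓ : ℤ} {c s₀ : ℂ} {P Q : ℂ[X]} {m' : ℕ → ℂ}
    (h : OrthogonalPair n (fun k => moment (γ s₀) (w s₀) (ℓ - n + 1 + k)) c P Q)
    (hm : ∀ k : ℕ, k + 1 < 2 * n →
      HasDerivAt (fun s => moment (γ s) (w s) (ℓ - n + 1 + k)) (m' k) s₀) :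
    toeplitzDet (γ s₀) (w s₀) n ℓ ≠ 0 ∧
    DifferentiableAt ℂ (fun s => toeplitzDet (γ s) (w s) n ℓ) s₀ ∧
    logDeriv (fun s => toeplitzDet (γ s) (w s) n ℓ) s₀ =
      momentFunctional m' (cdPoly P Q) / c := by
  have h1 := (OrthogonalPair.hasDerivAt_det (μ := fun s k => moment (γ s) (w s) (ℓ - n + 1 + k))
    h hm).const_mul (Equiv.Perm.sign (Fin.revPerm : Equiv.Perm (Fin n)) : ℂ)
  simp only [← mul_assoc, ← toeplitzDet_eq] at h1
  have h2 : toeplitzDet (γ s₀) (w s₀) n ℓ ≠ 0 := by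
    rw [toeplitzDet_eq]
    exact mul_ne_zero (by simp) h.det_hankel_ne_zero
  refine ⟨h2, h1.differentiableAt, ?_⟩
  rw [logDeriv_apply, h1.deriv, mul_div_cancel_left₀ _ h2]

lemma degree_mul_lt_two_mul {A B : ℂ[X]} {n : ℕ} (hA : A.degree ≤ n) (hB : B.degree < n) :
    (A * B).degree < (2 * n : ℕ) := by
  by_cases h0 : A * B = 0
  · rw [h0, degree_zero]; exact WithBot.bot_lt_coe _
  obtain ⟨hA0, hB0⟩ := mul_ne_zero_iff.1 h0
  rw [degree_eq_natDegree hA0] at hA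
  rw [degree_eq_natDegree hB0] at hB
  rw [degree_eq_natDegree h0, natDegree_mul hA0 hB0]
  have hA' : A.natDegree ≤ n := by exact_mod_cast hA
  have hB' : B.natDegree < n := by exact_mod_cast hB
  exact_mod_cast (show A.natDegree + B.natDegree < 2 * n by omega)

lemma OrthogonalPair.degree_cdPoly {n : ℕ} {P Q : ℂ[X]} (hP : P.degree = n) (hQ : Q.degree < n) :
    (cdPoly P Q).degree < (2 * n : ℕ) := by
  have hP0 : P ≠ 0 := by rintro rfl; simp at hP
  refine (degree_sub_le _ _).trans_lt (max_lt ?_ ?_)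
  · exact degree_mul_lt_two_mul hQ.le (hP ▸ degree_derivative_lt hP0)
  · exact degree_mul_lt_two_mul hP.le ((degree_derivative_le).trans_lt hQ)

namespace ContourSystem
variable {ι : Type*} {C : ContourSystem ι}

lemma ae_path_ne_zero (C : ContourSystem ι) (j : ι) :
    ∀ᵐ t ∂(volume.restrict (Ioo (0 : ℝ) 1)), C.path j t ≠ 0 := by
  filter_upwards [C.ae_not_node j] with t ht
  exact IsSolution.path_ne_zero ht

/-- With `x^(ℓ-n+1)` pulled out, Laurent moments become moments of ordinary polynomials, and degrees
below `2n` exhaust `momentRange n ℓ`; the top exponent is needed for `P * X^(n-1)`. The power law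
fails at the origin, which an arc meets only on a null set of parameters. -/
lemma arcIntegral_eval (j : ι) {n : ℕ} {ℓ : ℤ} {v : ℂ → ℂ} {q : ℂ[X]}
    (hv : ∀ k ∈ momentRange n ℓ, ArcIntegrable (C.path j) fun x => x ^ k * v x)
    (hq : q.degree < (2 * n : ℕ)) :
    ArcIntegrable (C.path j) (fun x => x ^ (ℓ - n + 1) * q.eval x * v x) ∧
    arcIntegral (C.path j) (fun x => x ^ (ℓ - n + 1) * q.eval x * v x) =
      ∑ i : Fin (2 * n), q.coeff i * arcIntegral (C.path j) fun x => x ^ (ℓ - n + 1 + i) * v x := by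
  have hi : ∀ i : Fin (2 * n), IntegrableOn (fun t => q.coeff i *
      (C.path j t ^ (ℓ - n + 1 + i) * v (C.path j t) * deriv (C.path j) t)) (Ioo 0 1) :=
    fun i => (hv _ ⟨by omega, by omega⟩).const_mul _
  have he : (fun t => C.path j t ^ (ℓ - n + 1) * q.eval (C.path j t) * v (C.path j t) *
      deriv (C.path j) t) =ᵐ[volume.restrict (Ioo 0 1)] fun t => ∑ i : Fin (2 * n), q.coeff i *
      (C.path j t ^ (ℓ - n + 1 + i) * v (C.path j t) * deriv (C.path j) t) := by
    filter_upwards [C.ae_path_ne_zero j] with t ht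
    have hq' : q.eval (C.path j t) = ∑ i : Fin (2 * n), q.coeff i * C.path j t ^ (i : ℕ) := by
      conv_lhs => rw [eq_sum_of_degree_lt hq]
      simp [eval_finsetSum]
    rw [hq', Finset.mul_sum, Finset.sum_mul, Finset.sum_mul]
    refine Finset.sum_congr rfl fun i _ => ?_
    rw [zpow_add₀ ht (ℓ - n + 1) i, zpow_natCast]; ring
  constructor
  · exact (integrable_congr he).2 (integrable_finsetSum _ fun i _ => hi i)
  · rw [arcIntegral, integral_congr_ae he, integral_finsetSum _ fun i _ => hi i]
    exact Finset.sum_congr rfl fun i _ => integral_const_mul _ _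

lemma momentFunctional_moment [Fintype ι] {n : ℕ} {ℓ : ℤ} {v : ι → ℂ → ℂ} {q : ℂ[X]}
    (hv : ∀ j, ∀ k ∈ momentRange n ℓ, ArcIntegrable (C.path j) fun x => x ^ k * v j x)
    (hq : q.degree < (2 * n : ℕ)) :
    momentFunctional (fun k => moment C.path v (ℓ - n + 1 + k)) q =
      ∑ j, arcIntegral (C.path j) fun x => x ^ (ℓ - n + 1) * q.eval x * v j x := by
  rw [momentFunctional_eq_sum _ hq, Finset.sum_congr rfl fun j _ => (arcIntegral_eval j (hv j) hq).2,
    Finset.sum_comm]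
  exact Finset.sum_congr rfl fun i _ => Finset.mul_sum _ _ _

end ContourSystem

/-! ### Orthogonality from the Riemann-Hilbert problem. -/

lemma PlusSide.sign_mul_self (σ : PlusSide) : σ.sign * σ.sign = 1 := by
  cases σ <;> simp [PlusSide.sign]

lemma PlusSide.sign_ne_zero (σ : PlusSide) : σ.sign ≠ 0 := by
  cases σ <;> simp [PlusSide.sign]

instance PlusSide.neBot_minusFilter (σ : PlusSide) : σ.minusFilter.NeBot := by
  cases σ
  · exact inferInstanceAs (𝓝[<] (0 : ℝ)).NeBot
  · exact inferInstanceAs (𝓝[>] (0 : ℝ)).NeBot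

lemma PlusSide.minusFilter_le (σ : PlusSide) : σ.minusFilter ≤ 𝓝[≠] 0 := by
  cases σ
  · exact nhdsWithin_mono _ fun x hx => ne_of_lt hx
  · exact nhdsWithin_mono _ fun x hx => ne_of_gt hx

namespace IsSolution
variable {ι : Type*} {σ : PlusSide} {C : ContourSystem ι} {n : ℕ} {ℓ : ℤ}
  {w : ι → ℂ → ℂ} {Γ : ℂ → Matrix (Fin 2) (Fin 2) ℂ}

lemma tendsto_collar_minus {j : ι} {t : ℝ} (ht : t ∈ Ioo (0 : ℝ) 1) (σ : PlusSide) :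
    Tendsto (collar (C.path j)) (𝓝 t ×ˢ σ.minusFilter) (𝓝 (C.path j t)) :=
  (tendsto_collar (C.contDiffAt_path j ht) (C.regular j t ht) {0}ᶜ).mono_left
    (prod_mono le_rfl σ.minusFilter_le)

lemma eventually_collar_mem [Finite ι] {j : ι} {t : ℝ} (ht : t ∈ Ioo (0 : ℝ) 1)
    (hn : C.path j t ∉ C.nodes) (σ : PlusSide) :
    ∀ᶠ p in 𝓝 t ×ˢ σ.minusFilter, collar (C.path j) p ∈ C.domain := by
  have : ∀ᶠ p in 𝓝 t ×ˢ 𝓝[≠] (0 : ℝ), collar (C.path j) p ∈ C.domain := by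
    rw [eventually_prod_nhdsWithin]
    filter_upwards [C.eventually_collar_nhds ht hn] with p hp hp2
    exact hp.1 hp2
  exact this.filter_mono (prod_mono le_rfl σ.minusFilter_le)

variable [Fintype ι]

/-- Orthogonality of a row of the solution. -/
lemma integral_row (h : IsSolution σ C n ℓ w Γ)
    (hw : ∀ j, ∀ k ∈ momentRange n ℓ, ArcIntegrable (C.path j) fun x => x ^ k * w j x)
    {i : Fin 2} {q : ℂ[X]} (hq : q.degree ≤ n) (hqΓ : ∀ z ∈ C.domain, Γ z i 0 = q.eval z) {k : ℕ}
    (hk : k < n) :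
    momentFunctional (fun k => moment C.path w (ℓ - n + 1 + k)) (q * X ^ k) =
      2 * Real.pi * Complex.I * σ.sign * if i = 1 ∧ k + 1 = n then 1 else 0 := by
  have hdeg : (q * X ^ k).degree < ((2 * n : ℕ) : WithBot ℕ) :=
    degree_mul_lt_two_mul hq (by rw [degree_X_pow]; exact_mod_cast hk)
  rw [ContourSystem.momentFunctional_moment hw hdeg]
  set d : ℂ := if i = 1 ∧ k + 1 = n then 1 else 0 with hd
  have hd1 : i = 1 ∧ k + 1 = n → d = 1 := fun h => if_pos h
  have hd0 : ¬(i = 1 ∧ k + 1 = n) → d = 0 := fun h => if_neg h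
  -- The exponent suits all three conditions: the jump becomes the integrand of the moment, the node
  -- condition becomes `o(1/|z - a|)`, and at infinity `F` is `z^(k-n)` times `δ + O(1/z)`, with `δ
  -- = 1` in the second row and `0` in the first. The residue `d` is thus nonzero only in the second
  -- row and for `k = n - 1`.
  set F : ℂ → ℂ := fun z => z ^ k * (z ^ (ℓ + 1 - n) * Γ z i 1) with hF
  have hex : ∀ j t, ∃ l r : ℂ, t ∈ Ioo (0 : ℝ) 1 → C.path j t ∉ C.nodes →
      Tendsto (fun p => F (collar (C.path j) p)) (𝓝 t ×ˢ 𝓝[>] 0) (𝓝 l) ∧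
      Tendsto (fun p => F (collar (C.path j) p)) (𝓝 t ×ˢ 𝓝[<] 0) (𝓝 r) ∧
      l - r = -σ.sign * (C.path j t ^ (ℓ - n + 1) * (q * X ^ k).eval (C.path j t) *
        w j (C.path j t)) := by
    intro j t
    by_cases hcond : t ∈ Ioo (0 : ℝ) 1 ∧ C.path j t ∉ C.nodes
    swap
    · exact ⟨0, 0, fun h1 h2 => absurd ⟨h1, h2⟩ hcond⟩
    obtain ⟨ht, hn⟩ := hcond
    obtain ⟨A, N, hA, hN, e⟩ := h.jump j t ht hn
    have hNi : N i 0 = q.eval (C.path j t) := by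
      refine tendsto_nhds_unique (tendsto_entry hN i 0)
        ((q.continuous.tendsto _ |>.comp (tendsto_collar_minus ht σ)).congr' ?_)
      filter_upwards [eventually_collar_mem ht hn σ] with p hp
      exact (hqΓ _ hp).symm
    have hAi : A i 1 - N i 1 = q.eval (C.path j t) * w j (C.path j t) := by
      rw [e, ← hNi]; simp [Matrix.mul_apply, jumpMatrix]
    have hk : ∀ s : Set ℝ, Tendsto (fun p => collar (C.path j) p ^ k) (𝓝 t ×ˢ 𝓝[s] 0)
        (𝓝 (C.path j t ^ k)) := fun s => by
      simpa using tendsto_collar_zpow ht hn s k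
    have hlim : ∀ (s : Set ℝ) (a : ℂ), Tendsto (fun p => Γ (collar (C.path j) p) i 1)
        (𝓝 t ×ˢ 𝓝[s] 0) (𝓝 a) → Tendsto (fun p => F (collar (C.path j) p)) (𝓝 t ×ˢ 𝓝[s] 0)
        (𝓝 (C.path j t ^ k * (C.path j t ^ (ℓ + 1 - n) * a))) := fun s a ha =>
      (hk s).mul ((tendsto_collar_zpow ht hn s _).mul ha)
    -- Left minus right is plus minus minus if `+` is the left side, and its negative otherwise:
    -- this is the factor `-σ.sign`.
    rcases σ.exists_filters (tendsto_entry hA i 1) (tendsto_entry hN i 1) with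
      ⟨rfl, h1, h2⟩ | ⟨rfl, h1, h2⟩
    · refine ⟨_, _, fun _ _ => ⟨hlim _ _ h1, hlim _ _ h2, ?_⟩⟩
      rw [eval_mul, eval_pow, eval_X, PlusSide.sign, show ℓ - n + 1 = ℓ + 1 - (n : ℤ) by ring]
      linear_combination (C.path j t ^ k * C.path j t ^ (ℓ + 1 - (n : ℤ))) * hAi
    · refine ⟨_, _, fun _ _ => ⟨hlim _ _ h1, hlim _ _ h2, ?_⟩⟩
      rw [eval_mul, eval_pow, eval_X, PlusSide.sign, show ℓ - n + 1 = ℓ + 1 - (n : ℤ) by ring]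
      linear_combination -(C.path j t ^ k * C.path j t ^ (ℓ + 1 - (n : ℤ))) * hAi
  choose L R hLR using hex
  have hpow : DifferentiableOn ℂ (fun z : ℂ => z ^ (ℓ + 1 - n)) C.domain := fun z hz =>
    (differentiableAt_zpow.2 (Or.inl (C.ne_zero_of_mem hz))).differentiableWithinAt
  have hS : C.Sides F L R :=
    { holo := (differentiable_pow k).differentiableOn.mul (hpow.mul (h.holo i 1))
      left := fun j t ht hn => (hLR j t ht hn).1
      right := fun j t ht hn => (hLR j t ht hn).2.1 }
  have hLRe : ∀ j, (fun t => (L j t - R j t) * deriv (C.path j) t)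
      =ᵐ[volume.restrict (Ioo (0 : ℝ) 1)] fun t => -σ.sign * (C.path j t ^ (ℓ - n + 1) *
        (q * X ^ k).eval (C.path j t) * w j (C.path j t) * deriv (C.path j) t) := by
    intro j
    filter_upwards [C.ae_not_node j, ae_restrict_mem measurableSet_Ioo] with t hn ht
    rw [(hLR j t ht hn).2.2]; ring
  have key := hS.total_jump (d := d) (fun j => ?_) (fun a ha => ?_) ?_
  · simp only [integral_congr_ae (hLRe _), integral_const_mul, ← Finset.mul_sum] at key
    simp only [arcIntegral]
    linear_combination (-σ.sign) * key - (∑ j, ∫ t in Ioo (0 : ℝ) 1, C.path j t ^ (ℓ - n + 1) *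
        (q * X ^ k).eval (C.path j t) * w j (C.path j t) * deriv (C.path j) t) * σ.sign_mul_self
  · exact (integrable_congr (hLRe j)).2
      ((ContourSystem.arcIntegral_eval j (hw j) hdeg).1.const_mul _)
  · have h1 : (fun z : ℂ => z ^ k) =O[𝓝[C.domain] a] fun _ => (1 : ℂ) :=
      (((continuous_pow k).continuousAt (x := a)).norm.isBoundedUnder_le.isBigO_one ℂ).mono
        nhdsWithin_le_nhds
    simpa using h1.mul_isLittleO (h.node_snd ha i)
  · have h1 : (fun z : ℂ => z ^ ((k : ℤ) - n) * (z ^ (ℓ + 1) * Γ z i 1 - if i = 1 then 1 else 0))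
        =O[cobounded ℂ ⊓ 𝓟 C.domain] fun z => z ^ (-2 : ℤ) := by
      refine ((zpow_isBigO_zpow inf_le_left (show (k : ℤ) - n ≤ -1 by omega)).mul
        (h.infinity_snd i)).congr' EventuallyEq.rfl ?_
      filter_upwards [eventually_ne_zero] with z hz
      rw [← zpow_neg_one, ← zpow_add₀ hz]; norm_num
    have h2 : (fun z : ℂ => z ^ ((k : ℤ) - n) * (if i = 1 then 1 else 0) - d / z)
        =O[cobounded ℂ ⊓ 𝓟 C.domain] fun z => z ^ (-2 : ℤ) := by
      by_cases hi : i = 1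
      · by_cases hkn : k + 1 = n
        · refine (isBigO_zero _ _).congr' ?_ EventuallyEq.rfl
          filter_upwards [eventually_ne_zero] with z hz
          rw [hd1 ⟨hi, hkn⟩, if_pos hi, show (k : ℤ) - n = -1 by omega, zpow_neg_one]
          ring
        · rw [hd0 fun h => hkn h.2]
          have := zpow_isBigO_zpow (inf_le_left : cobounded ℂ ⊓ 𝓟 C.domain ≤ _)
            (show (k : ℤ) - n ≤ -2 by omega)
          simpa [hi] using this
      · rw [hd0 fun h => hi h.1]
        simpa [hi] using isBigO_zero _ _
    refine (h1.add h2).congr' ?_ EventuallyEq.rfl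
    filter_upwards [eventually_ne_zero] with z hz
    rw [hF]
    have e : z ^ ((k : ℤ) - n) * z ^ (ℓ + 1) = z ^ k * z ^ (ℓ + 1 - n) := by
      rw [← zpow_natCast, ← zpow_add₀ hz, ← zpow_add₀ hz]; congr 1; ring
    linear_combination (Γ z i 1) * e

/-- The first column of the solution consists of orthogonal polynomials. -/
lemma exists_orthogonalPair (h : IsSolution σ C n ℓ w Γ)
    (hw : ∀ j, ∀ k ∈ momentRange n ℓ, ArcIntegrable (C.path j) fun x => x ^ k * w j x) :
    ∃ P Q : ℂ[X], OrthogonalPair n (fun k => moment C.path w (ℓ - n + 1 + k))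
      (2 * Real.pi * Complex.I * σ.sign) P Q ∧
      ∀ z ∈ C.domain, Γ z 0 0 = P.eval z ∧ Γ z 1 0 = Q.eval z := by
  obtain ⟨P, Q, hP, hPn, hQ, hPQ⟩ := h.exists_polynomial_fst
  refine ⟨P, Q, ⟨?_, hP, hPn, hQ, fun k hk => ?_, fun k hk => ?_⟩, hPQ⟩
  · exact mul_ne_zero Complex.two_pi_I_ne_zero σ.sign_ne_zero
  · rw [h.integral_row hw (i := 0) (degree_le_of_natDegree_le hPn.le) (fun z hz => (hPQ z hz).1) hk]
    simp
  · rw [h.integral_row hw (i := 1) hQ.le (fun z hz => (hPQ z hz).2) hk]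
    simp

end IsSolution

/-! ### Malgrange's integrand and the Christoffel-Darboux kernel. -/

lemma jumpMatrix_det (a : ℂ) : (jumpMatrix a).det = 1 := by
  simp [jumpMatrix, Matrix.det_fin_two]

/-- The variation of a unipotent matrix is strictly upper triangular and is not affected by the
factor `M⁻¹`. -/
lemma jumpVariation_eq {κ : Type*} {M : ℂ → κ → ℂ → Matrix (Fin 2) (Fin 2) ℂ} {f : ℂ → ℂ}
    {s₀ : ℂ} {j : κ} {z : ℂ} (hM : ∀ᶠ s in 𝓝 s₀, M s j z = jumpMatrix (f s)) :
    jumpVariation M s₀ j z = !![0, deriv f s₀; 0, 0] := by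
  have h0 := hM.self_of_nhds
  have hd : ∀ a b, deriv (fun s => M s j z a b) s₀ = deriv (fun s => jumpMatrix (f s) a b) s₀ :=
    fun a b => EventuallyEq.deriv_eq (hM.mono fun s hs => by simp only [hs])
  have hinv : (jumpMatrix (f s₀))⁻¹ = jumpMatrix (-f s₀) := by
    apply Matrix.inv_eq_right_inv
    ext a b; fin_cases a <;> fin_cases b <;> simp [jumpMatrix, Matrix.mul_apply]
  rw [jumpVariation, h0, hinv]
  ext a b
  simp only [Matrix.mul_apply, Matrix.of_apply, hd]
  fin_cases a <;> fin_cases b <;> simp [jumpMatrix]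

/-- A strictly upper triangular variation tests only the first columns; the second column enters
through the determinant alone. -/
lemma trace_inv_mul_mul_upper (N D : Matrix (Fin 2) (Fin 2) ℂ) (a : ℂ) :
    (N⁻¹ * D * !![0, a; 0, 0]).trace = (N.det)⁻¹ * (N 0 0 * D 1 0 - N 1 0 * D 0 0) * a := by
  rw [Matrix.inv_def, Ring.inverse_eq_inv', Matrix.adjugate_fin_two]
  rw [Matrix.trace_fin_two]
  simp only [Matrix.mul_apply, Fin.sum_univ_two, Matrix.smul_apply]
  simp [-mul_eq_mul_right_iff]
  ring

lemma minusValue_apply {σ : PlusSide} {γ : ℝ → ℂ} {G : ℂ → Matrix (Fin 2) (Fin 2) ℂ} {t : ℝ}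
    {i k : Fin 2} {a : ℂ}
    (h : Tendsto (fun p => G (collar γ p) i k) (𝓝 t ×ˢ σ.minusFilter) (𝓝 a)) :
    minusValue σ γ G t i k = a :=
  h.limUnder_eq

namespace IsSolution
variable {ι : Type*} [Fintype ι] {σ : PlusSide} {C : ContourSystem ι} {n : ℕ} {ℓ : ℤ}
  {w : ι → ℂ → ℂ} {Γ : ℂ → Matrix (Fin 2) (Fin 2) ℂ} {P Q : ℂ[X]}

/-- The trace in Malgrange's form, for a matrix function `G` with the same first column and the same
determinant as the solution. -/
lemma malgrange_trace (h : IsSolution σ C n ℓ w Γ)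
    (hΓ : ∀ z ∈ C.domain, Γ z 0 0 = P.eval z ∧ Γ z 1 0 = Q.eval z)
    {G : ℂ → Matrix (Fin 2) (Fin 2) ℂ} (hG : ∀ z i, G z i 0 = Γ z i 0)
    (hGdet : ∀ z, (G z).det = (Γ z).det) {γ : ℝ → ℂ} {t : ℝ}
    (hc : Tendsto (collar γ) (𝓝 t ×ˢ σ.minusFilter) (𝓝 (γ t)))
    (hd : ∀ᶠ p in 𝓝 t ×ˢ σ.minusFilter, collar γ p ∈ C.domain) (hx : γ t ≠ 0)
    {N : Matrix (Fin 2) (Fin 2) ℂ}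
    (hN : Tendsto (fun p => G (collar γ p)) (𝓝 t ×ˢ σ.minusFilter) (𝓝 N)) (a : ℂ) :
    ((minusValue σ γ G t)⁻¹ * minusValue σ γ (matDeriv G) t * !![0, a; 0, 0]).trace =
      -(γ t ^ (ℓ - n + 1) * (cdPoly P Q).eval (γ t) * a) := by
  have hlim : ∀ q : ℂ[X], Tendsto (fun p => q.eval (collar γ p)) (𝓝 t ×ˢ σ.minusFilter)
      (𝓝 (q.eval (γ t))) := fun q => (q.continuous.tendsto _).comp hc
  have hMN : minusValue σ γ G t = N := by
    ext i k; exact minusValue_apply (tendsto_entry hN i k)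
  have hval : ∀ (i : Fin 2) (q : ℂ[X]), (∀ z ∈ C.domain, Γ z i 0 = q.eval z) →
      N i 0 = q.eval (γ t) ∧ minusValue σ γ (matDeriv G) t i 0 = (derivative q).eval (γ t) := by
    intro i q hq
    constructor
    · refine tendsto_nhds_unique (tendsto_entry hN i 0) ((hlim q).congr' ?_)
      filter_upwards [hd] with p hp
      rw [hG, hq _ hp]
    · refine minusValue_apply ((hlim (derivative q)).congr' ?_)
      filter_upwards [hd] with p hp
      rw [matDeriv, Matrix.of_apply]
      have : (fun y => G y i 0) =ᶠ[𝓝 (collar γ p)] fun y => q.eval y := by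
        filter_upwards [C.isOpen_domain.mem_nhds hp] with y hy
        rw [hG, hq _ hy]
      rw [this.deriv_eq, Polynomial.deriv]
  obtain ⟨n0, d0⟩ := hval 0 P fun z hz => (hΓ z hz).1
  obtain ⟨n1, d1⟩ := hval 1 Q fun z hz => (hΓ z hz).2
  have hdet : N.det = γ t ^ ((n : ℤ) - ℓ - 1) := by
    refine tendsto_nhds_unique (((continuous_id.matrix_det).tendsto N).comp hN)
      ((((continuousAt_zpow₀ _ _ (Or.inl hx)).tendsto).comp hc).congr' ?_)
    filter_upwards [hd] with p hp
    simp [hGdet, h.det_eq hp]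
  rw [hMN, trace_inv_mul_mul_upper, n0, n1, d0, d1, hdet, ← zpow_neg,
    show -((n : ℤ) - ℓ - 1) = ℓ - n + 1 by ring]
  simp only [cdPoly, eval_sub, eval_mul]
  ring

/-- The value of the Christoffel-Darboux kernel off the contours. -/
lemma cdKernel_eq (h : IsSolution σ C n ℓ w Γ)
    (hΓ : ∀ z ∈ C.domain, Γ z 0 0 = P.eval z ∧ Γ z 1 0 = Q.eval z) {x y : ℂ}
    (hx : x ∈ C.domain) (hy : y ∈ C.domain) :
    cdKernel Γ x y = x ^ (ℓ - n + 1) * ((P.eval x * Q.eval y - Q.eval x * P.eval y) / (x - y)) := by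
  rw [cdKernel, Matrix.inv_def, Ring.inverse_eq_inv', Matrix.adjugate_fin_two, h.det_eq hx,
    ← zpow_neg, show -((n : ℤ) - ℓ - 1) = ℓ - n + 1 by ring, ← (hΓ x hx).1, ← (hΓ x hx).2,
    ← (hΓ y hy).1, ← (hΓ y hy).2]
  simp [Matrix.mul_apply, Fin.sum_univ_two]
  ring

end IsSolution

/-- The limit that defines `cdDiag` can be identified only if pairs of distinct points off the
contours accumulate at `(x, x)`; they do, as the domain is open and dense. -/
instance ContourSystem.neBot_diagFilter {ι : Type*} [Finite ι] (C : ContourSystem ι) (x : ℂ) :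
    (diagFilter C x).NeBot := by
  change ClusterPt (x, x) (𝓟 _)
  rw [← mem_closure_iff_clusterPt, Metric.mem_closure_iff]
  intro ε hε
  obtain ⟨u, hu, hxu⟩ := Metric.mem_closure_iff.1 (C.dense_domain x) ε hε
  have h0 : ∀ᶠ v in 𝓝 u, v ∈ C.domain := C.isOpen_domain.mem_nhds hu
  have h1 : ∀ᶠ v in 𝓝 u, v ∈ C.domain ∧ dist x v < ε :=
    h0.and
      ((continuous_const.dist continuous_id).continuousAt.eventually (gt_mem_nhds hxu))
  obtain ⟨v, ⟨hv, hxv⟩, hne⟩ := ((h1.filter_mono nhdsWithin_le_nhds).and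
    (self_mem_nhdsWithin : {u}ᶜ ∈ 𝓝[≠] u)).exists
  exact ⟨(u, v), ⟨hu, hv, fun e => hne e.symm⟩, by rw [Prod.dist_eq]; exact max_lt hxu hxv⟩

/-- The numerator is `Q(x)(P(x) - P(y)) - P(x)(Q(x) - Q(y))`; since both points vary, strict
differentiability is needed. -/
lemma tendsto_wronskian (P Q : ℂ[X]) (x : ℂ) :
    Tendsto (fun p : ℂ × ℂ => (P.eval p.1 * Q.eval p.2 - Q.eval p.1 * P.eval p.2) / (p.1 - p.2))
      (𝓝 (x, x) ⊓ 𝓟 {p | p.1 ≠ p.2}) (𝓝 ((cdPoly P Q).eval x)) := by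
  have hd : ∀ q : ℂ[X], Tendsto (fun p : ℂ × ℂ => (q.eval p.1 - q.eval p.2) / (p.1 - p.2))
      (𝓝 (x, x) ⊓ 𝓟 {p | p.1 ≠ p.2}) (𝓝 ((derivative q).eval x)) := by
    intro q
    have h1 := ((q.hasStrictDerivAt x).hasStrictFDerivAt.isLittleO).tendsto_div_nhds_zero.mono_left
      (inf_le_left (b := 𝓟 {p : ℂ × ℂ | p.1 ≠ p.2}))
    have h2 := h1.add_const ((derivative q).eval x)
    rw [zero_add] at h2
    refine h2.congr' ?_
    filter_upwards [mem_inf_of_right (mem_principal_self _)] with p hp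
    have : p.1 - p.2 ≠ 0 := sub_ne_zero.2 hp
    simp
    field_simp
    ring
  have hl : ∀ q : ℂ[X], Tendsto (fun p : ℂ × ℂ => q.eval p.1)
      (𝓝 (x, x) ⊓ 𝓟 {p | p.1 ≠ p.2}) (𝓝 (q.eval x)) := fun q =>
    ((q.continuous.comp continuous_fst).tendsto (x, x)).mono_left inf_le_left
  have := ((hl Q).mul (hd P)).sub ((hl P).mul (hd Q))
  rw [cdPoly, eval_sub, eval_mul, eval_mul]
  refine this.congr fun p => ?_
  ring

lemma IsSolution.tendsto_cdKernel {ι : Type*} [Fintype ι] {σ : PlusSide} {C : ContourSystem ι}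
    {n : ℕ} {ℓ : ℤ} {w : ι → ℂ → ℂ} {Γ : ℂ → Matrix (Fin 2) (Fin 2) ℂ} {P Q : ℂ[X]}
    (h : IsSolution σ C n ℓ w Γ)
    (hΓ : ∀ z ∈ C.domain, Γ z 0 0 = P.eval z ∧ Γ z 1 0 = Q.eval z) {x : ℂ} (hx : x ≠ 0) :
    Tendsto (fun p => cdKernel Γ p.1 p.2) (diagFilter C x)
      (𝓝 (x ^ (ℓ - n + 1) * (cdPoly P Q).eval x)) := by
  have h1 : Tendsto (fun p : ℂ × ℂ => p.1 ^ (ℓ - n + 1)) (diagFilter C x)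
      (𝓝 (x ^ (ℓ - n + 1))) :=
    ((continuousAt_zpow₀ x _ (Or.inl hx)).tendsto.comp
      (continuous_fst.tendsto (x, x))).mono_left inf_le_left
  have h2 := (tendsto_wronskian P Q x).mono_left (show diagFilter C x ≤ _ from
    inf_le_inf_left _ (principal_mono.2 fun p hp => hp.2.2))
  refine (h1.mul h2).congr' ?_
  filter_upwards [mem_inf_of_right (mem_principal_self _)] with p hp
  rw [h.cdKernel_eq hΓ hp.1 hp.2.1]

/-! ### Deformation of the weights and of the coefficients. -/

namespace WeightDeformation
variable {ι : Type*} {C : ContourSystem ι} {S : Set ℤ} {U : Set ℂ}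
  {w : ℂ → ι → ℂ → ℂ}

/-- Differentiation of the moments under the integral sign. -/
lemma hasDerivAt_arcIntegral (h : WeightDeformation C S U w) {s₀ : ℂ} (hs : s₀ ∈ U) (j : ι) {k : ℤ}
    (hk : k ∈ S) :
    ArcIntegrable (C.path j) (fun x => x ^ k * deriv (fun s => w s j x) s₀) ∧
    HasDerivAt (fun s => arcIntegral (C.path j) fun x => x ^ k * w s j x)
      (arcIntegral (C.path j) fun x => x ^ k * deriv (fun s => w s j x) s₀) s₀ := by
  obtain ⟨g, hg, hgb⟩ := h.dominated j k hk
  obtain ⟨ε, hε, hball⟩ := Metric.isOpen_iff.1 h.isOpen s₀ hs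
  -- Disks of radius `ε/4` around these `s` stay in `U`, so Cauchy's estimate turns the bound `g`
  -- for the weights into `g/(ε/4)` for their derivatives.
  have hsub : ∀ s ∈ Metric.ball s₀ (ε / 2), Metric.closedBall s (ε / 4) ⊆ U := by
    intro s hs' y hy
    apply hball
    rw [Metric.mem_ball] at hs' ⊢
    rw [Metric.mem_closedBall] at hy
    linarith [dist_triangle y s s₀]
  have hdiff : ∀ᵐ t ∂(volume.restrict (Ioo (0 : ℝ) 1)), ∀ s ∈ Metric.ball s₀ (ε / 2),
      HasDerivAt (fun s => C.path j t ^ k * w s j (C.path j t) * deriv (C.path j) t)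
        (C.path j t ^ k * deriv (fun s => w s j (C.path j t)) s * deriv (C.path j) t) s := by
    filter_upwards [C.ae_not_node j, ae_restrict_mem measurableSet_Ioo] with t hn ht s hs'
    have hsU : s ∈ U := hsub s hs' (Metric.mem_closedBall_self (by positivity))
    exact ((((h.holo j t ht hn).differentiableAt (h.isOpen.mem_nhds hsU)).hasDerivAt).const_mul
      _).mul_const _
  have hmeas : ∀ s ∈ U, AEStronglyMeasurable
      (fun t => C.path j t ^ k * w s j (C.path j t) * deriv (C.path j) t)
      (volume.restrict (Ioo (0 : ℝ) 1)) := fun s hs =>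
    ((h.admissible s hs).moments j k hk).aestronglyMeasurable
  refine hasDerivAt_integral_of_dominated_loc_of_deriv_le (μ := volume.restrict (Ioo (0 : ℝ) 1))
    (F := fun s t => C.path j t ^ k * w s j (C.path j t) * deriv (C.path j) t)
    (F' := fun s t => C.path j t ^ k * deriv (fun s => w s j (C.path j t)) s * deriv (C.path j) t)
    (bound := fun t => g t / (ε / 4)) (s := Metric.ball s₀ (ε / 2))
    (Metric.ball_mem_nhds _ (by positivity)) ?_ ((h.admissible s₀ hs).moments j k hk) ?_ ?_
    (hg.div_const _) hdiff
  · filter_upwards [h.isOpen.mem_nhds hs] with s hs using hmeas s hs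
  -- The derivative is measurable in `t` as a limit of difference quotients along a sequence of
  -- increments.
  · have hu : Tendsto (fun m : ℕ => (ε / 4 / (m + 1) : ℝ)) atTop (𝓝 0) :=
      tendsto_const_nhds.div_atTop (tendsto_natCast_atTop_atTop.atTop_add tendsto_const_nhds)
    have hu' : Tendsto (fun m : ℕ => ((ε / 4 / (m + 1) : ℝ) : ℂ)) atTop (𝓝[≠] 0) := by
      refine tendsto_nhdsWithin_iff.2 ⟨(Complex.continuous_ofReal.tendsto' 0 0 rfl).comp hu,
        Eventually.of_forall fun m => ?_⟩
      have : (ε / 4 / (m + 1) : ℝ) ≠ 0 := by positivity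
      exact fun h => this (Complex.ofReal_eq_zero.1 h)
    refine aestronglyMeasurable_of_tendsto_ae atTop (f := fun (m : ℕ) t =>
      ((ε / 4 / (m + 1) : ℝ) : ℂ)⁻¹ • (C.path j t ^ k * w (s₀ + (ε / 4 / (m + 1) : ℝ)) j (C.path j t) *
        deriv (C.path j) t - C.path j t ^ k * w s₀ j (C.path j t) * deriv (C.path j) t))
      (fun m => ?_) ?_
    · refine ((hmeas (s₀ + (ε / 4 / (m + 1) : ℝ)) (hball ?_)).sub (hmeas s₀ hs)).const_smul
        ((ε / 4 / (m + 1) : ℝ) : ℂ)⁻¹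
      rw [Metric.mem_ball, dist_eq_norm, add_sub_cancel_left, Complex.norm_real,
        Real.norm_of_nonneg (by positivity)]
      have : ε / 4 / ((m : ℝ) + 1) ≤ ε / 4 := div_le_self (by positivity) (by simp)
      linarith
    · filter_upwards [hdiff] with t ht
      exact (hasDerivAt_iff_tendsto_slope_zero.1
        (ht s₀ (Metric.mem_ball_self (by positivity)))).comp hu'
  · filter_upwards [hdiff, C.ae_not_node j, ae_restrict_mem measurableSet_Ioo] with t hd hn ht s hs'
    rw [← (hd s hs').deriv]
    have hdU : DifferentiableOn ℂ
        (fun s => C.path j t ^ k * w s j (C.path j t) * deriv (C.path j) t) U :=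
      ((h.holo j t ht hn).const_mul _).mul_const _
    refine Complex.norm_deriv_le_of_forall_mem_sphere_norm_le (by positivity) ?_ fun y hy => ?_
    · exact (hdU.mono (hsub s hs')).diffContOnCl_ball subset_rfl
    · exact hgb y (hsub s hs' (Metric.sphere_subset_closedBall hy)) t ht hn

end WeightDeformation

namespace IsSolution
variable {ι : Type*} [Fintype ι] {σ : PlusSide} {C : ContourSystem ι} {n : ℕ} {ℓ : ℤ}
  {Γ : ℂ → Matrix (Fin 2) (Fin 2) ℂ}

/-- Deformation of the weights. -/
theorem logDeriv_weightDeformation {U : Set ℂ} {w : ℂ → ι → ℂ → ℂ}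
    (hw : WeightDeformation C (momentRange n ℓ) U w) {s₀ : ℂ} (hs : s₀ ∈ U)
    (h : IsSolution σ C n ℓ (w s₀) Γ) :
    toeplitzDet C.path (w s₀) n ℓ ≠ 0 ∧
    DifferentiableAt ℂ (fun s => toeplitzDet C.path (w s) n ℓ) s₀ ∧
    (∀ j, IntegrableOn (malgrangeIntegrand σ C.path Γ
      (fun s j z => jumpMatrix (w s j z)) s₀ j) (Ioo 0 1)) ∧
    logDeriv (fun s => toeplitzDet C.path (w s) n ℓ) s₀ =
      σ.sign * malgrangeForm σ C.path Γ (fun s j z => jumpMatrix (w s j z)) s₀ := by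
  obtain ⟨P, Q, hPQ, hΓ⟩ := h.exists_orthogonalPair (hw.admissible s₀ hs).moments
  set v : ι → ℂ → ℂ := fun j x => deriv (fun s => w s j x) s₀ with hv
  have hdv := fun j k hk => hw.hasDerivAt_arcIntegral hs j (k := k) hk
  have hdeg := OrthogonalPair.degree_cdPoly hPQ.degree_left hPQ.degree_lt
  obtain ⟨h1, h2, h3⟩ := OrthogonalPair.logDeriv_toeplitzDet (γ := fun _ => C.path) (w := w)
    (s₀ := s₀) (m' := fun k => moment C.path v (ℓ - n + 1 + k)) hPQ fun k hk =>
      HasDerivAt.fun_sum fun j _ => (hdv j _ ⟨by omega, by omega⟩).2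
  have hint := fun j => C.arcIntegral_eval j (fun k hk => (hdv j k hk).1) hdeg
  have hae : ∀ j, malgrangeIntegrand σ C.path Γ (fun s j z => jumpMatrix (w s j z)) s₀ j
      =ᵐ[volume.restrict (Ioo 0 1)] fun t => -(2 * Real.pi * Complex.I)⁻¹ *
        (C.path j t ^ (ℓ - n + 1) * (cdPoly P Q).eval (C.path j t) * v j (C.path j t) *
          deriv (C.path j) t) := by
    intro j
    filter_upwards [C.ae_not_node j, ae_restrict_mem measurableSet_Ioo] with t hn ht
    obtain ⟨A, N, hA, hN, e⟩ := h.jump j t ht hn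
    rw [malgrangeIntegrand, jumpVariation_eq (f := fun s => w s j (C.path j t))
      (Eventually.of_forall fun s => rfl), h.malgrange_trace hΓ (fun _ _ => rfl) (fun _ => rfl)
      (tendsto_collar_minus ht σ) (eventually_collar_mem ht hn σ) (path_ne_zero hn) hN]
    ring
  refine ⟨h1, h2, fun j => ?_, ?_⟩
  · exact (integrable_congr (hae j)).2 ((hint j).1.const_mul _)
  · rw [h3, ContourSystem.momentFunctional_moment (fun j k hk => (hdv j k hk).1) hdeg, malgrangeForm]
    simp only [integral_congr_ae (hae _), integral_const_mul, ← Finset.mul_sum, arcIntegral]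
    have := σ.sign_ne_zero
    have := Complex.two_pi_I_ne_zero
    -- The determinant side carries `1/(2πiε)` and the Malgrange side `ε/(2πi)`; they agree because
    -- `ε² = 1`.
    rw [div_eq_iff (mul_ne_zero Complex.two_pi_I_ne_zero σ.sign_ne_zero)]
    field_simp
    linear_combination (-(∑ j, ∫ t in Ioo (0 : ℝ) 1, C.path j t ^ (ℓ - n + 1) *
      (cdPoly P Q).eval (C.path j t) * v j (C.path j t) * deriv (C.path j) t)) * σ.sign_mul_self

/-- Derivatives in the coefficients of the contours. -/
theorem logDeriv_coefficient [DecidableEq ι] {ρ : ι → ℂ → ℂ} {κ : ι → ℂ} (j₀ : ι)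
    (hρ : AdmissibleWeight C (momentRange n ℓ) ρ)
    (h : IsSolution σ C n ℓ (fun j x => κ j * ρ j x) Γ) :
    toeplitzDet C.path (fun j x => κ j * ρ j x) n ℓ ≠ 0 ∧
    DifferentiableAt ℂ
      (fun c => toeplitzDet C.path (fun j x => Function.update κ j₀ c j * ρ j x) n ℓ) (κ j₀) ∧
    (∀ t ∈ Ioo (0 : ℝ) 1, C.path j₀ t ∉ C.nodes →
      Tendsto (fun p => cdKernel Γ p.1 p.2) (diagFilter C (C.path j₀ t))
        (𝓝 (cdDiag C Γ (C.path j₀ t)))) ∧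
    ArcIntegrable (C.path j₀) (fun x => cdDiag C Γ x * ρ j₀ x) ∧
    logDeriv (fun c => toeplitzDet C.path (fun j x => Function.update κ j₀ c j * ρ j x) n ℓ)
      (κ j₀) = σ.sign * (arcIntegral (C.path j₀) (fun x => cdDiag C Γ x * ρ j₀ x) /
        (2 * Real.pi * Complex.I)) := by
  have hmul : ∀ (a : ι → ℂ) j (k : ℤ), (fun t => C.path j t ^ k * (a j * ρ j (C.path j t)) *
      deriv (C.path j) t) = fun t => a j * (C.path j t ^ k * ρ j (C.path j t) *
      deriv (C.path j) t) := fun a j k => by ext t; ring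
  have hint : ∀ (a : ι → ℂ) j, ∀ k ∈ momentRange n ℓ,
      ArcIntegrable (C.path j) fun x => x ^ k * (a j * ρ j x) := fun a j k hk => by
    rw [ArcIntegrable, hmul]
    exact (hρ.moments j k hk).const_mul _
  have hmom : ∀ (a : ι → ℂ) k, moment C.path (fun j x => a j * ρ j x) k =
      ∑ j, a j * arcIntegral (C.path j) fun x => x ^ k * ρ j x := fun a k =>
    Finset.sum_congr rfl fun j _ => by
      simp only [arcIntegral, hmul, integral_const_mul]
  obtain ⟨P, Q, hPQ, hΓ⟩ := h.exists_orthogonalPair (hint κ)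
  -- The derivative of `Function.update κ j₀ c` in `c`: only the weight on the arc `j₀` varies.
  set e : ι → ℂ := fun j => if j = j₀ then 1 else 0 with he
  have hdeg := OrthogonalPair.degree_cdPoly hPQ.degree_left hPQ.degree_lt
  obtain ⟨h1, h2, h3⟩ := OrthogonalPair.logDeriv_toeplitzDet (γ := fun _ => C.path)
    (w := fun c j x => Function.update κ j₀ c j * ρ j x) (s₀ := κ j₀)
    (m' := fun k => moment C.path (fun j x => e j * ρ j x) (ℓ - n + 1 + k))
    (by simpa only [Function.update_eq_self] using hPQ) fun k hk => by
      simp only [hmom]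
      refine HasDerivAt.fun_sum fun j _ => ?_
      refine HasDerivAt.mul_const ?_ _
      by_cases hj : j = j₀
      · subst hj; simpa [he] using hasDerivAt_id' (κ j)
      · simpa [he, hj] using hasDerivAt_const (κ j₀) (κ j)
  simp only [Function.update_eq_self] at h1
  have hK : ∀ t, C.path j₀ t ∉ C.nodes → cdDiag C Γ (C.path j₀ t) =
      C.path j₀ t ^ (ℓ - n + 1) * (cdPoly P Q).eval (C.path j₀ t) := fun t hn =>
    (h.tendsto_cdKernel hΓ (path_ne_zero hn)).limUnder_eq
  obtain ⟨i1, i2⟩ := C.arcIntegral_eval j₀ (hρ.moments j₀) hdeg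
  have hae : (fun t => cdDiag C Γ (C.path j₀ t) * ρ j₀ (C.path j₀ t) * deriv (C.path j₀) t)
      =ᵐ[volume.restrict (Ioo 0 1)] fun t => C.path j₀ t ^ (ℓ - n + 1) *
        (cdPoly P Q).eval (C.path j₀ t) * ρ j₀ (C.path j₀ t) * deriv (C.path j₀) t := by
    filter_upwards [C.ae_not_node j₀] with t hn
    rw [hK t hn]
  refine ⟨h1, h2, fun t _ hn => ?_, (integrable_congr hae).2 i1, ?_⟩
  · rw [hK t hn]; exact h.tendsto_cdKernel hΓ (path_ne_zero hn)
  · rw [h3, ContourSystem.momentFunctional_moment (hint e) hdeg]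
    have e1 : (∑ j, arcIntegral (C.path j) fun x => x ^ (ℓ - n + 1) * (cdPoly P Q).eval x *
        (e j * ρ j x)) = arcIntegral (C.path j₀) fun x => cdDiag C Γ x * ρ j₀ x := by
      rw [Finset.sum_eq_single j₀]
      · simp only [he, if_true, one_mul]
        exact (integral_congr_ae hae).symm
      · intro j _ hj
        simp [he, hj, arcIntegral]
      · simp
    rw [e1, div_eq_iff (mul_ne_zero Complex.two_pi_I_ne_zero σ.sign_ne_zero)]
    have := Complex.two_pi_I_ne_zero
    field_simp
    linear_combination (-arcIntegral (C.path j₀) fun x => cdDiag C Γ x * ρ j₀ x) * σ.sign_mul_self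

/-- In the Hankel case the kernel is the Christoffel-Darboux kernel. -/
theorem cdKernel_eq_christoffel_darboux {w : ι → ℂ → ℂ} {p : ℕ → ℂ[X]} {η : ℕ → ℂ}
    (hw : AdmissibleWeight C (momentRange n ℓ) w) (h : IsSolution σ C n ℓ w Γ) (hn : 1 ≤ n)
    (hℓ : ℓ = (n : ℤ) - 1) (hp : ∀ i ≤ n, (p i).Monic ∧ (p i).natDegree = i)
    (ho : ∀ i ≤ n, ∀ k < n,
      ∑ j, arcIntegral (C.path j) (fun x => (p i).eval x * (p k).eval x * w j x) =
        if i = k then η i else 0) {x y : ℂ} (hx : x ∈ C.domain) (hy : y ∈ C.domain) (hxy : x ≠ y) :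
    cdKernel Γ x y = σ.sign * (2 * Real.pi * Complex.I) *
      (((p n).eval x * (p (n - 1)).eval y - (p (n - 1)).eval x * (p n).eval y) /
        (η (n - 1) * (x - y))) ∧
    cdKernel Γ x y = σ.sign * (2 * Real.pi * Complex.I) *
      ∑ i ∈ Finset.range n, (p i).eval x * (p i).eval y / η i := by
  obtain ⟨P, Q, hPQ, hΓ⟩ := h.exists_orthogonalPair hw.moments
  have hdeg : ∀ i ≤ n, (p i).degree = i := fun i hi => by
    rw [degree_eq_natDegree (hp i hi).1.ne_zero, (hp i hi).2]
  obtain ⟨e1, e2, e3⟩ := hPQ.christoffel_darboux hn hp (η := η) fun i hi k hk => by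
    rw [ContourSystem.momentFunctional_moment hw.moments
      (degree_mul_lt_two_mul (by rw [hdeg i hi]; exact_mod_cast hi)
        (by rw [hdeg k hk.le]; exact_mod_cast hk)), ← ho i hi k hk]
    simp [hℓ]
  have hK := h.cdKernel_eq hΓ hx hy
  rw [hℓ, show (n : ℤ) - 1 - n + 1 = 0 by ring, zpow_zero, one_mul] at hK
  constructor
  · rw [hK, e2, e1]
    simp only [eval_mul, eval_C]
    rw [← div_div]
    ring
  · rw [hK, e3 x y hxy]; ring

end IsSolution

/-! ### Moving an endpoint of the arcs. -/

/-- At a point of `A` that is a limit of points of `A` from the right, the difference quotients of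
`f - g` along `A` vanish; the remaining points of `A` are countable. -/
lemma ae_deriv_eq_of_eqOn {f g : ℝ → ℂ} {A : Set ℝ} (hf : ∀ t ∈ A, DifferentiableAt ℝ f t)
    (hg : ∀ t ∈ A, DifferentiableAt ℝ g t) (h : EqOn f g A) :
    ∀ᵐ t, t ∈ A → deriv f t = deriv g t := by
  have hS := (countable_setOfPred_isolated_right_within (s := A)).ae_notMem volume
  filter_upwards [hS] with t ht htA
  have hne : (𝓝[A ∩ Ioi t] t).NeBot := ⟨fun e => ht ⟨htA, e⟩⟩
  have hd := (((hf t htA).hasDerivAt.sub (hg t htA).hasDerivAt).hasDerivWithinAt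
    (s := A ∩ Ioi t))
  rw [hasDerivWithinAt_iff_tendsto_slope' (fun h => lt_irrefl t h.2)] at hd
  have h0 : Tendsto (slope (f - g) t) (𝓝[A ∩ Ioi t] t) (𝓝 0) := by
    refine tendsto_const_nhds.congr' ?_
    filter_upwards [self_mem_nhdsWithin] with u hu
    simp [slope, h hu.1, h htA]
  exact sub_eq_zero.1 (tendsto_nhds_unique hd h0)

open Classical in
/-- The number of ends of the `j`-th arc at `b`, counted with sign. -/
noncomputable def ContourSystem.endWeight {ι : Type*} (C : ContourSystem ι) (j : ι) (b : ℂ) : ℂ :=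
  (if C.EndsAt j b then 1 else 0) - if C.StartsAt j b then 1 else 0

namespace EdgeMotion
variable {ι : Type*} {C : ContourSystem ι} {b : ℂ} {r : ℝ} {γ : ℂ → ι → ℝ → ℂ}

lemma differentiableAt (h : EdgeMotion C b r γ) {s : ℂ} (hs : s ∈ Metric.ball b r) (j : ι) {t : ℝ}
    (ht : t ∈ Ioo (0 : ℝ) 1) : DifferentiableAt ℝ (γ s j) t :=
  ((h.smooth s hs j).differentiableOn one_ne_zero).differentiableAt (isOpen_Ioo.mem_nhds ht)

/-- Where the moved arc is inside the disk, `f` is bounded and the length finite. Elsewhere it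
coincides with the old arc, but on a set of parameters that need not be open, so the velocities are
compared almost everywhere. -/
lemma arcIntegrable (h : EdgeMotion C b r γ) {s : ℂ} (hs : s ∈ Metric.ball b r) {j : ι} {f : ℂ → ℂ}
    (hf : ArcIntegrable (C.path j) f) (hfa : ContinuousOn f (Metric.closedBall b r)) :
    ArcIntegrable (γ s j) f := by
  have hcont : ContinuousOn (γ s j) (Ioo 0 1) := (h.smooth s hs j).continuousOn
  have hopen : IsOpen (Ioo (0 : ℝ) 1 ∩ γ s j ⁻¹' Metric.ball b r) :=
    hcont.isOpen_inter_preimage isOpen_Ioo Metric.isOpen_ball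
  set A : Set ℝ := Ioo (0 : ℝ) 1 \ (Ioo (0 : ℝ) 1 ∩ γ s j ⁻¹' Metric.ball b r) with hA
  have hAm : MeasurableSet A := measurableSet_Ioo.diff hopen.measurableSet
  have hun : Ioo (0 : ℝ) 1 = (Ioo (0 : ℝ) 1 ∩ γ s j ⁻¹' Metric.ball b r) ∪ A := by
    rw [hA, union_sdiff_cancel inter_subset_left]
  rw [ArcIntegrable, hun]
  refine IntegrableOn.union ?_ ?_
  · obtain ⟨M, hM⟩ := (isCompact_closedBall b r).exists_bound_of_continuousOn hfa
    refine (h.rectifiable s hs j).bdd_mul (c := M) ?_ ?_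
    · refine ContinuousOn.aestronglyMeasurable ?_ hopen.measurableSet
      exact hfa.comp (hcont.mono inter_subset_left)
        fun t ht => Metric.ball_subset_closedBall ht.2
    · filter_upwards [ae_restrict_mem hopen.measurableSet] with t ht
      exact hM _ (Metric.ball_subset_closedBall ht.2)
  · have heq : EqOn (γ s j) (C.path j) A := by
      intro t ht
      rcases h.outside s hs j t ht.1 with e | e
      · exact e
      · exact absurd ⟨ht.1, e.1⟩ ht.2
    have hd := ae_deriv_eq_of_eqOn (fun t ht => h.differentiableAt hs j ht.1)
      (fun t (ht : t ∈ A) => C.differentiableAt_path j ht.1) heq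
    have hfA : IntegrableOn (fun t => f (C.path j t) * deriv (C.path j) t) A :=
      IntegrableOn.mono_set hf sdiff_subset
    refine hfA.congr ?_
    filter_upwards [ae_restrict_of_ae hd, ae_restrict_mem hAm] with t h1 ht
    rw [heq ht, h1 ht]

/-- The fundamental theorem applies to `Φ = F ∘ γ_s - F ∘ γ`, although `F` is a primitive of `f`
near the disk only: outside the disk the two arcs coincide and `Φ` vanishes. At an end at `b` its
limit is `F(s) - F(b)`, at other ends `0`. -/
lemma arcIntegral_eq (h : EdgeMotion C b r γ) {s : ℂ} (hs : s ∈ Metric.ball b r) {j : ι}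
    {f F : ℂ → ℂ} {r' : ℝ} (hr : 0 < r) (hr' : r < r')
    (hF : ∀ z ∈ Metric.ball b r', HasDerivAt F (f z) z) (hf : ArcIntegrable (C.path j) f)
    (hfa : ContinuousOn f (Metric.closedBall b r)) :
    arcIntegral (γ s j) f = arcIntegral (C.path j) f + C.endWeight j b * (F s - F b) := by
  classical
  set Φ : ℝ → ℂ := fun t => if γ s j t = C.path j t then 0 else F (γ s j t) - F (C.path j t) with hΦ
  have hi := h.arcIntegrable hs hf hfa
  have hΦeq : ∀ t, Φ t = F (γ s j t) - F (C.path j t) ∨ (Φ t = 0 ∧ γ s j t = C.path j t) := by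
    intro t
    by_cases he : γ s j t = C.path j t
    · exact Or.inr ⟨if_pos he, he⟩
    · exact Or.inl (if_neg he)
  have hΦsub : ∀ t, Φ t = F (γ s j t) - F (C.path j t) := fun t => by
    rcases hΦeq t with e | ⟨e, e'⟩
    · exact e
    · rw [e, e', sub_self]
  have hderiv : ∀ t ∈ Ioo (0 : ℝ) 1, HasDerivAt Φ
      (f (γ s j t) * deriv (γ s j) t - f (C.path j t) * deriv (C.path j) t) t := by
    intro t ht
    have h1 := (h.differentiableAt hs j ht).hasDerivAt
    have h2 := (C.differentiableAt_path j ht).hasDerivAt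
    by_cases hin : γ s j t ∈ Metric.ball b r' ∧ C.path j t ∈ Metric.ball b r'
    · have h3 := (hF _ hin.1).comp t h1
      have h4 := (hF _ hin.2).comp t h2
      exact (h3.sub h4).congr_of_eventuallyEq (Eventually.of_forall hΦsub)
    · have e0 : γ s j t = C.path j t := by
        rcases h.outside s hs j t ht with e | e
        · exact e
        · exact absurd ⟨Metric.ball_subset_ball hr'.le e.1, Metric.ball_subset_ball hr'.le e.2⟩ hin
      -- The margin `r < r'` makes this an open condition, so the arcs coincide on a neighbourhood
      -- of `t`.
      have hout : C.path j t ∉ Metric.closedBall b r := fun hc => by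
        have : C.path j t ∈ Metric.ball b r' := Metric.closedBall_subset_ball hr' hc
        exact hin ⟨e0 ▸ this, this⟩
      have hev : ∀ᶠ u in 𝓝 t, γ s j u = C.path j u := by
        filter_upwards [isOpen_Ioo.mem_nhds ht, h2.continuousAt.preimage_mem_nhds
          (Metric.isClosed_closedBall.isOpen_compl.mem_nhds hout)] with u hu hu2
        rcases h.outside s hs j u hu with e | e
        · exact e
        · exact absurd (Metric.ball_subset_closedBall e.2) hu2
      have e1 : deriv (γ s j) t = deriv (C.path j) t := EventuallyEq.deriv_eq hev
      rw [e0, e1, sub_self]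
      refine (hasDerivAt_const t (0 : ℂ)).congr_of_eventuallyEq ?_
      filter_upwards [hev] with u hu
      exact if_pos hu
  have hlim : ∀ (l : Filter ℝ) (p : Prop) [Decidable p], (p → Tendsto (γ s j) l (𝓝 s)) →
      (p → Tendsto (C.path j) l (𝓝 b)) → (¬ p → γ s j =ᶠ[l] C.path j) →
      Tendsto Φ l (𝓝 ((if p then 1 else 0) * (F s - F b))) := by
    intro l p _ h1 h2 h3
    by_cases hp : p
    · rw [if_pos hp, one_mul]
      refine Tendsto.congr (fun t => (hΦsub t).symm) (Tendsto.sub ?_ ?_)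
      · exact ((hF s (Metric.ball_subset_ball hr'.le hs)).continuousAt.tendsto).comp (h1 hp)
      · exact ((hF b (Metric.mem_ball_self (hr.trans hr'))).continuousAt.tendsto).comp (h2 hp)
    · rw [if_neg hp, zero_mul]
      refine tendsto_const_nhds.congr' ?_
      filter_upwards [h3 hp] with t ht
      exact (if_pos ht).symm
  have key := intervalIntegral.integral_eq_sub_of_hasDerivAt_of_tendsto (zero_lt_one' ℝ) hderiv
    ((intervalIntegrable_iff_integrableOn_Ioo_of_le zero_le_one).2 (hi.sub hf))
    (hlim _ (C.StartsAt j b) (h.source s hs j) id (h.source_fixed s hs j))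
    (hlim _ (C.EndsAt j b) (h.target s hs j) id (h.target_fixed s hs j))
  rw [intervalIntegral.integral_of_le zero_le_one, integral_Ioc_eq_integral_Ioo,
    integral_sub hi hf] at key
  rw [ContourSystem.endWeight, arcIntegral, arcIntegral]
  linear_combination key

/-- The derivative of a contour integral with respect to the position of the edge. -/
lemma hasDerivAt_arcIntegral (h : EdgeMotion C b r γ) (hr : 0 < r) {j : ι} {f : ℂ → ℂ}
    (hf : ArcIntegrable (C.path j) f)
    (hfa : C.StartsAt j b ∨ C.EndsAt j b → AnalyticOnNhd ℂ f (Metric.closedBall b r)) :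
    HasDerivAt (fun s => arcIntegral (γ s j) f) (C.endWeight j b * f b) b := by
  have hb : Metric.ball b r ∈ 𝓝 b := Metric.ball_mem_nhds b hr
  by_cases hj : C.StartsAt j b ∨ C.EndsAt j b
  · obtain ⟨δ, hδ, hsub⟩ := (isCompact_closedBall b r).exists_thickening_subset_open
      (isOpen_analyticAt ℂ f) (hfa hj)
    rw [thickening_closedBall hδ hr.le] at hsub
    obtain ⟨F, hF⟩ := DifferentiableOn.isExactOn_ball (f := f) (c := b) (r := δ + r)
      fun z hz => (hsub hz).differentiableAt.differentiableWithinAt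
    have heq : (fun s => arcIntegral (γ s j) f) =ᶠ[𝓝 b] fun s =>
        arcIntegral (C.path j) f + C.endWeight j b * (F s - F b) := by
      filter_upwards [hb] with s hs
      exact h.arcIntegral_eq hs hr (by linarith) hF hf (hfa hj).continuousOn
    refine HasDerivAt.congr_of_eventuallyEq ?_ heq
    exact (((hF b (Metric.mem_ball_self (by linarith))).sub_const _).const_mul _).const_add _
  · obtain ⟨h1, h2⟩ := not_or.1 hj
    rw [ContourSystem.endWeight, if_neg h1, if_neg h2, sub_zero, zero_mul]
    refine (hasDerivAt_const b (arcIntegral (C.path j) f)).congr_of_eventuallyEq ?_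
    filter_upwards [hb] with s hs
    refine setIntegral_congr_fun measurableSet_Ioo fun t ht => ?_
    have hev : γ s j =ᶠ[𝓝 t] C.path j := by
      filter_upwards [isOpen_Ioo.mem_nhds ht] with u hu using h.fixed s hs j h1 h2 u hu
    simp only [hev.deriv_eq, hev.self_of_nhds]

lemma arcIntegral_base (h : EdgeMotion C b r γ) (j : ι) (f : ℂ → ℂ) :
    arcIntegral (γ b j) f = arcIntegral (C.path j) f := by
  refine setIntegral_congr_fun measurableSet_Ioo fun t ht => ?_
  have hev : γ b j =ᶠ[𝓝 t] C.path j := by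
    filter_upwards [isOpen_Ioo.mem_nhds ht] with u hu using h.base j u hu
  simp only [hev.deriv_eq, hev.self_of_nhds]

end EdgeMotion

/-! ### The Cauchy transform and the cloaking circle. -/

namespace ContourSystem
variable {ι : Type*} {C : ContourSystem ι}

lemma exists_dist_path [Finite ι] {z : ℂ} (hz : z ∈ C.domain) : ∃ δ > 0, ∀ j, ∀ t ∈ Ioo (0 : ℝ) 1,
    ∀ y ∈ Metric.ball z δ, δ ≤ ‖C.path j t - y‖ := by
  obtain ⟨δ, hδ, hsub⟩ := Metric.isOpen_iff.1 C.isOpen_domain z hz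
  refine ⟨δ / 2, by positivity, fun j t ht y hy => ?_⟩
  by_contra! hlt
  have : C.path j t ∈ C.domain := by
    apply hsub
    rw [Metric.mem_ball, dist_eq_norm] at hy ⊢
    calc ‖C.path j t - z‖ = ‖(C.path j t - y) + (y - z)‖ := by ring_nf
      _ ≤ ‖C.path j t - y‖ + ‖y - z‖ := norm_add_le _ _
      _ < δ := by linarith
  exact C.path_mem_compl j ht this

lemma aestronglyMeasurable_cauchy {j : ι} {v : ℂ → ℂ} (hv : ArcIntegrable (C.path j) v) (z : ℂ) :
    AEStronglyMeasurable (fun t => v (C.path j t) / (C.path j t - z) * deriv (C.path j) t)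
      (volume.restrict (Ioo (0 : ℝ) 1)) := by
  have h1 : AEStronglyMeasurable (fun t => (C.path j t - z)⁻¹) (volume.restrict (Ioo (0 : ℝ) 1)) :=
    (((C.continuousOn_path j).sub continuousOn_const).aestronglyMeasurable
      measurableSet_Ioo).aemeasurable.inv.aestronglyMeasurable
  refine (h1.mul hv.aestronglyMeasurable).congr (ae_of_all _ fun t => ?_)
  simp only [Pi.mul_apply]; ring

lemma norm_cauchy_le {v x y d : ℂ} {ε : ℝ} (hε : 0 < ε) (h : ε ≤ ‖x - y‖) :
    ‖v / (x - y) * d‖ ≤ ε⁻¹ * ‖v * d‖ := by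
  rw [norm_mul, norm_div, norm_mul]
  calc ‖v‖ / ‖x - y‖ * ‖d‖ ≤ ‖v‖ / ε * ‖d‖ := by gcongr
    _ = ε⁻¹ * (‖v‖ * ‖d‖) := by ring

lemma arcIntegrable_cauchy [Finite ι] {j : ι} {v : ℂ → ℂ} (hv : ArcIntegrable (C.path j) v) {z : ℂ}
    (hz : z ∈ C.domain) : ArcIntegrable (C.path j) fun x => v x / (x - z) := by
  obtain ⟨δ, hδ, hd⟩ := C.exists_dist_path hz
  refine Integrable.mono' (hv.norm.const_mul δ⁻¹) (aestronglyMeasurable_cauchy hv z) ?_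
  filter_upwards [ae_restrict_mem measurableSet_Ioo] with t ht
  exact norm_cauchy_le hδ (hd j t ht z (Metric.mem_ball_self hδ))

lemma continuousAt_cauchyTransform [Fintype ι] {w : ι → ℂ → ℂ}
    (hw : ∀ j, ArcIntegrable (C.path j) (w j)) {z : ℂ} (hz : z ∈ C.domain) :
    ContinuousAt (cauchyTransform C.path w) z := by
  obtain ⟨δ, hδ, hd⟩ := C.exists_dist_path hz
  refine ContinuousAt.div_const (tendsto_finsetSum _ fun j _ => ?_) _
  refine continuousAt_of_dominated (bound := fun t => δ⁻¹ *
    ‖w j (C.path j t) * deriv (C.path j) t‖) ?_ ?_ ((hw j).norm.const_mul δ⁻¹) ?_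
  · exact Eventually.of_forall fun y => aestronglyMeasurable_cauchy (hw j) y
  · filter_upwards [Metric.ball_mem_nhds z hδ] with y hy
    filter_upwards [ae_restrict_mem measurableSet_Ioo] with t ht
    exact norm_cauchy_le hδ (hd j t ht y hy)
  · filter_upwards [ae_restrict_mem measurableSet_Ioo] with t ht
    have hne : C.path j t - z ≠ 0 := by
      have := hd j t ht z (Metric.mem_ball_self hδ)
      exact norm_pos_iff.1 (hδ.trans_le this)
    exact (continuousAt_const.div (continuousAt_const.sub continuousAt_id) hne).mul
      continuousAt_const

end ContourSystem

section circle
variable {ι : Type*} (γ : ι → ℝ → ℂ) (b : ℂ) (R : ℝ)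

lemma cloakedPath_none_eq (t : ℝ) :
    cloakedPath γ b R none t = circleMap b R (2 * Real.pi * t) := by
  simp only [cloakedPath, circleMap]
  congr 3
  push_cast; ring

lemma hasDerivAt_cloakedPath_none (t : ℝ) : HasDerivAt (cloakedPath γ b R none)
    (2 * Real.pi * deriv (circleMap b R) (2 * Real.pi * t)) t := by
  have h1 : HasDerivAt (fun t : ℝ => 2 * Real.pi * t) (2 * Real.pi) t := by
    simpa using (hasDerivAt_id t).const_mul (2 * Real.pi)
  have h2 := ((hasDerivAt_circleMap b R (2 * Real.pi * t)).scomp t h1)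
  have e : cloakedPath γ b R none = circleMap b R ∘ fun t => 2 * Real.pi * t :=
    _root_.funext fun t => cloakedPath_none_eq γ b R t
  rw [e, deriv_circleMap]
  simpa using h2

/-- The velocity of the circle is `2πi` times the radius vector, so the collar is radial, and small
positive heights, to the left of the counterclockwise circle, lie inside. -/
lemma collar_cloakedPath_none (p : ℝ × ℝ) : collar (cloakedPath γ b R none) p =
    b + ((1 - 2 * Real.pi * p.2 : ℝ) : ℂ) * (cloakedPath γ b R none p.1 - b) := by
  rw [collar, (hasDerivAt_cloakedPath_none γ b R p.1).deriv, deriv_circleMap,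
    cloakedPath_none_eq, circleMap]
  simp only [circleMap, zero_add]
  push_cast
  linear_combination (2 * Real.pi * p.2 * (R * Complex.exp (2 * Real.pi * p.1 * Complex.I))) *
    Complex.I_mul_I

lemma norm_cloakedPath_none_sub (hR : 0 ≤ R) (t : ℝ) : ‖cloakedPath γ b R none t - b‖ = R := by
  rw [cloakedPath_none_eq, circleMap_sub_center, norm_circleMap_zero, abs_of_nonneg hR]

lemma tendsto_collar_cloakedPath_none (t : ℝ) :
    Tendsto (collar (cloakedPath γ b R none)) (𝓝 (t, 0)) (𝓝 (cloakedPath γ b R none t)) := by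
  have h1 : Continuous (cloakedPath γ b R none) := continuous_iff_continuousAt.2
    fun t => (hasDerivAt_cloakedPath_none γ b R t).continuousAt
  have h2 : Continuous (collar (cloakedPath γ b R none)) := by
    have : collar (cloakedPath γ b R none) = _ := _root_.funext (collar_cloakedPath_none γ b R)
    rw [this]; fun_prop
  have := h2.tendsto (t, 0)
  rwa [collar_cloakedPath_none, mul_zero, sub_zero, Complex.ofReal_one, one_mul,
    add_sub_cancel] at this

lemma setIntegral_cloakedPath_none (g : ℂ → ℂ) :
    ∫ t in Ioo (0 : ℝ) 1, g (cloakedPath γ b R none t) * deriv (cloakedPath γ b R none) t =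
      ∮ z in C(b, R), g z := by
  have e : ∀ t : ℝ, g (cloakedPath γ b R none t) * deriv (cloakedPath γ b R none) t =
      (2 * Real.pi) • (deriv (circleMap b R) (2 * Real.pi * t) •
        g (circleMap b R (2 * Real.pi * t))) := by
    intro t
    rw [(hasDerivAt_cloakedPath_none γ b R t).deriv, cloakedPath_none_eq, Complex.real_smul]
    push_cast
    rw [smul_eq_mul]; ring
  simp only [e]
  rw [← integral_Ioc_eq_integral_Ioo, ← intervalIntegral.integral_of_le zero_le_one,
    intervalIntegral.integral_smul, intervalIntegral.smul_integral_comp_mul_left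
      (fun θ => deriv (circleMap b R) θ • g (circleMap b R θ)), mul_zero, mul_one, circleIntegral]

lemma integrableOn_cloakedPath_none {g : ℂ → ℂ} (hR : 0 ≤ R)
    (hg : ContinuousOn g (Metric.sphere b R)) : IntegrableOn
      (fun t => g (cloakedPath γ b R none t) * deriv (cloakedPath γ b R none) t) (Ioo 0 1) := by
  have h1 : Continuous (cloakedPath γ b R none) := continuous_iff_continuousAt.2
    fun t => (hasDerivAt_cloakedPath_none γ b R t).continuousAt
  have h2 : Continuous fun t => g (cloakedPath γ b R none t) :=
    hg.comp_continuous h1 fun t => by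
      rw [mem_sphere_iff_norm, norm_cloakedPath_none_sub γ b R hR]
  have h3 : Continuous (deriv (cloakedPath γ b R none)) := by
    have : deriv (cloakedPath γ b R none) = _ :=
      _root_.funext fun t => (hasDerivAt_cloakedPath_none γ b R t).deriv
    rw [this]
    simp only [deriv_circleMap]
    fun_prop
  exact ((h2.mul h3).continuousOn.integrableOn_compact isCompact_Icc).mono_set Ioo_subset_Icc_self

end circle

/-- With the invariance of the determinant below, this is all that `IsSolution.malgrange_trace` asks
of a matrix function in place of `Γ`. -/
lemma cloakedSolution_fst {ι : Type*} [Fintype ι] (σ : PlusSide) (γ : ι → ℝ → ℂ) (w : ι → ℂ → ℂ)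
    (b : ℂ) (R : ℝ) (Γ : ℂ → Matrix (Fin 2) (Fin 2) ℂ) (z : ℂ) (i : Fin 2) :
    cloakedSolution σ γ w b R Γ z i 0 = Γ z i 0 := by
  rw [cloakedSolution]
  split_ifs
  · simp [Matrix.mul_apply, jumpMatrix]
  · rfl

lemma cloakedSolution_det {ι : Type*} [Fintype ι] (σ : PlusSide) (γ : ι → ℝ → ℂ) (w : ι → ℂ → ℂ)
    (b : ℂ) (R : ℝ) (Γ : ℂ → Matrix (Fin 2) (Fin 2) ℂ) (z : ℂ) :
    (cloakedSolution σ γ w b R Γ z).det = (Γ z).det := by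
  rw [cloakedSolution]
  split_ifs
  · rw [Matrix.det_mul, jumpMatrix_det, mul_one]
  · rfl

namespace ContourSystem
variable {ι : Type*} {C : ContourSystem ι} {b : ℂ} {R : ℝ}

/-- Almost every point of the circle is off the contours. -/
lemma ae_cloakedPath_mem_domain [Finite ι] (hR : 0 < R)
    (hnode : ∀ a ∈ C.nodes, a ∈ Metric.closedBall b R → a = b)
    (hfin : ∀ j, {t ∈ Ioo (0 : ℝ) 1 | C.path j t ∈ Metric.sphere b R}.Finite) (γ : ι → ℝ → ℂ) :
    ∀ᵐ t ∂(volume.restrict (Ioo (0 : ℝ) 1)), cloakedPath γ b R none t ∈ C.domain := by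
  have hsph : ∀ t, cloakedPath γ b R none t ∈ Metric.sphere b R := fun t => by
    rw [mem_sphere_iff_norm, norm_cloakedPath_none_sub γ b R hR.le]
  have hE : (⋃ j, C.path j '' {t ∈ Ioo (0 : ℝ) 1 | C.path j t ∈ Metric.sphere b R}).Finite :=
    finite_iUnion fun j => (hfin j).image _
  have hinj : InjOn (cloakedPath γ b R none) (Ioo 0 1) := by
    intro s hs t ht hst
    rw [cloakedPath_none_eq, cloakedPath_none_eq] at hst
    have hp := Real.pi_pos
    have := injOn_circleMap_of_abs_sub_le' (a := 0) (b := 2 * Real.pi) hR.ne' (by linarith)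
      ⟨by nlinarith [hs.1], by nlinarith [hs.2]⟩ ⟨by nlinarith [ht.1], by nlinarith [ht.2]⟩ hst
    exact mul_left_cancel₀ (by positivity) this
  have hbad : {t ∈ Ioo (0 : ℝ) 1 | cloakedPath γ b R none t ∉ C.domain}.Finite := by
    refine Set.Finite.of_finite_image (hE.subset ?_) (hinj.mono fun t ht => ht.1)
    rintro _ ⟨t, ⟨ht, hbad⟩, rfl⟩
    rcases not_not.1 hbad with h | h
    · obtain ⟨j, u, hu, e⟩ := mem_iUnion.1 h
      exact mem_iUnion.2 ⟨j, u, ⟨hu, e ▸ hsph t⟩, e⟩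
    · have := hnode _ h (Metric.sphere_subset_closedBall (hsph t))
      have h2 := norm_cloakedPath_none_sub γ b R hR.le t
      rw [this, sub_self, norm_zero] at h2
      exact absurd h2 hR.ne
  rw [ae_restrict_iff' measurableSet_Ioo, ae_iff]
  refine measure_mono_null (fun t ht => ?_) (hbad.measure_zero volume)
  simpa [and_assoc] using ht

end ContourSystem

lemma continuous_jumpMatrix : Continuous jumpMatrix := by
  refine continuous_matrix fun i k => ?_
  fin_cases i <;> fin_cases k <;> simp only [jumpMatrix] <;>
    first | exact continuous_const | exact continuous_id

lemma tendsto_mul_jumpMatrix {α : Type*} {l : Filter α} {A : α → Matrix (Fin 2) (Fin 2) ℂ}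
    {A₀ : Matrix (Fin 2) (Fin 2) ℂ} {a : α → ℂ} {a₀ : ℂ} (hA : Tendsto A l (𝓝 A₀))
    (ha : Tendsto a l (𝓝 a₀)) :
    Tendsto (fun x => A x * jumpMatrix (a x)) l (𝓝 (A₀ * jumpMatrix a₀)) :=
  hA.mul ((continuous_jumpMatrix.tendsto a₀).comp ha)

/-- The boundary value of the cloaked solution on the circle from the minus side. -/
lemma IsSolution.exists_tendsto_cloakedSolution {ι : Type*} [Fintype ι] {σ : PlusSide}
    {C : ContourSystem ι} {n : ℕ} {ℓ : ℤ} {w : ι → ℂ → ℂ} {Γ : ℂ → Matrix (Fin 2) (Fin 2) ℂ}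
    (h : IsSolution σ C n ℓ w Γ) (hw : ∀ j, ArcIntegrable (C.path j) (w j)) {b : ℂ} {R : ℝ}
    (hR : 0 < R) (γ : ι → ℝ → ℂ) {t : ℝ} (ht : cloakedPath γ b R none t ∈ C.domain) :
    ∃ N, Tendsto (fun p => cloakedSolution σ C.path w b R Γ
      (collar (cloakedPath γ b R none) p)) (𝓝 t ×ˢ σ.minusFilter) (𝓝 N) := by
  set z := cloakedPath γ b R none t with hz
  have hle : 𝓝 t ×ˢ σ.minusFilter ≤ 𝓝 (t, 0) := by
    rw [nhds_prod_eq]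
    exact prod_mono le_rfl (σ.minusFilter_le.trans nhdsWithin_le_nhds)
  have hc := (tendsto_collar_cloakedPath_none γ b R t).mono_left hle
  have hΓ : ContinuousAt Γ z := by
    refine continuousAt_pi.2 fun i => continuousAt_pi.2 fun k => ?_
    exact (h.holo i k).continuousOn.continuousAt (C.isOpen_domain.mem_nhds ht)
  have hnorm : ∀ p, ‖collar (cloakedPath γ b R none) p - b‖ = |1 - 2 * Real.pi * p.2| * R := by
    intro p
    rw [collar_cloakedPath_none, add_sub_cancel_left, norm_mul, Complex.norm_real,
      norm_cloakedPath_none_sub γ b R hR.le, Real.norm_eq_abs]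
  have hp := Real.pi_pos
  -- If `+` is the left side, the minus side of the circle is its exterior, where `Γ` is unchanged;
  -- otherwise it is the interior, where the unipotent factor is present.
  cases σ
  · refine ⟨Γ z, (hΓ.tendsto.comp hc).congr' ?_⟩
    have h1 : ∀ᶠ p : ℝ × ℝ in 𝓝 t ×ˢ PlusSide.minusFilter .left, p.2 < 0 :=
      tendsto_snd.eventually (self_mem_nhdsWithin : Iio (0 : ℝ) ∈ 𝓝[<] 0)
    filter_upwards [h1] with p hp2
    have hout : collar (cloakedPath γ b R none) p ∉ Metric.ball b R := by
      rw [mem_ball_iff_norm, hnorm, not_lt]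
      have h2 : 1 ≤ |1 - 2 * Real.pi * p.2| := le_trans (by nlinarith) (le_abs_self _)
      nlinarith
    rw [Function.comp_apply, cloakedSolution, if_neg hout]
  · have h2 := (ContourSystem.continuousAt_cauchyTransform hw ht).tendsto.comp hc
    refine ⟨_, (tendsto_mul_jumpMatrix (hΓ.tendsto.comp hc)
      (h2.const_mul PlusSide.right.sign)).congr' ?_⟩
    have h1 : ∀ᶠ p : ℝ × ℝ in 𝓝 t ×ˢ PlusSide.minusFilter .right, p.2 ∈ Ioo 0 (1 / Real.pi / 2) :=
      tendsto_snd.eventually (Ioo_mem_nhdsGT (by positivity))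
    filter_upwards [h1] with p hp2
    have hin : collar (cloakedPath γ b R none) p ∈ Metric.ball b R := by
      rw [mem_ball_iff_norm, hnorm]
      have h3 : Real.pi * p.2 < 1 / 2 := by
        have := mul_lt_mul_of_pos_left hp2.2 hp
        rwa [show Real.pi * (1 / Real.pi / 2) = 1 / 2 by field_simp] at this
      have h4 : 0 < Real.pi * p.2 := mul_pos hp hp2.1
      have h2 : |1 - 2 * Real.pi * p.2| < 1 := by
        rw [abs_lt]; constructor <;> nlinarith
      nlinarith
    simp only [Function.comp_apply]
    rw [cloakedSolution, if_pos hin]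

lemma jumpVariation_eq_zero {κ : Type*} {M : ℂ → κ → ℂ → Matrix (Fin 2) (Fin 2) ℂ} {s₀ : ℂ}
    {j : κ} {z : ℂ} {A : Matrix (Fin 2) (Fin 2) ℂ} (hM : ∀ s, M s j z = A) :
    jumpVariation M s₀ j z = 0 := by
  have : (Matrix.of fun a b => deriv (fun s => M s j z a b) s₀) = 0 := by
    ext a b
    simp only [hM, Matrix.of_apply, deriv_const, Matrix.zero_apply]
  rw [jumpVariation, this, zero_mul]

/-- Displacement of a hard edge. -/
theorem IsSolution.logDeriv_edgeMotion {ι : Type*} [Fintype ι] {σ : PlusSide}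
    {C : ContourSystem ι} {n : ℕ} {ℓ : ℤ} {w : ι → ℂ → ℂ} {Γ : ℂ → Matrix (Fin 2) (Fin 2) ℂ}
    {b : ℂ} {r R : ℝ} {γ : ℂ → ι → ℝ → ℂ}
    (hw : AdmissibleWeight C (insert 0 (momentRange n ℓ)) w) (h : IsSolution σ C n ℓ w Γ)
    (hr : 0 < r) (hrR : r < R) (hnode : ∀ a ∈ C.nodes, a ∈ Metric.closedBall b R → a = b)
    (hb : b ≠ 0 ∨ (n : ℤ) ≤ ℓ + 1)
    (hwa : ∀ j, C.StartsAt j b ∨ C.EndsAt j b → AnalyticOnNhd ℂ (w j) (Metric.closedBall b r))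
    (hfin : ∀ j, {t ∈ Ioo (0 : ℝ) 1 | C.path j t ∈ Metric.sphere b R}.Finite)
    (hγ : EdgeMotion C b r γ) :
    toeplitzDet (γ b) w n ℓ ≠ 0 ∧
    DifferentiableAt ℂ (fun s => toeplitzDet (γ s) w n ℓ) b ∧
    (∀ j, IntegrableOn (malgrangeIntegrand σ (cloakedPath C.path b R)
      (cloakedSolution σ C.path w b R Γ) (fun s => cloakedJump (γ s) w b R) b j) (Ioo 0 1)) ∧
    logDeriv (fun s => toeplitzDet (γ s) w n ℓ) b =
      σ.sign * malgrangeForm σ (cloakedPath C.path b R)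
        (cloakedSolution σ C.path w b R Γ) (fun s => cloakedJump (γ s) w b R) b := by
  have hR := hr.trans hrR
  have hm : ∀ j, ∀ k ∈ momentRange n ℓ, ArcIntegrable (C.path j) fun x => x ^ k * w j x :=
    fun j k hk => hw.moments j k (mem_insert_of_mem _ hk)
  have hw0 : ∀ j, ArcIntegrable (C.path j) (w j) := fun j => by
    simpa using hw.moments j 0 (mem_insert _ _)
  obtain ⟨P, Q, hPQ, hΓ⟩ := h.exists_orthogonalPair hm
  have hdeg := OrthogonalPair.degree_cdPoly hPQ.degree_left hPQ.degree_lt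
  -- integer powers on the disk
  have hz0 : ∀ z ∈ Metric.closedBall b R, ∀ k : ℤ, ℓ - n + 1 ≤ k → z ≠ 0 ∨ 0 ≤ k := by
    intro z hz k hk
    rcases hb with hb | hb
    · left; rintro rfl
      exact hb (hnode 0 C.zero_mem hz).symm
    · right; omega
  -- Moving `b` changes each contour integral at the rate `± f(b)` per end at `b`; `W` collects
  -- these rates for `f = w j`, and all derivatives below are `W` times the remaining factor at `b`.
  set W : ℂ := ∑ j, C.endWeight j b * w j b with hW
  have hbb : b ∈ Metric.closedBall b R := Metric.mem_closedBall_self hR.le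
  -- derivatives of the moments
  have hmom : ∀ k : ℕ, k + 1 < 2 * n → HasDerivAt (fun s => moment (γ s) w (ℓ - n + 1 + k))
      (W * b ^ (ℓ - n + 1) * b ^ k) b := by
    intro k hk
    have h1 : b ^ (ℓ - n + 1 + k) = b ^ (ℓ - n + 1) * b ^ k := by
      rcases hz0 b hbb (ℓ - n + 1) le_rfl with h0 | h0
      · rw [zpow_add₀ h0, zpow_natCast]
      · obtain ⟨a, ha⟩ := Int.eq_ofNat_of_zero_le h0
        rw [ha, ← Nat.cast_add, zpow_natCast, zpow_natCast, pow_add]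
    refine (HasDerivAt.fun_sum fun j _ => hγ.hasDerivAt_arcIntegral hr
      (hm j _ ⟨by omega, by omega⟩) fun hj => ?_).congr_deriv (?_ : _ = _)
    · refine AnalyticOnNhd.mul (fun z hz => ?_) (hwa j hj)
      have hz' := Metric.closedBall_subset_closedBall hrR.le hz
      rcases hz0 z hz' (ℓ - n + 1 + k) (by omega) with h0 | h0
      · exact analyticAt_id.zpow h0
      · exact analyticAt_id.zpow_nonneg h0
    · rw [hW, Finset.sum_mul, Finset.sum_mul]
      exact Finset.sum_congr rfl fun j _ => by rw [h1]; ring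
  have hPQ' : OrthogonalPair n (fun k => moment (γ b) w (ℓ - n + 1 + k))
      (2 * Real.pi * Complex.I * σ.sign) P Q := by
    simpa only [moment, hγ.arcIntegral_base] using hPQ
  obtain ⟨h1, h2, h3⟩ := OrthogonalPair.logDeriv_toeplitzDet (γ := γ) (w := fun _ => w) hPQ' hmom
  have hfun : momentFunctional (fun k => W * b ^ (ℓ - n + 1) * b ^ k) (cdPoly P Q) =
      W * (b ^ (ℓ - n + 1) * (cdPoly P Q).eval b) := by
    rw [momentFunctional_eq_sum _ hdeg]
    conv_rhs => rw [eq_sum_of_degree_lt hdeg, eval_finsetSum, Finset.mul_sum, Finset.mul_sum]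
    refine Finset.sum_congr rfl fun i _ => ?_
    simp only [eval_mul, eval_C, eval_pow, eval_X]
    ring
  -- the variation of the jump
  have hC' : ∀ z ∈ C.domain, z ∈ Metric.sphere b R →
      HasDerivAt (fun s => -cauchyTransform (γ s) w z)
        (-(W / (b - z) / (2 * Real.pi * Complex.I))) b := by
    intro z hz hzR
    refine ((HasDerivAt.fun_sum fun j _ => hγ.hasDerivAt_arcIntegral hr
      (ContourSystem.arcIntegrable_cauchy (hw0 j) hz) fun hj => ?_).div_const _).neg.congr_deriv ?_
    · refine AnalyticOnNhd.div (hwa j hj) (fun y _ => analyticAt_id.sub analyticAt_const)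
        fun y hy => sub_ne_zero.2 ?_
      rintro rfl
      rw [mem_sphere_iff_norm] at hzR
      rw [mem_closedBall_iff_norm] at hy
      linarith
    · simp only [hW, Finset.sum_div]
      congr 1
      exact Finset.sum_congr rfl fun j _ => by ring
  have hsome : ∀ j t, malgrangeIntegrand σ (cloakedPath C.path b R)
      (cloakedSolution σ C.path w b R Γ) (fun s => cloakedJump (γ s) w b R) b (some j) t = 0 := by
    intro j t
    rw [malgrangeIntegrand, jumpVariation_eq_zero (fun s => rfl)]
    simp
  -- One factor `(2πi)⁻¹` comes from Malgrange's form, the other from the Cauchy transform, whose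
  -- variation has a simple pole at `z = b`.
  set g : ℂ → ℂ := fun z => -W * (2 * Real.pi * Complex.I)⁻¹ ^ 2 *
    ((z - b)⁻¹ • (z ^ (ℓ - n + 1) * (cdPoly P Q).eval z)) with hg
  have hnone : malgrangeIntegrand σ (cloakedPath C.path b R)
      (cloakedSolution σ C.path w b R Γ) (fun s => cloakedJump (γ s) w b R) b none
      =ᵐ[volume.restrict (Ioo 0 1)] fun t => g (cloakedPath C.path b R none t) *
        deriv (cloakedPath C.path b R none) t := by
    filter_upwards [C.ae_cloakedPath_mem_domain hR hnode hfin C.path] with t ht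
    obtain ⟨N, hN⟩ := h.exists_tendsto_cloakedSolution hw0 hR C.path ht
    have hle : 𝓝 t ×ˢ σ.minusFilter ≤ 𝓝 (t, 0) := by
      rw [nhds_prod_eq]
      exact prod_mono le_rfl (σ.minusFilter_le.trans nhdsWithin_le_nhds)
    have hc := (tendsto_collar_cloakedPath_none C.path b R t).mono_left hle
    have hsph : cloakedPath C.path b R none t ∈ Metric.sphere b R := by
      rw [mem_sphere_iff_norm, norm_cloakedPath_none_sub C.path b R hR.le]
    rw [malgrangeIntegrand, jumpVariation_eq
      (f := fun s => -cauchyTransform (γ s) w (cloakedPath C.path b R none t))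
      (Eventually.of_forall fun s => rfl), h.malgrange_trace hΓ
      (cloakedSolution_fst σ C.path w b R Γ) (cloakedSolution_det σ C.path w b R Γ) hc
      (hc.eventually (C.isOpen_domain.mem_nhds ht)) (C.ne_zero_of_mem ht) hN,
      (hC' _ ht hsph).deriv, hg, ← neg_sub _ b, div_neg]
    simp only [smul_eq_mul]
    ring
  have hhol : DifferentiableOn ℂ (fun z : ℂ => z ^ (ℓ - n + 1) * (cdPoly P Q).eval z)
      (Metric.closedBall b R) := fun z hz =>
    ((differentiableAt_zpow.2 (hz0 z hz _ le_rfl)).mul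
      (cdPoly P Q).differentiableAt).differentiableWithinAt
  -- Cauchy's integral formula at `b`. It requires `z^(ℓ-n+1)` to be holomorphic in the disk, hence
  -- the condition `b ≠ 0` or `n ≤ ℓ + 1`.
  have hcirc : ∮ z in C(b, R), g z = -W * (2 * Real.pi * Complex.I)⁻¹ *
      (b ^ (ℓ - n + 1) * (cdPoly P Q).eval b) := by
    rw [hg, circleIntegral.integral_const_mul,
      hhol.circleIntegral_sub_inv_smul (Metric.mem_ball_self hR), smul_eq_mul]
    have := Complex.two_pi_I_ne_zero
    field_simp
  refine ⟨h1, h2, ?_, ?_⟩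
  · rintro (_ | j)
    · refine (integrable_congr hnone).2 (integrableOn_cloakedPath_none _ _ _ hR.le ?_)
      have hinv : ContinuousOn (fun z : ℂ => (z - b)⁻¹) (Metric.sphere b R) := by
        refine ContinuousOn.inv₀ (continuousOn_id.sub continuousOn_const) fun z hz => ?_
        rw [mem_sphere_iff_norm] at hz
        exact norm_pos_iff.1 (hz ▸ hR)
      exact continuousOn_const.mul
        (hinv.mul (hhol.continuousOn.mono Metric.sphere_subset_closedBall))
    · exact (integrable_congr (ae_of_all _ (hsome j))).2 (integrable_zero _ _ _)
  · rw [h3, hfun, malgrangeForm, Fintype.sum_option]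
    simp only [hsome, integral_zero, Finset.sum_const_zero, add_zero]
    rw [integral_congr_ae hnone, setIntegral_cloakedPath_none, hcirc,
      div_eq_iff (mul_ne_zero Complex.two_pi_I_ne_zero σ.sign_ne_zero)]
    have := Complex.two_pi_I_ne_zero
    field_simp
    linear_combination (-(W * b ^ (ℓ - n + 1) * (cdPoly P Q).eval b)) * σ.sign_mul_self

theorem mainTheorem7 {ι : Type*} [Fintype ι] [DecidableEq ι] (C : ContourSystem ι)
    (σ : PlusSide) (n : ℕ) (ℓ : ℤ) (Γ : ℂ → Matrix (Fin 2) (Fin 2) ℂ) :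
    -- deformations of the weights
    (∀ (U : Set ℂ) (w : ℂ → ι → ℂ → ℂ), WeightDeformation C (momentRange n ℓ) U w →
      ∀ s₀ ∈ U, IsSolution σ C n ℓ (w s₀) Γ →
        toeplitzDet C.path (w s₀) n ℓ ≠ 0 ∧
        DifferentiableAt ℂ (fun s => toeplitzDet C.path (w s) n ℓ) s₀ ∧
        (∀ j, IntegrableOn (malgrangeIntegrand σ C.path Γ
          (fun s j z => jumpMatrix (w s j z)) s₀ j) (Ioo 0 1)) ∧
        logDeriv (fun s => toeplitzDet C.path (w s) n ℓ) s₀ =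
          σ.sign * malgrangeForm σ C.path Γ (fun s j z => jumpMatrix (w s j z)) s₀) ∧
    -- displacement of a hard edge
    (∀ (w : ι → ℂ → ℂ) (b : ℂ) (r R : ℝ) (γ : ℂ → ι → ℝ → ℂ),
      AdmissibleWeight C (insert 0 (momentRange n ℓ)) w → IsSolution σ C n ℓ w Γ →
      0 < r → r < R → b ∈ C.nodes → (∀ a ∈ C.nodes, a ∈ Metric.closedBall b R → a = b) →
      (b ≠ 0 ∨ (n : ℤ) ≤ ℓ + 1) →
      (∀ j, C.StartsAt j b ∨ C.EndsAt j b →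
        AnalyticOnNhd ℂ (w j) (Metric.closedBall b r)) →
      (∀ j, {t ∈ Ioo (0 : ℝ) 1 | C.path j t ∈ Metric.sphere b R}.Finite) →
      EdgeMotion C b r γ →
        toeplitzDet (γ b) w n ℓ ≠ 0 ∧
        DifferentiableAt ℂ (fun s => toeplitzDet (γ s) w n ℓ) b ∧
        (∀ j, IntegrableOn (malgrangeIntegrand σ (cloakedPath C.path b R)
          (cloakedSolution σ C.path w b R Γ) (fun s => cloakedJump (γ s) w b R) b j)
          (Ioo 0 1)) ∧
        logDeriv (fun s => toeplitzDet (γ s) w n ℓ) b =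
          σ.sign * malgrangeForm σ (cloakedPath C.path b R)
            (cloakedSolution σ C.path w b R Γ) (fun s => cloakedJump (γ s) w b R) b) ∧
    -- derivatives with respect to the coefficients of the contours
    (∀ (ρ : ι → ℂ → ℂ) (κ : ι → ℂ) (j₀ : ι), AdmissibleWeight C (momentRange n ℓ) ρ →
      IsSolution σ C n ℓ (fun j x => κ j * ρ j x) Γ →
        toeplitzDet C.path (fun j x => κ j * ρ j x) n ℓ ≠ 0 ∧
        DifferentiableAt ℂ
          (fun c => toeplitzDet C.path (fun j x => Function.update κ j₀ c j * ρ j x) n ℓ)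
          (κ j₀) ∧
        (∀ t ∈ Ioo (0 : ℝ) 1, C.path j₀ t ∉ C.nodes →
          Tendsto (fun p => cdKernel Γ p.1 p.2) (diagFilter C (C.path j₀ t))
            (𝓝 (cdDiag C Γ (C.path j₀ t)))) ∧
        ArcIntegrable (C.path j₀) (fun x => cdDiag C Γ x * ρ j₀ x) ∧
        logDeriv
          (fun c => toeplitzDet C.path (fun j x => Function.update κ j₀ c j * ρ j x) n ℓ)
          (κ j₀) =
          σ.sign * (arcIntegral (C.path j₀) (fun x => cdDiag C Γ x * ρ j₀ x) /
            (2 * Real.pi * Complex.I))) ∧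
    -- in the Hankel case the kernel is the Christoffel-Darboux kernel
    (∀ (w : ι → ℂ → ℂ) (p : ℕ → Polynomial ℂ) (h : ℕ → ℂ),
      AdmissibleWeight C (momentRange n ℓ) w → IsSolution σ C n ℓ w Γ →
      1 ≤ n → ℓ = (n : ℤ) - 1 →
      (∀ i ≤ n, (p i).Monic ∧ (p i).natDegree = i) →
      (∀ i ≤ n, ∀ k < n,
        ∑ j, arcIntegral (C.path j) (fun x => (p i).eval x * (p k).eval x * w j x) =
          if i = k then h i else 0) →
      ∀ x ∈ C.domain, ∀ y ∈ C.domain, x ≠ y →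
        cdKernel Γ x y = σ.sign * (2 * Real.pi * Complex.I) *
          (((p n).eval x * (p (n - 1)).eval y - (p (n - 1)).eval x * (p n).eval y) /
            (h (n - 1) * (x - y))) ∧
        cdKernel Γ x y = σ.sign * (2 * Real.pi * Complex.I) *
          ∑ i ∈ Finset.range n, (p i).eval x * (p i).eval y / h i) := by
  exact ⟨fun U w hw s₀ hs h => h.logDeriv_weightDeformation hw hs,
    fun w b r R γ hw h hr hrR _ hnode hb hwa hfin hγ =>
      h.logDeriv_edgeMotion hw hr hrR hnode hb hwa hfin hγ,
    fun ρ κ j₀ hρ h => h.logDeriv_coefficient j₀ hρ,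
    fun w p η hw h hn hℓ hp ho x hx y hy hxy =>
      h.cdKernel_eq_christoffel_darboux hw hn hℓ hp ho hx hy hxy⟩
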